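/- Work over $\mathbb{Q}$ and let $S=\{0,1,\infty\}\subset\mathbb{P}^1$. An $SL(2)$-torsor over $\operatorname{Spec} R$ is a rank two vector bundle $E$ with a trivialization of $\det E$; let $BSL(2)$ be the stack of these. Consider the following stacks, described by their groupoids of points over a commutative $\mathbb{Q}$-algebra $R$. - The Betti moduli $\mathrm{Loc}_{SL(2)}(\mathbb{P}^1,S)$ classifies $SL(2)$-local systems over $R$ on the topological space $\mathbb{P}^1(\mathbb{C})\setminus S$ (functors from its fundamental groupoid to the groupoid of $SL(2)$-torsors over $\operatorname{Spec} R$), equipped with a Borel reduction near each $s\in S$ with trivial induced monodromy in the torus, that is, with a locally constant field $\ell_s$ of lines (rank one direct summands of the fibres) on a punctured disc around $s$, such that the monodromy on this disc is trivial on $\ell_s$ and on the quotient by $\ell_s$. It maps to $BSL(2)$ by the fibre at a base point $u_0\in\mathbb{P}^1(\mathbb{C})\setminus S$. - The linearized moduli $T^*((\mathbb{P}^1)^S/SL(2))$ classifies an $SL(2)$-torsor $E$ over $\operatorname{Spec} R$ together with pairs $(B_s,\ell_s)_{s\in S}$, where $\ell_s\subset E$ is a line and $B_s\in\operatorname{End}(E)$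 satisfies $B_s(\ell_s)=0$ and $B_s(E)\subset\ell_s$, such that $B_0+B_1+B_\infty=0$. It maps to $BSL(2)$ by $E$. - The de Rham moduli $\mathrm{Conn}_{SL(2)}(\mathbb{P}^1,S)$ classifies $(\mathcal{E},\tau,(\ell_s)_{s\in S},\nabla)$, where $\mathcal{E}$ is a rank two vector bundle on $\mathbb{P}^1_R$, $\ell_s\subset\mathcal{E}_s$ is a line in the fibre at each $s\in S$, $\nabla:\mathcal{E}\to\mathcal{E}\otimes\Omega_{\mathbb{P}^1_R/R}(S)$ is a connection relative to $R$ with $\operatorname{Res}_s\nabla|_{\ell_s}=0$ for all $s\in S$, and $\tau:\mathcal{O}\simeq\det\mathcal{E}$ is a $\nabla$-flat trivialization. It maps to $BSL(2)$ by the fibre of $(\mathcal{E},\tau)$ at a point $s\in S$. For every choice of $u_0$ and of $s$, these three stacks are isomorphic as stacks over $BSL(2)$. Moreover there is no derived structure to be taken into account: in $\tilde{\mathcal{N}}^S=\{(g_s,\ell_s)_{s\in S}\}$, where $\tilde{\mathcal{N}}\simeq T^*\mathbb{P}^1$ is the Springer resolution of the unipotent (respectively nilpotent) matrices, the derived fibre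 over $1\in SL(2)$ of the map $(A_s,\ell_s)_s\mapsto A_0A_1A_\infty$, which presents the first stack, and the derived fibre over $0\in\mathfrak{sl}(2)$ of the map $(B_s,\ell_s)_s\mapsto B_0+B_1+B_\infty$, which presents the second one, are classical: in each of the eight standard affine charts of $\tilde{\mathcal{N}}^S$ the ideal of the fibre is generated, locally at each of its points, by a regular sequence of length $3$. -/

import Mathlib

open CategoryTheory Polynomial
open scoped LaurentPolynomial

universe u

noncomputable section

namespace Spectral

/-! ### `SL(2)`-torsors: the classifying stack -/

/-- An `SL(2)`-torsor over `Spec R`, in the form of a vector bundle of rank two on `Spec R`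
together with a trivialization of its determinant. -/
structure SLBundle (R : Type u) [CommRing R] where
  /-- the module of sections of the vector bundle -/
  carrier : Type u
  [addCommGroup : AddCommGroup carrier]
  [module : Module R carrier]
  [finite : Module.Finite R carrier]
  [projective : Module.Projective R carrier]
  /-- the rank is two at every point of `Spec R` -/
  rank_eq : ∀ p : PrimeSpectrum R, Module.rankAtStalk carrier p = 2
  /-- the trivialization of the determinant -/
  τ : (⋀[R]^2 carrier) ≃ₗ[R] R

namespace SLBundle

variable {R : Type u} [CommRing R]

instance : CoeSort (SLBundle R) (Type u) := ⟨carrier⟩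
instance (E : SLBundle R) : AddCommGroup E := E.addCommGroup
instance (E : SLBundle R) : Module R E := E.module
instance (E : SLBundle R) : Module.Finite R E := E.finite
instance (E : SLBundle R) : Module.Projective R E := E.projective

/-- The volume form: `vol x y = τ (x ∧ y)`. -/
def vol (E : SLBundle R) (x y : E) : R := E.τ (exteriorPower.ιMulti R 2 ![x, y])

/-- The groupoid of `SL(2)`-torsors over `Spec R`. -/
instance : Category (SLBundle R) where
  Hom E E' := {g : E ≃ₗ[R] E' // ∀ x y, E'.vol (g x) (g y) = E.vol x y}
  id E := ⟨LinearEquiv.refl R E, fun _ _ => rfl⟩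
  comp g h := ⟨g.1.trans h.1, fun x y => (h.2 (g.1 x) (g.1 y)).trans (g.2 x y)⟩

/-- A submodule which is (locally) a direct summand of rank one. -/
structure IsLine (E : SLBundle R) (ℓ : Submodule R E) : Prop where
  projective : Module.Projective R (E ⧸ ℓ)
  rank_eq : ∀ p : PrimeSpectrum R, Module.rankAtStalk ℓ p = 1

end SLBundle

/-- `g : E → E'` covers the homomorphism of rings `f : R → R'`, and it exhibits the
`SL(2)`-torsor `E'` over `Spec R'` as the pullback of the `SL(2)`-torsor `E` over `Spec R`. -/
structure IsCart {R R' : Type u} [CommRing R] [CommRing R'] (f : R →+* R')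
    (E : SLBundle R) (E' : SLBundle R') (g : E →+ E') : Prop where
  map_smul : ∀ (r : R) (x : E), g (r • x) = f r • g x
  /-- the universal property of the extension of scalars `R' ⊗[R] E` -/
  universal : ∀ (Q : Type u) [AddCommGroup Q] [Module R' Q] (h : E →+ Q),
    (∀ (r : R) (x : E), h (r • x) = f r • h x) →
      ∃! h' : E' →ₗ[R'] Q, ∀ x, h' (g x) = h x
  map_vol : ∀ x y : E, E'.vol (g x) (g y) = f (E.vol x y)

namespace IsCart

variable {R R' R'' : Type u} [CommRing R] [CommRing R'] [CommRing R'']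

theorem id (E : SLBundle R) : IsCart (RingHom.id R) E E (AddMonoidHom.id E) where
  map_smul _ _ := rfl
  universal _ _ _ h hh :=
    ⟨{ toFun := h, map_add' := h.map_add, map_smul' := hh }, fun _ => rfl,
      fun _ hk => LinearMap.ext hk⟩
  map_vol _ _ := rfl

theorem comp {f : R →+* R'} {f' : R' →+* R''} {E : SLBundle R} {E' : SLBundle R'}
    {E'' : SLBundle R''} {g : E →+ E'} {g' : E' →+ E''} (hg' : IsCart f' E' E'' g')
    (hg : IsCart f E E' g) : IsCart (f'.comp f) E E'' (g'.comp g) where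
  map_smul r x := by simp [hg.map_smul, hg'.map_smul]
  universal Q _ _ h hh := by
    let _ : Module R' Q := Module.compHom Q f'
    obtain ⟨h₁, hh₁, hu₁⟩ := hg.universal Q h hh
    obtain ⟨h₂, hh₂, hu₂⟩ := hg'.universal Q h₁.toAddMonoidHom (fun r x => h₁.map_smul r x)
    refine ⟨h₂, fun x => (hh₂ (g x)).trans (hh₁ x), fun k hk => hu₂ k fun y => ?_⟩
    have := hu₁ { toFun := fun y => k (g' y)
                  map_add' := fun a b => by simp
                  map_smul' := fun r a => by
                    rw [hg'.map_smul, k.map_smul]; rfl } hk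
    exact LinearMap.congr_fun this y
  map_vol x y := by simp [hg.map_vol, hg'.map_vol]

end IsCart

/-- The classifying stack `BSL(2)` over `ℚ`, as a category (co)fibred in groupoids over the
category of commutative `ℚ`-algebras. -/
structure BSL where
  ring : Type u
  [commRing : CommRing ring]
  [algebra : Algebra ℚ ring]
  /-- the torsor -/
  bundle : SLBundle ring

attribute [instance] BSL.commRing BSL.algebra

namespace BSL

/-- Morphisms of `BSL(2)`. -/
@[ext]
structure Hom (E E' : BSL.{u}) where
  base : E.ring →ₐ[ℚ] E'.ring
  map : E.bundle →+ E'.bundle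
  cart : IsCart base.toRingHom E.bundle E'.bundle map

instance : Category BSL.{u} where
  Hom := Hom
  id E := ⟨AlgHom.id ℚ _, AddMonoidHom.id _, IsCart.id _⟩
  comp g h := ⟨h.base.comp g.base, h.map.comp g.map, h.cart.comp g.cart⟩

end BSL

/-- Two stacks over `ℬ`, given by categories (co)fibred in groupoids `𝒳`, `𝒴` over `ℬ`, are
isomorphic over `ℬ`. (Here `ℬ` is itself (co)fibred in groupoids over the category of test
rings. The isomorphism `e.functor ⋙ q ≅ p` may involve isomorphisms of test rings, but they can
always be removed by transporting the values of `e.functor` along them.) -/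
def IsIsomorphicOver {ℬ 𝒳 𝒴 : Type*} [Category ℬ] [Category 𝒳] [Category 𝒴]
    (p : 𝒳 ⥤ ℬ) (q : 𝒴 ⥤ ℬ) : Prop :=
  ∃ e : 𝒳 ≌ 𝒴, Nonempty (e.functor ⋙ q ≅ p)

/-- The three-element subset `S = {0, 1, ∞}` of the projective line. -/
inductive Pt : Type
  | zero | one | infty

/-! ### The Betti moduli -/

/-- The topological space `ℙ¹(ℂ) ∖ {0, 1, ∞}`. -/
abbrev PuncturedLine : Type := {z : ℂ // z ≠ 0 ∧ z ≠ 1}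

/-- A punctured disc around each of the three points of `S`. -/
def puncturedDisc : Pt → Set PuncturedLine
  | .zero => {z | ‖z.1‖ < 1}
  | .one => {z | ‖z.1 - 1‖ < 1}
  | .infty => {z | 1 < ‖z.1‖}

/-- An `SL(2)`-local system on `ℙ¹ ∖ S` over the ring `R`: a functor from the fundamental
groupoid to the groupoid of `SL(2)`-torsors over `Spec R`. -/
abbrev LocalSystem (R : Type u) [CommRing R] : Type (u + 1) :=
  FundamentalGroupoid PuncturedLine ⥤ SLBundle R

namespace LocalSystem

variable {R : Type u} [CommRing R]

/-- The fibre of a local system at a point. -/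
abbrev fib (L : LocalSystem R) (x : PuncturedLine) : SLBundle R := L.obj ⟨x⟩

/-- The parallel transport along a path. -/
def transport (L : LocalSystem R) {x y : PuncturedLine} (γ : Path x y) : L.fib x ≃ₗ[R] L.fib y :=
  (L.map (FundamentalGroupoid.fromPath (Path.Homotopic.Quotient.mk γ))).1

end LocalSystem

/-- A `Spec R`-point of the Betti moduli `Loc_{SL(2)}(ℙ¹, S)`: an `SL(2)`-local system on
`ℙ¹ ∖ S` with a Borel reduction near each `s ∈ S` (a flat field of lines on the punctured disc
around `s`) such that the induced monodromy on the torus is trivial. -/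
structure BettiPoint (R : Type u) [CommRing R] where
  sys : LocalSystem R
  /-- the Borel reductions; only the values on the punctured discs matter -/
  line : ∀ (s : Pt) (x : puncturedDisc s), Submodule R (sys.fib x)
  isLine : ∀ (s : Pt) (x : puncturedDisc s), (sys.fib x).IsLine (line s x)
  /-- the lines are preserved by parallel transport inside the punctured disc -/
  flat : ∀ (s : Pt) (x y : puncturedDisc s) (γ : Path x.1 y.1), (∀ t, γ t ∈ puncturedDisc s) →
    ∀ v ∈ line s x, sys.transport γ v ∈ line s y
  /-- the monodromy inside the punctured disc is trivial on the line -/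
  unipotent_sub : ∀ (s : Pt) (x : puncturedDisc s) (γ : Path x.1 x.1),
    (∀ t, γ t ∈ puncturedDisc s) → ∀ v ∈ line s x, sys.transport γ v = v
  /-- the monodromy inside the punctured disc is trivial on the quotient by the line -/
  unipotent_quot : ∀ (s : Pt) (x : puncturedDisc s) (γ : Path x.1 x.1),
    (∀ t, γ t ∈ puncturedDisc s) → ∀ v, sys.transport γ v - v ∈ line s x

/-- The Betti moduli `Loc_{SL(2)}(ℙ¹, S)` over `ℚ`, as a category (co)fibred in groupoids over the
category of commutative `ℚ`-algebras. -/
structure Loc where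
  ring : Type u
  [commRing : CommRing ring]
  [algebra : Algebra ℚ ring]
  pt : BettiPoint ring

attribute [instance] Loc.commRing Loc.algebra

namespace Loc

/-- Morphisms of `Loc_{SL(2)}(ℙ¹, S)`. (As the `line`s are direct summands of rank one, the
condition `map_line` forces the pullback of a line to be equal to the other line.) -/
@[ext]
structure Hom (L L' : Loc.{u}) where
  base : L.ring →ₐ[ℚ] L'.ring
  map : ∀ x, L.pt.sys.fib x →+ L'.pt.sys.fib x
  cart : ∀ x, IsCart base.toRingHom (L.pt.sys.fib x) (L'.pt.sys.fib x) (map x)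
  map_transport : ∀ (x y : PuncturedLine) (γ : Path x y) (v : L.pt.sys.fib x),
    map y (L.pt.sys.transport γ v) = L'.pt.sys.transport γ (map x v)
  map_line : ∀ (s : Pt) (x : puncturedDisc s), ∀ v ∈ L.pt.line s x, map x v ∈ L'.pt.line s x

instance : Category Loc.{u} where
  Hom := Hom
  id L := ⟨AlgHom.id ℚ _, fun _ => AddMonoidHom.id _, fun _ => IsCart.id _,
    fun _ _ _ _ => rfl, fun _ _ _ h => h⟩
  comp g h := ⟨h.base.comp g.base, fun x => (h.map x).comp (g.map x),
    fun x => (h.cart x).comp (g.cart x),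
    fun x y γ v => by simp [g.map_transport, h.map_transport],
    fun s x v hv => h.map_line s x _ (g.map_line s x v hv)⟩

/-- The map `Loc_{SL(2)}(ℙ¹, S) → BSL(2)` given by the fibre at the base point `u₀`. -/
def toBSL (u₀ : PuncturedLine) : Loc.{u} ⥤ BSL.{u} where
  obj L := ⟨L.ring, L.pt.sys.fib u₀⟩
  map g := ⟨g.base, g.map u₀, g.cart u₀⟩

end Loc

/-! ### The linearized moduli -/

/-- A `Spec R`-point of `T^*((ℙ¹)^S / SL(2))`, the quotient by `SL(2)` of the zero fibre of the
moment map `T^*((ℙ¹)^S) → sl(2)`. A cotangent vector of `ℙ(E)` at the line `ℓ`, that is, an element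
of `Hom(E / ℓ, ℓ)`, is an endomorphism of `E` which maps `E` into `ℓ` and kills `ℓ`
(an element of the nilpotent radical of the Borel subalgebra of `sl(E)` attached to `ℓ`). -/
structure CotangentPoint (R : Type u) [CommRing R] where
  bundle : SLBundle R
  line : Pt → Submodule R bundle
  isLine : ∀ s, bundle.IsLine (line s)
  B : Pt → (bundle →ₗ[R] bundle)
  B_line : ∀ s, ∀ v ∈ line s, B s v = 0
  B_mem : ∀ s v, B s v ∈ line s
  sum_eq_zero : B .zero + B .one + B .infty = 0

/-- The stack `T^*((ℙ¹)^S / SL(2))` over `ℚ`, as a category (co)fibred in groupoids over the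
category of commutative `ℚ`-algebras. -/
structure Cotangent where
  ring : Type u
  [commRing : CommRing ring]
  [algebra : Algebra ℚ ring]
  pt : CotangentPoint ring

attribute [instance] Cotangent.commRing Cotangent.algebra

namespace Cotangent

/-- Morphisms of `T^*((ℙ¹)^S / SL(2))`. -/
@[ext]
structure Hom (L L' : Cotangent.{u}) where
  base : L.ring →ₐ[ℚ] L'.ring
  map : L.pt.bundle →+ L'.pt.bundle
  cart : IsCart base.toRingHom L.pt.bundle L'.pt.bundle map
  map_line : ∀ s, ∀ v ∈ L.pt.line s, map v ∈ L'.pt.line s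
  map_B : ∀ s v, map (L.pt.B s v) = L'.pt.B s (map v)

instance : Category Cotangent.{u} where
  Hom := Hom
  id L := ⟨AlgHom.id ℚ _, AddMonoidHom.id _, IsCart.id _, fun _ _ h => h, fun _ _ => rfl⟩
  comp g h := ⟨h.base.comp g.base, h.map.comp g.map, h.cart.comp g.cart,
    fun s v hv => h.map_line s _ (g.map_line s v hv),
    fun s v => by simp [g.map_B, h.map_B]⟩

/-- The map `T^*((ℙ¹)^S / SL(2)) → BSL(2)`. -/
def toBSL : Cotangent.{u} ⥤ BSL.{u} where
  obj L := ⟨L.ring, L.pt.bundle⟩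
  map g := ⟨g.base, g.map, g.cart⟩

end Cotangent

/-! ### The de Rham moduli -/

/-- The inclusion `R[u] → R[t, t⁻¹]`, `u ↦ t⁻¹`, of functions on the chart `ℙ¹ ∖ {0}`. -/
def toLaurentInv (R : Type u) [CommRing R] : R[X] →+* R[T;T⁻¹] :=
  (LaurentPolynomial.invert (R := R)).toRingEquiv.toRingHom.comp Polynomial.toLaurent

/-- The homomorphism `R[t, t⁻¹] → R'[t, t⁻¹]` induced by `f : R → R'`. -/
abbrev laurentMap {R R' : Type u} [CommRing R] [CommRing R'] (f : R →+* R') :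
    R[T;T⁻¹] →+* R'[T;T⁻¹] :=
  AddMonoidAlgebra.mapRingHom ℤ f

/-- A rank two vector bundle with trivialized determinant on `ℙ¹_R`: its sections over the charts
`Spec R[t] = ℙ¹ ∖ {∞}`, `Spec R[u] = ℙ¹ ∖ {0}` (where `u = t⁻¹`) and over their intersection
`Spec R[t, t⁻¹]`, with the restriction maps, and its fibres at the points `0`, `1`, `∞`
with the evaluation maps. -/
structure SLBundleP1 (R : Type u) [CommRing R] where
  fin : SLBundle R[X]
  inf : SLBundle R[X]
  mid : SLBundle R[T;T⁻¹]
  resFin : fin →+ mid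
  resInf : inf →+ mid
  cart_resFin : IsCart Polynomial.toLaurent fin mid resFin
  cart_resInf : IsCart (toLaurentInv R) inf mid resInf
  fib : Pt → SLBundle R
  evZero : fin →+ fib .zero
  evOne : fin →+ fib .one
  evInfty : inf →+ fib .infty
  cart_evZero : IsCart (evalRingHom 0) fin (fib .zero) evZero
  cart_evOne : IsCart (evalRingHom 1) fin (fib .one) evOne
  cart_evInfty : IsCart (evalRingHom 0) inf (fib .infty) evInfty

/-- A connection `∇ : E → E ⊗ Ω_{ℙ¹}(S)` relative to `Spec R` on a bundle on `ℙ¹_R`, with respect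
to which the trivialization of the determinant is flat.

The line bundle `Ω_{ℙ¹}(S)` has the basis `ω = dt / (t (t - 1))` on the chart with coordinate `t`
and the basis `ω' = du / (u (u - 1))` on the chart with coordinate `u = t⁻¹`, and `ω = u ω'` on the
intersection. Accordingly `∇` is given by `m ↦ D m ⊗ ω` and by `m ↦ D' m ⊗ ω'` on the two
charts, where `D = nablaFin` and `D' = nablaInf`. On the intersection it is `m ↦ nablaMid m ⊗ ω`. -/
structure LogConnection {R : Type u} [CommRing R] (E : SLBundleP1 R) where
  nablaFin : E.fin →+ E.fin
  nablaInf : E.inf →+ E.inf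
  nablaMid : E.mid →+ E.mid
  leibniz_fin : ∀ (p : R[X]) (m : E.fin),
    nablaFin (p • m) = (X * (X - 1) * derivative p) • m + p • nablaFin m
  leibniz_inf : ∀ (p : R[X]) (m : E.inf),
    nablaInf (p • m) = (X * (X - 1) * derivative p) • m + p • nablaInf m
  /-- the Leibniz rule for the functions `r t ^ n`, where
  `t (t - 1) (d / dt) (r t ^ n) = n r t ^ n (t - 1)` -/
  leibniz_mid : ∀ (r : R) (n : ℤ) (m : E.mid),
    nablaMid ((LaurentPolynomial.C r * LaurentPolynomial.T n) • m) =
      ((n : R[T;T⁻¹]) * LaurentPolynomial.C r * LaurentPolynomial.T n *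
        (LaurentPolynomial.T 1 - 1)) • m +
        (LaurentPolynomial.C r * LaurentPolynomial.T n) • nablaMid m
  res_fin : ∀ m, E.resFin (nablaFin m) = nablaMid (E.resFin m)
  res_inf : ∀ m, E.resInf (nablaInf m) =
    (LaurentPolynomial.T (-1) : R[T;T⁻¹]) • nablaMid (E.resInf m)
  flat_fin : ∀ m n, X * (X - 1) * derivative (E.fin.vol m n) =
    E.fin.vol (nablaFin m) n + E.fin.vol m (nablaFin n)
  flat_inf : ∀ m n, X * (X - 1) * derivative (E.inf.vol m n) =
    E.inf.vol (nablaInf m) n + E.inf.vol m (nablaInf n)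
  /-- the residues of `∇`; the residues of `dt / (t (t - 1))` at `0` and `1` are `-1` and `1`, and
  the residue of `du / (u (u - 1))` at `u = 0` is `-1` -/
  residue : ∀ s, E.fib s →ₗ[R] E.fib s
  residue_zero : ∀ m, residue .zero (E.evZero m) = -E.evZero (nablaFin m)
  residue_one : ∀ m, residue .one (E.evOne m) = E.evOne (nablaFin m)
  residue_infty : ∀ m, residue .infty (E.evInfty m) = -E.evInfty (nablaInf m)

/-- A `Spec R`-point of the de Rham moduli `Conn_{SL(2)}(ℙ¹, S)`. -/
structure DeRhamPoint (R : Type u) [CommRing R] where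
  bundle : SLBundleP1 R
  conn : LogConnection bundle
  line : ∀ s, Submodule R (bundle.fib s)
  isLine : ∀ s, (bundle.fib s).IsLine (line s)
  residue_line : ∀ s, ∀ v ∈ line s, conn.residue s v = 0

/-- The de Rham moduli `Conn_{SL(2)}(ℙ¹, S)` over `ℚ`, as a category (co)fibred in groupoids over
the category of commutative `ℚ`-algebras. -/
structure Conn where
  ring : Type u
  [commRing : CommRing ring]
  [algebra : Algebra ℚ ring]
  pt : DeRhamPoint ring

attribute [instance] Conn.commRing Conn.algebra

namespace Conn

/-- Morphisms of `Conn_{SL(2)}(ℙ¹, S)`. (Residues are preserved automatically.) -/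
@[ext]
structure Hom (L L' : Conn.{u}) where
  base : L.ring →ₐ[ℚ] L'.ring
  mapFin : L.pt.bundle.fin →+ L'.pt.bundle.fin
  mapInf : L.pt.bundle.inf →+ L'.pt.bundle.inf
  mapMid : L.pt.bundle.mid →+ L'.pt.bundle.mid
  mapFib : ∀ s, L.pt.bundle.fib s →+ L'.pt.bundle.fib s
  cart_fin : IsCart (mapRingHom base.toRingHom) _ _ mapFin
  cart_inf : IsCart (mapRingHom base.toRingHom) _ _ mapInf
  cart_mid : IsCart (laurentMap base.toRingHom) _ _ mapMid
  cart_fib : ∀ s, IsCart base.toRingHom _ _ (mapFib s)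
  map_resFin : ∀ m, mapMid (L.pt.bundle.resFin m) = L'.pt.bundle.resFin (mapFin m)
  map_resInf : ∀ m, mapMid (L.pt.bundle.resInf m) = L'.pt.bundle.resInf (mapInf m)
  map_evZero : ∀ m, mapFib .zero (L.pt.bundle.evZero m) = L'.pt.bundle.evZero (mapFin m)
  map_evOne : ∀ m, mapFib .one (L.pt.bundle.evOne m) = L'.pt.bundle.evOne (mapFin m)
  map_evInfty : ∀ m, mapFib .infty (L.pt.bundle.evInfty m) = L'.pt.bundle.evInfty (mapInf m)
  map_nablaFin : ∀ m, mapFin (L.pt.conn.nablaFin m) = L'.pt.conn.nablaFin (mapFin m)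
  map_nablaInf : ∀ m, mapInf (L.pt.conn.nablaInf m) = L'.pt.conn.nablaInf (mapInf m)
  map_line : ∀ s, ∀ v ∈ L.pt.line s, mapFib s v ∈ L'.pt.line s

/-- The identity morphism. -/
def Hom.id (L : Conn.{u}) : Hom L L where
  base := AlgHom.id ℚ _
  mapFin := AddMonoidHom.id _
  mapInf := AddMonoidHom.id _
  mapMid := AddMonoidHom.id _
  mapFib _ := AddMonoidHom.id _
  cart_fin := by
    have h : mapRingHom (AlgHom.id ℚ L.ring).toRingHom = RingHom.id _ := mapRingHom_id
    rw [h]; exact IsCart.id _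
  cart_inf := by
    have h : mapRingHom (AlgHom.id ℚ L.ring).toRingHom = RingHom.id _ := mapRingHom_id
    rw [h]; exact IsCart.id _
  cart_mid := by
    have h : laurentMap (AlgHom.id ℚ L.ring).toRingHom = RingHom.id _ :=
      AddMonoidAlgebra.mapRingHom_id ..
    rw [h]; exact IsCart.id _
  cart_fib _ := IsCart.id _
  map_resFin _ := rfl
  map_resInf _ := rfl
  map_evZero _ := rfl
  map_evOne _ := rfl
  map_evInfty _ := rfl
  map_nablaFin _ := rfl
  map_nablaInf _ := rfl
  map_line _ _ h := h

/-- The composition of morphisms. -/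
def Hom.comp {L L' L'' : Conn.{u}} (g : Hom L L') (h : Hom L' L'') : Hom L L'' where
  base := h.base.comp g.base
  mapFin := h.mapFin.comp g.mapFin
  mapInf := h.mapInf.comp g.mapInf
  mapMid := h.mapMid.comp g.mapMid
  mapFib s := (h.mapFib s).comp (g.mapFib s)
  cart_fin := by
    have e : mapRingHom (h.base.comp g.base).toRingHom =
        (mapRingHom h.base.toRingHom).comp (mapRingHom g.base.toRingHom) :=
      (mapRingHom_comp _ _).symm
    rw [e]; exact h.cart_fin.comp g.cart_fin
  cart_inf := by
    have e : mapRingHom (h.base.comp g.base).toRingHom =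
        (mapRingHom h.base.toRingHom).comp (mapRingHom g.base.toRingHom) :=
      (mapRingHom_comp _ _).symm
    rw [e]; exact h.cart_inf.comp g.cart_inf
  cart_mid := by
    have e : laurentMap (h.base.comp g.base).toRingHom =
        (laurentMap h.base.toRingHom).comp (laurentMap g.base.toRingHom) :=
      AddMonoidAlgebra.mapRingHom_comp ..
    rw [e]; exact h.cart_mid.comp g.cart_mid
  cart_fib s := (h.cart_fib s).comp (g.cart_fib s)
  map_resFin m := by simp [g.map_resFin, h.map_resFin]
  map_resInf m := by simp [g.map_resInf, h.map_resInf]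
  map_evZero m := by simp [g.map_evZero, h.map_evZero]
  map_evOne m := by simp [g.map_evOne, h.map_evOne]
  map_evInfty m := by simp [g.map_evInfty, h.map_evInfty]
  map_nablaFin m := by simp [g.map_nablaFin, h.map_nablaFin]
  map_nablaInf m := by simp [g.map_nablaInf, h.map_nablaInf]
  map_line s v hv := h.map_line s _ (g.map_line s v hv)

instance : Category Conn.{u} where
  Hom := Hom
  id := Hom.id
  comp := Hom.comp

/-- The map `Conn_{SL(2)}(ℙ¹, S) → BSL(2)` given by the fibre of the bundle at the point `s`. -/
def toBSL (s : Pt) : Conn.{u} ⥤ BSL.{u} where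
  obj L := ⟨L.ring, L.pt.bundle.fib s⟩
  map g := ⟨g.base, g.mapFib s, g.cart_fib s⟩

end Conn

/-! ### The derived structure -/

/-- The coordinate ring of a chart `𝔸⁶` of `Ñ^S`: the variables `(s, false)` are the coordinates
of the lines, and the variables `(s, true)` are the coordinates of the cotangent vectors. -/
abbrev ChartRing : Type := MvPolynomial (Pt × Bool) ℚ

/-- A basis vector of the line `ℓ_s`, in one of the eight charts `ε` of `(ℙ¹)^S`: either `(1, x)`
or `(x, 1)`, where `x` is the coordinate of `ℓ_s`. -/
def chartVec (ε : Pt → Bool) (s : Pt) : Fin 2 → ChartRing :=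
  if ε s then ![MvPolynomial.X (s, false), 1] else ![1, MvPolynomial.X (s, false)]

/-- The universal nilpotent matrix which kills `ℓ_s` and has image in `ℓ_s`: it is
`w ↦ a det(v, w) v`, where `v` is the basis vector of `ℓ_s` and `a` is the coordinate of the
cotangent vector. -/
def chartNilp (ε : Pt → Bool) (s : Pt) : Matrix (Fin 2) (Fin 2) ChartRing :=
  (MvPolynomial.X (s, true) : ChartRing) •
    Matrix.vecMulVec (chartVec ε s) ![-chartVec ε s 1, chartVec ε s 0]

/-- The ideal generated by the entries of a matrix. -/
def entriesIdeal {A : Type} [CommRing A] (M : Matrix (Fin 2) (Fin 2) A) : Ideal A :=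
  Ideal.span (Set.range fun ij : Fin 2 × Fin 2 => M ij.1 ij.2)

/-- The ideal of `A_0 A_1 A_∞ = 1` in the chart `ε`, where `A_s` is the universal unipotent
matrix fixing `ℓ_s`. -/
def prodIdeal (ε : Pt → Bool) : Ideal ChartRing :=
  entriesIdeal ((1 + chartNilp ε .zero) * (1 + chartNilp ε .one) * (1 + chartNilp ε .infty) - 1)

/-- The ideal of `B_0 + B_1 + B_∞ = 0` in the chart `ε`, where `B_s` is the universal nilpotent
matrix killing `ℓ_s`. -/
def sumIdeal (ε : Pt → Bool) : Ideal ChartRing :=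
  entriesIdeal (chartNilp ε .zero + chartNilp ε .one + chartNilp ε .infty)

/-- The ideal `I` is, locally at each of the points of its zero locus, generated by a regular
sequence of length `c`. If `I` is the ideal of the fibre over a point of a morphism
`Spec A → Y` with `Y` smooth of dimension `c`, this says that the higher homology of the local
Koszul complexes vanishes, that is, that the derived fibre is equal to the classical one. -/
def IsCompleteIntersection {A : Type} [CommRing A] (I : Ideal A) (c : ℕ) : Prop :=
  ∀ (p : Ideal A) [p.IsPrime], I ≤ p → ∃ rs : List (Localization.AtPrime p),
    rs.length = c ∧ RingTheory.Sequence.IsRegular (Localization.AtPrime p) rs ∧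
      Ideal.ofList rs = I.map (algebraMap A (Localization.AtPrime p))

end Spectral

end

/-! The linearized moduli is compared with each of the two others by an explicit functor, which is
shown to be fully faithful and essentially surjective over all `ℚ`-algebras at once.

De Rham side. To `(E, B_s, ℓ_s)` one attaches the connection `d + B_0 dt/t + B_1 dt/(t-1)` on the
trivial bundle with fibre `E`. Everything rests on the converse: a bundle `𝓔` with a logarithmic
connection as in the de Rham moduli is trivial, because `H⁰(𝓔(-1)) = H¹(𝓔(-1)) = 0`. The residues
are nilpotent: they kill `ℓ_s`, and flatness of the volume makes their trace zero. The module
`H¹(𝓔(-1))` is finitely generated, so if it is non-zero it has a non-zero functional with values in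
a residue field `k`, which has characteristic zero. By Serre duality, written out with generating
polynomials in `exists_eq_add`, this is a non-zero map `𝓔_k → O(-1)`. Choose a non-zero map `𝓔_k →
O(-n)` with `n ≥ 1` maximal; it is surjective. The obstruction to its kernel being `∇`-stable is a
map `∧²𝓔_k → O(1-2n)`, hence zero (`wronskian_eq_zero`), and `∇` induces a connection on `O(-n)`. By
nilpotency this connection has no residues at `0` and `1`, so its residue at `∞` is `n` up to sign,
and that is not nilpotent (`functional_eq_zero`). The vanishing of `H⁰` follows by pairing with `H¹`
through the volume form (`eq_zero_of_resFin_eq`). Thus global sections trivialize `𝓔`, and in this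
frame `∇` is given by its residues, whose sum is zero (`residueZero_spec`).

Betti side. The punctured line is covered by two half planes and three strips, all convex. Gluing
the free group on the strips along this cover gives a universal local system, whose transport is
`winding`. A local system amounts to its fibre at a base point in the upper half plane with an
automorphism `τ_j` for each strip, where `τ_mid = 1` (`transport_chartAt`). Unipotence around `0`,
`1`, `∞` makes `x = 1 - τ_left`, `n = τ_right - 1` and `1 - τ_left⁻¹ τ_right = -(x + n + x n)`
square to zero. This forces `x n + n x = 0` (`mul_eq_neg_mul_of_sq`), just as `B_0² = B_1² = (B_0 +
B_1)² = 0` forces `B_0 B_1 + B_1 B_0 = 0`. So `B_0 = x`, `B_1 = n + x n`, `B_∞ = -(x + n + x n)` has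
sum zero, with inverse `n = B_1 - B_0 B_1`. Here `n` is the conjugate of `B_1` by `1 - B_0 / 2`, and
the same automorphism carries `ℓ_1` along.

Complete intersections. Write the matrix `K` of equations in a basis `v, w` of determinant one,
where `v` spans `ℓ_∞`. One entry is `c + h` and eliminates the cotangent coordinate `c` at `∞`. The
vector `K v` amounts to two equations `f`, `g`, where `f` is prime and does not divide `g`. The last
entry is redundant, because of trace zero for the sum and of determinant one for the product
(`isCompleteIntersection_of_matrix`). -/

noncomputable section

namespace Spectral

/-! ### Volume forms on modules of rank two -/

section VolumeForm

open TensorProduct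

variable {R M : Type*} [CommRing R] [AddCommGroup M] [Module R M]

/-- The wedge product of two vectors. -/
def wedge (R M : Type*) [CommRing R] [AddCommGroup M] [Module R M] :
    M →ₗ[R] M →ₗ[R] ⋀[R]^2 M :=
  have h0 : ∀ x y z : M, Function.update ![x, y] 0 z = ![z, y] := fun x y z => by
    ext i; fin_cases i <;> rfl
  have h1 : ∀ x y z : M, Function.update ![x, y] 1 z = ![x, z] := fun x y z => by
    ext i; fin_cases i <;> rfl
  LinearMap.mk₂ R (fun x y => exteriorPower.ιMulti R 2 ![x, y])
    (fun x x' y => by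
      have := (exteriorPower.ιMulti R 2 (M := M)).map_update_add ![x, y] 0 x x'
      rwa [h0, h0, h0] at this)
    (fun r x y => by
      have := (exteriorPower.ιMulti R 2 (M := M)).map_update_smul ![x, y] 0 r x
      rwa [h0, h0] at this)
    (fun x y y' => by
      have := (exteriorPower.ιMulti R 2 (M := M)).map_update_add ![x, y] 1 y y'
      rwa [h1, h1, h1] at this)
    (fun r x y => by
      have := (exteriorPower.ιMulti R 2 (M := M)).map_update_smul ![x, y] 1 r y
      rwa [h1, h1] at this)

theorem wedge_apply (x y : M) : wedge R M x y = exteriorPower.ιMulti R 2 ![x, y] := rfl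

theorem ιMulti_eq_wedge (v : Fin 2 → M) : exteriorPower.ιMulti R 2 v = wedge R M (v 0) (v 1) := by
  rw [wedge_apply]; congr 1; ext i; fin_cases i <;> rfl

/-- An alternating form on `M` which makes `M` look like a module of rank two with a trivialized
determinant. -/
structure IsVolumeForm (ω : LinearMap.BilinForm R M) : Prop where
  self_eq_zero : ∀ x, ω x x = 0
  -- Cramer's rule for three vectors in a plane. It carries the information that the rank is at most
  -- two, without mention of bases.
  cyclic : ∀ x y z, ω x y • z + ω y z • x + ω z x • y = 0
  exists_sum_eq_one : ∃ (n : ℕ) (x y : Fin n → M), ∑ i, ω (x i) (y i) = 1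

/-- The coefficients of a linear combination of values `ω v w` are absorbed into the vectors `v`,
which stay in `ℓ`. -/
theorem exists_sum_of_mem_span {ω : LinearMap.BilinForm R M} (ℓ : Submodule R M) {r : R}
    (hr : r ∈ Submodule.span R {r | ∃ v ∈ ℓ, ∃ w, ω v w = r}) :
    ∃ (n : ℕ) (x y : Fin n → M), (∀ i, x i ∈ ℓ) ∧ ∑ i, ω (x i) (y i) = r := by
  induction hr using Submodule.span_induction with
  | mem r hr =>
    obtain ⟨v, hv, w, rfl⟩ := hr
    exact ⟨1, fun _ => v, fun _ => w, fun _ => hv, by simp⟩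
  | zero => exact ⟨0, Fin.elim0, Fin.elim0, fun i => i.elim0, by simp⟩
  | add r s _ _ hr hs =>
    obtain ⟨n, x, y, hx, h⟩ := hr
    obtain ⟨m, x', y', hx', h'⟩ := hs
    refine ⟨n + m, Fin.append x x', Fin.append y y', fun i => ?_, ?_⟩
    · induction i using Fin.addCases <;> simp [hx, hx']
    · simp [Fin.sum_univ_add, h, h']
  | smul a r _ hr =>
    obtain ⟨n, x, y, hx, h⟩ := hr
    exact ⟨n, fun i => a • x i, y, fun i => ℓ.smul_mem _ (hx i), by simp [← Finset.mul_sum, h]⟩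

namespace IsVolumeForm

variable {ω : LinearMap.BilinForm R M} (h : IsVolumeForm ω)
include h

theorem neg_eq (x y : M) : -ω x y = ω y x := by
  have := h.self_eq_zero (x + y)
  simp only [map_add, LinearMap.add_apply, h.self_eq_zero] at this
  linear_combination -this

theorem smul_eq (x y z : M) : ω x y • z = ω z y • x - ω z x • y := by
  have := h.cyclic x y z
  rw [← h.neg_eq z y] at this
  rw [← sub_eq_zero, ← this]
  module

/-- Cramer's rule, summed over a family of total volume one. It is the substitute for coordinates in
a basis, which exists only locally. -/
theorem expand {n : ℕ} {x y : Fin n → M} (hxy : ∑ i, ω (x i) (y i) = 1) (z : M) :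
    z = ∑ i, (ω z (y i) • x i - ω z (x i) • y i) := by
  simp_rw [← h.smul_eq, ← Finset.sum_smul, hxy, one_smul]

theorem eq_zero {x : M} (hx : ∀ y, ω x y = 0) : x = 0 := by
  obtain ⟨n, a, b, hab⟩ := h.exists_sum_eq_one
  rw [h.expand hab x]
  simp [hx]

/-- An alternating form is a multiple of the volume form. -/
theorem alternating_eq {Q : Type*} [AddCommGroup Q] [Module R Q] (β : M →ₗ[R] M →ₗ[R] Q)
    (hβ : ∀ x, β x x = 0) {n : ℕ} {a b : Fin n → M} (hab : ∑ i, ω (a i) (b i) = 1) (x y : M) :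
    (2 : R) • β x y = (2 : R) • ω x y • ∑ i, β (a i) (b i) := by
  have hneg : ∀ x y, β y x = -β x y := fun x y => by
    have := hβ (x + y)
    simp only [map_add, LinearMap.add_apply, hβ, zero_add, add_zero] at this
    exact eq_neg_of_add_eq_zero_left this
  -- Repeated use of Cramer's rule inside the arguments of `β` gives the symmetric relation only
  -- after doubling; the factor `2` is cancelled by the callers.
  have key : ∀ z w, (2 : R) • ω z w • β x y = (2 : R) • ω x y • β z w := fun z w => by
    have e1 : ω x y • β z w = ω z y • β x w - ω z x • β y w := by
      have := congr_arg (fun t => β t w) (h.smul_eq x y z)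
      simpa using this
    have e2 : ω z y • β x w = ω w y • β x z - ω w z • β x y := by
      have := congr_arg (fun t => β x t) (h.smul_eq z y w)
      simpa using this
    have e3 : ω z x • β y w = ω w x • β y z - ω w z • β y x := by
      have := congr_arg (fun t => β y t) (h.smul_eq z x w)
      simpa using this
    have e4 : ω x y • β w z = ω w y • β x z - ω w x • β y z := by
      have := congr_arg (fun t => β t z) (h.smul_eq x y w)
      simpa using this
    rw [hneg x y] at e3
    rw [hneg z w] at e4
    rw [← h.neg_eq z w] at e2 e3
    have : ω x y • β z w + ω x y • β z w = ω z w • β x y + ω z w • β x y := by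
      nth_rw 1 [e1]
      rw [e2, e3]
      have : ω x y • β z w = - (ω w y • β x z - ω w x • β y z) := by rw [← e4]; simp
      rw [this]; module
    rw [two_smul, two_smul, this]
  rw [Finset.smul_sum, Finset.smul_sum]
  simp_rw [← key, ← smul_assoc, ← Finset.sum_smul, ← Finset.smul_sum, hab]
  simp

/-- The alternating map of a volume form. -/
def alternatingMap : M [⋀^Fin 2]→ₗ[R] R where
  toFun v := ω (v 0) (v 1)
  map_update_add' v i x y := by fin_cases i <;> simp [Function.update]
  map_update_smul' v i c x := by fin_cases i <;> simp [Function.update]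
  map_eq_zero_of_eq' v i j hv hij := by
    fin_cases i <;> fin_cases j <;> simp_all [h.self_eq_zero]

@[simp] theorem alternatingMap_apply (v : Fin 2 → M) : h.alternatingMap v = ω (v 0) (v 1) := rfl

/-- The trivialization of the determinant which belongs to a volume form. -/
def exteriorEquiv (h2 : IsUnit (2 : R)) : (⋀[R]^2 M) ≃ₗ[R] R := by
  refine LinearEquiv.ofBijective (exteriorPower.alternatingMapLinearEquiv h.alternatingMap) ?_
  obtain ⟨n, a, b, hab⟩ := h.exists_sum_eq_one
  set T := exteriorPower.alternatingMapLinearEquiv h.alternatingMap with hT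
  have hTι : ∀ v : Fin 2 → M, T (exteriorPower.ιMulti R 2 v) = ω (v 0) (v 1) := fun v => by
    rw [hT, exteriorPower.alternatingMapLinearEquiv_apply_ιMulti, alternatingMap_apply]
  -- An element of volume one. It generates the exterior square, because the wedge product is an
  -- alternating form and hence a multiple of `ω`.
  let c : ⋀[R]^2 M := ∑ i, exteriorPower.ιMulti R 2 ![a i, b i]
  have hc : T c = 1 := by simp [c, hTι, hab]
  have key : ∀ z, z = T z • c := fun z => by
    have hz : z ∈ Submodule.span R (Set.range (exteriorPower.ιMulti R 2 (M := M))) := by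
      rw [exteriorPower.ιMulti_span]; trivial
    induction hz using Submodule.span_induction with
    | mem z hz =>
      obtain ⟨v, rfl⟩ := hz
      have := h.alternating_eq (wedge R M) (fun x =>
        (exteriorPower.ιMulti R 2).map_eq_zero_of_eq ![x, x] (i := 0) (j := 1) rfl (by simp))
        hab (v 0) (v 1)
      rw [hTι, ιMulti_eq_wedge]
      exact h2.smul_left_cancel.1 this
    | zero => simp
    | add x y _ _ hx hy => rw [map_add, add_smul, ← hx, ← hy]
    | smul r x _ hx => rw [map_smul, smul_assoc, ← hx]
  refine ⟨(injective_iff_map_eq_zero T).2 fun z hz => by rw [key z, hz, zero_smul], fun r =>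
    ⟨r • c, by simp [hc]⟩⟩

@[simp] theorem exteriorEquiv_ιMulti (h2 : IsUnit (2 : R)) (v : Fin 2 → M) :
    h.exteriorEquiv h2 (exteriorPower.ιMulti R 2 v) = ω (v 0) (v 1) := by
  change exteriorPower.alternatingMapLinearEquiv h.alternatingMap _ = _
  rw [exteriorPower.alternatingMapLinearEquiv_apply_ιMulti, alternatingMap_apply]

theorem baseChange (A : Type*) [CommRing A] [Algebra R A] :
    IsVolumeForm (LinearMap.BilinForm.baseChange A ω) := by
  -- The condition `ω x x = 0` is not additive in `x`. Antisymmetry is needed first, so that the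
  -- cross terms of a sum cancel.
  have hneg : ∀ x y : A ⊗[R] M, LinearMap.BilinForm.baseChange A ω y x =
      -LinearMap.BilinForm.baseChange A ω x y := fun x y => by
    induction x with
    | zero => simp
    | add x x' hx hx' => simp only [map_add, LinearMap.add_apply, hx, hx', neg_add]
    | tmul a x =>
      induction y with
      | zero => simp
      | add y y' hy hy' => simp only [map_add, LinearMap.add_apply, hy, hy', neg_add]
      | tmul b y => simp [LinearMap.BilinForm.baseChange_tmul, ← h.neg_eq x y, mul_comm]
  refine ⟨fun x => ?_, fun x y z => ?_, ?_⟩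
  · induction x with
    | zero => simp
    | add x x' hx hx' => simp [hx, hx', hneg x x']
    | tmul a x => simp [LinearMap.BilinForm.baseChange_tmul, h.self_eq_zero]
  · induction x with
    | zero => simp
    | add x x' hx hx' =>
      rw [← add_zero (0 : A ⊗[R] M)]
      nth_rw 1 [← hx]; rw [← hx']
      simp only [map_add, LinearMap.add_apply, add_smul, smul_add]; abel
    | tmul a x =>
      induction y with
      | zero => simp
      | add y y' hy hy' =>
        rw [← add_zero (0 : A ⊗[R] M)]
        nth_rw 1 [← hy]; rw [← hy']
        simp only [map_add, LinearMap.add_apply, add_smul, smul_add]; abel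
      | tmul b y =>
        induction z with
        | zero => simp
        | add z z' hz hz' =>
          rw [← add_zero (0 : A ⊗[R] M)]
          nth_rw 1 [← hz]; rw [← hz']
          simp only [map_add, LinearMap.add_apply, add_smul, smul_add]; abel
        | tmul c z =>
          have := congr_arg (fun t => (a * b * c) ⊗ₜ[R] t) (h.cyclic x y z)
          simp only [tmul_add, tmul_zero, tmul_smul] at this
          rw [← this]
          simp only [LinearMap.BilinForm.baseChange_tmul, smul_tmul', smul_eq_mul,
            Algebra.smul_def]
          congr 1
          · congr 1 <;> congr 1 <;> ring
          · congr 1; ring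
  · obtain ⟨n, a, b, hab⟩ := h.exists_sum_eq_one
    refine ⟨n, fun i => 1 ⊗ₜ a i, fun i => 1 ⊗ₜ b i, ?_⟩
    simp only [LinearMap.BilinForm.baseChange_tmul]
    simp [← Finset.sum_smul, hab]

end IsVolumeForm

/-- The annihilator of `w` lies in no maximal ideal. This reduces identities to the stalks. -/
theorem eq_zero_of_forall_prime {w : M}
    (hw : ∀ p : PrimeSpectrum R, ∃ s ∉ p.asIdeal, s • w = 0) : w = 0 := by
  let I : Ideal R := LinearMap.ker (LinearMap.toSpanSingleton R M w)
  by_cases hI : I = ⊤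
  · have : (1 : R) ∈ I := by rw [hI]; trivial
    simpa [I] using this
  · obtain ⟨m, hm, hIm⟩ := I.exists_le_maximal hI
    obtain ⟨s, hs, hsw⟩ := hw ⟨m, hm.isPrime⟩
    exact absurd (hIm (by simpa [I] using hsw)) hs

/-- The stalk is free of rank `n`. Clearing denominators in a basis gives vectors of `M` which span
it up to factors outside `p`. -/
theorem exists_smul_mem_span_of_rankAtStalk [Module.Finite R M] [Module.Projective R M]
    (p : PrimeSpectrum R) {n : ℕ} (hn : Module.rankAtStalk M p = n) :
    ∃ (e : Fin n → M), ∀ x : M, ∃ s ∉ p.asIdeal, s • x ∈ Submodule.span R (Set.range e) := by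
  let Rp := Localization.AtPrime p.asIdeal
  let f := LocalizedModule.mkLinearMap p.asIdeal.primeCompl M
  have hfree : Module.Free Rp (LocalizedModule p.asIdeal.primeCompl M) :=
    Module.free_of_flat_of_isLocalRing
  let b : Module.Basis (Fin n) Rp (LocalizedModule p.asIdeal.primeCompl M) :=
    Module.finBasisOfFinrankEq _ _ hn
  choose e he using fun i => IsLocalizedModule.surj p.asIdeal.primeCompl f (b i)
  refine ⟨fun i => (e i).1, fun x => ?_⟩
  obtain ⟨t, ht⟩ := IsLocalization.exist_integer_multiples_of_finite p.asIdeal.primeCompl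
    (fun i => b.repr (f x) i * IsLocalization.mk' Rp 1 (e i).2)
  choose a ha using ht
  have hfe : ∀ i, b i = IsLocalization.mk' Rp 1 (e i).2 • f (e i).1 := fun i => by
    rw [← he i]
    change _ = _ • ((e i).2 : R) • b i
    rw [← algebraMap_smul Rp ((e i).2 : R), ← mul_smul, IsLocalization.mk'_spec, map_one, one_smul]
  have h1 : f ((t : R) • x) = f (∑ i, a i • (e i).1) := by
    rw [map_smul, map_sum]
    conv_lhs => rw [← b.sum_repr (f x)]
    rw [Finset.smul_sum]
    refine Finset.sum_congr rfl fun i _ => ?_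
    rw [map_smul, ← algebraMap_smul Rp (a i), ha i, hfe i]
    simp only [smul_smul, smul_assoc]
  obtain ⟨c, hc⟩ := (IsLocalizedModule.eq_iff_exists p.asIdeal.primeCompl f).1 h1
  refine ⟨c * t, (c * t).2, ?_⟩
  rw [mul_smul]
  change c • (t : R) • x ∈ _
  rw [hc]
  exact Submodule.smul_mem _ _ (Submodule.sum_mem _ fun i _ =>
    Submodule.smul_mem _ _ (Submodule.subset_span ⟨i, rfl⟩))

end VolumeForm

/-! ### The volume form of an `SL(2)`-torsor, and its lines -/

namespace SLBundle

variable {R : Type u} [CommRing R] (E : SLBundle R)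

/-- The volume form as a bilinear form. -/
def volForm : LinearMap.BilinForm R E :=
  (wedge R E).compr₂ E.τ.toLinearMap

@[simp] theorem volForm_apply (x y : E) : E.volForm x y = E.vol x y := rfl

/-- Cramer's rule may be checked locally, where all vectors are combinations of two. The values
generate the unit ideal since the wedges span the exterior square and `τ` is onto. -/
theorem isVolumeForm : IsVolumeForm E.volForm := by
  have halt : ∀ x, E.volForm x x = 0 := fun x => by
    rw [volForm_apply, vol, (exteriorPower.ιMulti R 2 (M := E)).map_eq_zero_of_eq ![x, x]
      (i := 0) (j := 1) rfl (by simp), map_zero]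
  have hneg : ∀ x y, E.volForm y x = -E.volForm x y := fun x y => by
    have := halt (x + y)
    simp only [map_add, LinearMap.add_apply, halt] at this
    linear_combination this
  refine ⟨halt, fun x y z => ?_, ?_⟩
  · refine eq_zero_of_forall_prime (R := R) fun p => ?_
    obtain ⟨e, he⟩ := exists_smul_mem_span_of_rankAtStalk p (E.rank_eq p)
    have he' : ∀ x : E, ∃ s ∉ p.asIdeal, ∃ a b : R, s • x = a • e 0 + b • e 1 := fun x => by
      obtain ⟨s, hs, hsx⟩ := he x
      have : Set.range e = {e 0, e 1} := by
        ext; simp [Fin.exists_fin_two, eq_comm]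
      rw [this, Submodule.mem_span_pair] at hsx
      obtain ⟨a, b, hab⟩ := hsx
      exact ⟨s, hs, a, b, hab.symm⟩
    obtain ⟨s, hs, a, b, hx⟩ := he' x
    obtain ⟨s', hs', a', b', hy⟩ := he' y
    obtain ⟨s'', hs'', a'', b'', hz⟩ := he' z
    refine ⟨s * s' * s'', ?_, ?_⟩
    · exact fun hh => (p.2.mem_or_mem hh).elim (fun hh => (p.2.mem_or_mem hh).elim hs hs') hs''
    · have e1 : s * s' * E.volForm x y = E.volForm (s • x) (s' • y) := by simp; ring
      have e2 : s' * s'' * E.volForm y z = E.volForm (s' • y) (s'' • z) := by simp; ring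
      have e3 : s'' * s * E.volForm z x = E.volForm (s'' • z) (s • x) := by simp; ring
      have : (s * s' * s'') • (E.volForm x y • z + E.volForm y z • x + E.volForm z x • y) =
          (s * s' * E.volForm x y) • s'' • z + (s' * s'' * E.volForm y z) • s • x +
            (s'' * s * E.volForm z x) • s' • y := by module
      rw [this, e1, e2, e3, hx, hy, hz]
      simp only [map_add, map_smul, LinearMap.add_apply, LinearMap.smul_apply, halt, smul_eq_mul,
        hneg (e 0) (e 1), mul_zero, add_zero, zero_add]
      module
  · have h1 : (1 : R) ∈ Submodule.span R
        {r | ∃ v ∈ (⊤ : Submodule R E), ∃ w, E.volForm v w = r} := by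
      obtain ⟨c, hc⟩ := E.τ.surjective 1
      have : c ∈ Submodule.span R (Set.range (exteriorPower.ιMulti R 2 (M := E))) := by
        rw [exteriorPower.ιMulti_span]; trivial
      rw [← hc]
      refine (Submodule.span_le (p := Submodule.comap E.τ.toLinearMap (Submodule.span R
        {r | ∃ v ∈ (⊤ : Submodule R E), ∃ w, E.volForm v w = r}))).2 ?_ this
      rintro _ ⟨v, rfl⟩
      exact Submodule.subset_span ⟨v 0, trivial, v 1, by rw [ιMulti_eq_wedge]; rfl⟩
    obtain ⟨n, x, y, -, hxy⟩ := exists_sum_of_mem_span _ h1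
    exact ⟨n, x, y, hxy⟩

theorem vol_add_left (x y z : E) : E.vol (x + y) z = E.vol x z + E.vol y z :=
  E.volForm.map_add₂ x y z
theorem vol_add_right (x y z : E) : E.vol x (y + z) = E.vol x y + E.vol x z :=
  (E.volForm x).map_add y z
theorem vol_smul_left (r : R) (x z : E) : E.vol (r • x) z = r * E.vol x z :=
  E.volForm.map_smul₂ r x z
theorem vol_smul_right (r : R) (x z : E) : E.vol x (r • z) = r * E.vol x z :=
  (E.volForm x).map_smul r z
theorem vol_neg (x y : E) : -E.vol x y = E.vol y x := E.isVolumeForm.neg_eq x y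
theorem vol_self (x : E) : E.vol x x = 0 := E.isVolumeForm.self_eq_zero x

end SLBundle

open TensorProduct in
/-- The pullback of an `SL(2)`-torsor. -/
def SLBundle.baseChange {R : Type u} [CommRing R] (E : SLBundle R) (A : Type u) [CommRing A]
    [Algebra R A] (h2 : IsUnit (2 : A)) : SLBundle A where
  carrier := A ⊗[R] E
  rank_eq p := by rw [Module.rankAtStalk_baseChange, E.rank_eq]
  τ := (E.isVolumeForm.baseChange A).exteriorEquiv h2

namespace SLBundle

variable {R : Type u} [CommRing R] {E : SLBundle R}

theorem baseChange_vol (A : Type u) [CommRing A] [Algebra R A] (h2 : IsUnit (2 : A))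
    (x y : E.baseChange A h2) :
    (E.baseChange A h2).vol x y = LinearMap.BilinForm.baseChange A E.volForm x y :=
  (E.isVolumeForm.baseChange A).exteriorEquiv_ιMulti h2 _

theorem eq_zero_of_vol {x : E} (h : ∀ y, E.vol x y = 0) : x = 0 := E.isVolumeForm.eq_zero h

namespace IsLine

variable {ℓ : Submodule R E} (h : E.IsLine ℓ)
include h

theorem exists_projection : ∃ π : E →ₗ[R] ℓ, ∀ v : ℓ, π v = v := by
  have := h.projective
  obtain ⟨g, hg⟩ := Module.projective_lifting_property ℓ.mkQ LinearMap.id ℓ.mkQ_surjective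
  have hg' : ∀ y, ℓ.mkQ (g y) = y := fun y => LinearMap.congr_fun hg y
  refine ⟨LinearMap.codRestrict ℓ (LinearMap.id - g ∘ₗ ℓ.mkQ) fun x => ?_, fun v => ?_⟩
  · rw [← Submodule.Quotient.mk_eq_zero, ← Submodule.mkQ_apply]
    simp only [LinearMap.sub_apply, LinearMap.id_apply, LinearMap.comp_apply, map_sub, hg', sub_self]
  · ext
    have : ℓ.mkQ (v : E) = 0 := by simp
    simp [this]

theorem finite : Module.Finite R ℓ := by
  obtain ⟨π, hπ⟩ := h.exists_projection
  exact Module.Finite.of_surjective π fun v => ⟨v, hπ v⟩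

theorem projective_line : Module.Projective R ℓ := by
  obtain ⟨π, hπ⟩ := h.exists_projection
  exact Module.Projective.of_split ℓ.subtype π (LinearMap.ext hπ)

/-- Locally `v` and `w` are multiples of one vector, and the volume is alternating. -/
theorem vol_eq_zero {v w : E} (hv : v ∈ ℓ) (hw : w ∈ ℓ) : E.vol v w = 0 := by
  have := h.finite
  have := h.projective_line
  refine eq_zero_of_forall_prime (R := R) fun p => ?_
  obtain ⟨e, he⟩ := exists_smul_mem_span_of_rankAtStalk p (h.rank_eq p)
  have he' : ∀ x : ℓ, ∃ s ∉ p.asIdeal, ∃ a : R, a • e 0 = s • x := fun x => by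
    obtain ⟨s, hs, hsx⟩ := he x
    have : Set.range e = {e 0} := by ext; simp [eq_comm]
    rw [this, Submodule.mem_span_singleton] at hsx
    exact ⟨s, hs, hsx⟩
  obtain ⟨s, hs, a, ha⟩ := he' ⟨v, hv⟩
  obtain ⟨t, ht, b, hb⟩ := he' ⟨w, hw⟩
  refine ⟨s * t, fun hh => (p.2.mem_or_mem hh).elim hs ht, ?_⟩
  have ha' : a • (e 0 : E) = s • v := congr_arg Subtype.val ha
  have hb' : b • (e 0 : E) = t • w := congr_arg Subtype.val hb
  have : (s * t) • E.vol v w = E.vol (s • v) (t • w) := by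
    rw [vol_smul_left, vol_smul_right, smul_eq_mul]; ring
  rw [this, ← ha', ← hb', vol_smul_left, vol_smul_right, vol_self, mul_zero, mul_zero]

/-- Let `J` be the ideal generated by the volumes `vol v w` with `v ∈ ℓ`. Expanding `v ∈ ℓ` and
projecting back to `ℓ` gives `ℓ = J ℓ`. If `J` were proper, Nakayama's lemma would make `ℓ` vanish
at a maximal ideal containing `J`, against rank one. -/
theorem exists_sum_eq_one :
    ∃ (n : ℕ) (x y : Fin n → E), (∀ i, x i ∈ ℓ) ∧ ∑ i, E.vol (x i) (y i) = 1 := by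
  have hfin := h.finite
  obtain ⟨π, hπ⟩ := h.exists_projection
  refine exists_sum_of_mem_span (ω := E.volForm) ℓ ?_
  set J : Ideal R := Submodule.span R {r | ∃ v ∈ ℓ, ∃ w, E.volForm v w = r} with hJ
  obtain ⟨n, a, b, hab⟩ := E.isVolumeForm.exists_sum_eq_one
  have hle : (⊤ : Submodule R ℓ) ≤ J • ⊤ := fun v _ => by
    have hv : v = ∑ i, (E.volForm v (b i) • π (a i) - E.volForm v (a i) • π (b i)) := by
      conv_lhs => rw [← hπ v, E.isVolumeForm.expand hab (v : E)]
      simp only [map_sum, map_sub, map_smul]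
    rw [hv]
    exact Submodule.sum_mem _ fun i _ => Submodule.sub_mem _
      (Submodule.smul_mem_smul (Submodule.subset_span ⟨v, v.2, _, rfl⟩) trivial)
      (Submodule.smul_mem_smul (Submodule.subset_span ⟨v, v.2, _, rfl⟩) trivial)
  obtain ⟨r, hr, hr0⟩ := Submodule.exists_sub_one_mem_and_smul_eq_zero_of_fg_of_le_smul J ⊤
    hfin.fg_top hle
  by_contra hne
  obtain ⟨m, hm, hJm⟩ := J.exists_le_maximal ((Ideal.ne_top_iff_one J).2 hne)
  have hproj := h.projective_line
  have hrank := h.rank_eq ⟨m, hm.isPrime⟩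
  have : Module.rankAtStalk ℓ (⟨m, hm.isPrime⟩ : PrimeSpectrum R) = 0 := by
    rw [Module.rankAtStalk_eq_zero_iff_notMem_support, Module.notMem_support_iff']
    intro v
    refine ⟨r, fun hrm => hm.ne_top ((Ideal.eq_top_iff_one m).2 ?_), hr0 v trivial⟩
    have := m.sub_mem hrm (hJm hr)
    simpa using this
  omega

/-- A line is its own orthogonal: in the expansion of `x` along a family with first members in `ℓ`,
the coefficients of the second members vanish. -/
theorem mem_iff {x : E} : x ∈ ℓ ↔ ∀ v ∈ ℓ, E.vol x v = 0 := by
  refine ⟨fun hx v hv => h.vol_eq_zero hx hv, fun hx => ?_⟩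
  obtain ⟨n, a, b, ha, hab⟩ := h.exists_sum_eq_one
  rw [E.isVolumeForm.expand hab x]
  refine Submodule.sum_mem _ fun i _ => ?_
  rw [volForm_apply, volForm_apply, hx _ (ha i), zero_smul, sub_zero]
  exact ℓ.smul_mem _ (ha i)

theorem map {E' : SLBundle R} (e : E ≃ₗ[R] E') : E'.IsLine (ℓ.map (e : E →ₗ[R] E')) where
  projective := by
    have := h.projective
    exact Module.Projective.of_equiv (Submodule.Quotient.equiv ℓ _ e rfl)
  rank_eq p := by
    have := h.finite
    have := h.projective_line
    rw [← h.rank_eq p]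
    exact (congr_fun (Module.rankAtStalk_eq_of_equiv (e.submoduleMap ℓ)) p).symm

/-- This is trace zero. Applying `B` to Cramer's rule for `x`, `y` and a vector of `ℓ` leaves only a
relation that exchanges `x` and `y`. -/
theorem vol_map_add {B : E →ₗ[R] E} (hB : ∀ v ∈ ℓ, B v = 0) (hB' : ∀ v, B v ∈ ℓ) (x y : E) :
    E.vol (B x) y + E.vol x (B y) = 0 := by
  obtain ⟨n, a, b, ha, hab⟩ := h.exists_sum_eq_one
  have key : ∀ x y, E.vol (B x) y = ∑ i, E.vol (b i) (B x) * E.vol y (a i) := fun x y => by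
    conv_lhs => rw [E.isVolumeForm.expand hab (B x)]
    rw [← volForm_apply, map_sum, LinearMap.sum_apply]
    refine Finset.sum_congr rfl fun i _ => ?_
    rw [volForm_apply, volForm_apply, volForm_apply, h.vol_eq_zero (hB' x) (ha i), zero_smul,
      sub_zero, vol_smul_left, ← E.vol_neg (B x) (b i), ← E.vol_neg (a i) y]
    ring
  have hsymm : ∀ i, E.vol y (a i) • B x = E.vol x (a i) • B y := fun i => by
    have := congr_arg B (E.isVolumeForm.cyclic x y (a i))
    simp only [map_add, map_smul, hB _ (ha i), smul_zero, zero_add, map_zero, volForm_apply] at this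
    rw [← E.vol_neg x (a i), neg_smul] at this
    exact add_neg_eq_zero.1 this
  rw [← E.vol_neg (B y) x, key x y, key y x, ← sub_eq_add_neg, sub_eq_zero]
  refine Finset.sum_congr rfl fun i _ => ?_
  have := congr_arg (E.vol (b i)) (hsymm i)
  rw [vol_smul_right, vol_smul_right] at this
  linear_combination this

/-- An endomorphism of trace zero which kills the line maps into the line. -/
theorem mem_of_vol_map_add {B : E →ₗ[R] E} (hB : ∀ v ∈ ℓ, B v = 0)
    (hB' : ∀ x y, E.vol (B x) y + E.vol x (B y) = 0) (x : E) : B x ∈ ℓ := by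
  refine h.mem_iff.2 fun v hv => ?_
  have := hB' x v
  have h0 : E.vol x 0 = 0 := (E.volForm x).map_zero
  rwa [hB v hv, h0, add_zero] at this

end IsLine

end SLBundle

/-! ### Pullbacks of `SL(2)`-torsors -/

namespace IsCart

variable {R R' R'' : Type u} [CommRing R] [CommRing R'] [CommRing R'']
  {f : R →+* R'} {E : SLBundle R} {E' : SLBundle R'} {g : E →+ E'}

theorem of_linearEquiv {E E' : SLBundle R} (e : E ≃ₗ[R] E')
    (he : ∀ x y, E'.vol (e x) (e y) = E.vol x y) :
    IsCart (RingHom.id R) E E' (e : E →ₗ[R] E').toAddMonoidHom where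
  map_smul r x := e.map_smul r x
  universal Q _ _ h hh :=
    ⟨{ toFun := fun y => h (e.symm y)
       map_add' := by simp
       map_smul' := fun r y => by simp [hh] }, fun x => congr_arg h (e.symm_apply_apply x),
      fun k hk => LinearMap.ext fun y => by
        have := hk (e.symm y)
        simpa using this⟩
  map_vol := he

/-- The projection to the quotient by the span and the zero map both extend the zero map on `E`, so
they agree by uniqueness. -/
theorem span_range (hg : IsCart f E E' g) : Submodule.span R' (Set.range g) = ⊤ := by
  set N := Submodule.span R' (Set.range g)
  obtain ⟨k, -, hk⟩ := hg.universal (E' ⧸ N) 0 fun r x => by simp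
  have h1 := hk N.mkQ fun x => by
    have : g x ∈ N := Submodule.subset_span ⟨x, rfl⟩
    simpa using this
  have h2 := hk 0 fun x => rfl
  rw [← Submodule.ker_mkQ N, h1, ← h2, LinearMap.ker_zero]

/-- Additive identities on a pullback need only be tested on vectors `r • g x`. Most compatibilities
below are proved in this way. -/
theorem induction (hg : IsCart f E E' g) {P : E' → Prop} (zero : P 0)
    (add : ∀ x y, P x → P y → P (x + y)) (smul : ∀ (r : R') x, P (r • g x)) (y : E') : P y := by
  have hy : y ∈ Submodule.span R' (Set.range g) := by rw [hg.span_range]; trivial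
  rw [← Set.image_univ] at hy
  obtain ⟨l, -, rfl⟩ := (Finsupp.mem_span_image_iff_linearCombination R').1 hy
  rw [Finsupp.linearCombination_apply]
  exact Finset.sum_induction _ P add zero fun x _ => smul _ _

theorem hom_ext (hg : IsCart f E E' g) {Q : Type*} [AddCommGroup Q] {k k' : E' →+ Q}
    (h : ∀ (r : R') x, k (r • g x) = k' (r • g x)) : k = k' :=
  AddMonoidHom.ext fun y => hg.induction (P := fun y => k y = k' y) (by simp)
    (fun x y hx hy => by simp [hx, hy]) h y

theorem surjective (hg : IsCart f E E' g) (hf : Function.Surjective f) :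
    Function.Surjective g := fun y => by
  refine hg.induction (P := fun y => ∃ x, g x = y) ⟨0, map_zero g⟩ ?_ ?_ y
  · rintro _ _ ⟨x, rfl⟩ ⟨y, rfl⟩
    exact ⟨x + y, map_add g x y⟩
  · intro r x
    obtain ⟨r, rfl⟩ := hf r
    exact ⟨r • x, hg.map_smul r x⟩

theorem injective (hg : IsCart f E E' g) (hf : Function.Injective f) :
    Function.Injective g := (injective_iff_map_eq_zero g).2 fun x hx => by
  refine E.eq_zero_of_vol fun y => hf ?_
  rw [← hg.map_vol, hx, map_zero]
  exact E'.volForm.map_zero₂ _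

/-- The universal property for targets over a third ring, seen as modules over `R'` by restriction
along `f'`. -/
theorem exists_lift (hg : IsCart f E E' g) (f' : R' →+* R'') {Q : Type u} [AddCommGroup Q]
    [Module R'' Q] (h : E →+ Q) (hh : ∀ (r : R) x, h (r • x) = f' (f r) • h x) :
    ∃ k : E' →+ Q, ∀ (r : R') x, k (r • g x) = f' r • h x := by
  let _ : Module R' Q := Module.compHom Q f'
  obtain ⟨k, hk, -⟩ := hg.universal Q h hh
  exact ⟨k.toAddMonoidHom, fun r x => (k.map_smul r (g x)).trans (by rw [hk]; rfl)⟩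

/-- The extension of a semilinear map. -/
def lift (hg : IsCart f E E' g) (f' : R' →+* R'') {Q : Type u} [AddCommGroup Q]
    [Module R'' Q] (h : E →+ Q) (hh : ∀ (r : R) x, h (r • x) = f' (f r) • h x) : E' →+ Q :=
  (hg.exists_lift f' h hh).choose

theorem lift_smul_map (hg : IsCart f E E' g) (f' : R' →+* R'') {Q : Type u} [AddCommGroup Q]
    [Module R'' Q] (h : E →+ Q) (hh : ∀ (r : R) x, h (r • x) = f' (f r) • h x) (r : R') (x : E) :
    hg.lift f' h hh (r • g x) = f' r • h x :=
  (hg.exists_lift f' h hh).choose_spec r x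

theorem lift_map (hg : IsCart f E E' g) (f' : R' →+* R'') {Q : Type u} [AddCommGroup Q]
    [Module R'' Q] (h : E →+ Q) (hh : ∀ (r : R) x, h (r • x) = f' (f r) • h x) (x : E) :
    hg.lift f' h hh (g x) = h x := by
  have := hg.lift_smul_map f' h hh 1 x
  simpa using this

theorem lift_smul (hg : IsCart f E E' g) (f' : R' →+* R'') {Q : Type u} [AddCommGroup Q]
    [Module R'' Q] (h : E →+ Q) (hh : ∀ (r : R) x, h (r • x) = f' (f r) • h x) (r : R') (y : E') :
    hg.lift f' h hh (r • y) = f' r • hg.lift f' h hh y := by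
  refine hg.induction (P := fun y => hg.lift f' h hh (r • y) = f' r • hg.lift f' h hh y)
    (by simp) (fun x y hx hy => by simp [hx, hy]) (fun s x => ?_) y
  rw [smul_smul, lift_smul_map, lift_smul_map, map_mul, mul_smul]

/-- Cancellation: a map out of a pullback is itself a pullback as soon as the composite is one. -/
theorem of_comp (hg : IsCart f E E' g) {f' : R' →+* R''} {E'' : SLBundle R''} {k : E' →+ E''}
    (hk : ∀ (r : R') y, k (r • y) = f' r • k y) (hkg : IsCart (f'.comp f) E E'' (k.comp g)) :
    IsCart f' E' E'' k where
  map_smul := hk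
  universal Q _ _ h hh := by
    obtain ⟨l, hl, hu⟩ := hkg.universal Q (h.comp g) fun r x => by
      simp [hg.map_smul, hh]
    refine ⟨l, fun y => ?_, fun l' hl' => hu l' fun x => hl' (g x)⟩
    refine hg.induction (P := fun y => l (k y) = h y) (by simp)
      (fun x y hx hy => by simp [hx, hy]) (fun r x => ?_) y
    rw [hk, hh, l.map_smul]
    exact congr_arg _ (hl x)
  map_vol x y := by
    refine hg.induction (P := fun x => E''.vol (k x) (k y) = f' (E'.vol x y)) ?_ ?_ ?_ x
    · rw [map_zero]
      exact (E''.volForm.map_zero₂ _).trans ((map_zero f').symm.trans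
        (congr_arg f' (E'.volForm.map_zero₂ _).symm))
    · intro a b ha hb
      rw [map_add, E''.vol_add_left, E'.vol_add_left, map_add, ha, hb]
    · intro r a
      refine hg.induction (P := fun y => E''.vol (k (r • g a)) (k y) = f' (E'.vol (r • g a) y))
        ?_ ?_ ?_ y
      · rw [map_zero]
        exact ((E''.volForm _).map_zero).trans ((map_zero f').symm.trans
          (congr_arg f' ((E'.volForm _).map_zero).symm))
      · intro b c hb hc
        rw [map_add, E''.vol_add_right, E'.vol_add_right, map_add, hb, hc]
      · intro s b
        rw [hk, hk, E''.vol_smul_left, E''.vol_smul_right, E'.vol_smul_left, E'.vol_smul_right,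
          hg.map_vol, map_mul, map_mul]
        have := hkg.map_vol a b
        simp only [AddMonoidHom.comp_apply, RingHom.comp_apply] at this
        rw [this]

end IsCart

/-! ### The pullback as an extension of scalars -/

namespace SLBundle

variable {R : Type u} [CommRing R] (E : SLBundle R) (A : Type u) [CommRing A] [Algebra R A]
  (h2 : IsUnit (2 : A))

/-- The pullback of sections. -/
def toBaseChange : E →+ E.baseChange A h2 :=
  (TensorProduct.mk R A E 1).toAddMonoidHom

theorem smul_toBaseChange (a : A) (x : E) : a • E.toBaseChange A h2 x = a ⊗ₜ[R] x := by
  change a • ((1 : A) ⊗ₜ[R] x) = _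
  rw [TensorProduct.smul_tmul', smul_eq_mul, mul_one]

theorem isCart_toBaseChange :
    IsCart (algebraMap R A) E (E.baseChange A h2) (E.toBaseChange A h2) where
  map_smul r x := by
    rw [smul_toBaseChange]
    change (1 : A) ⊗ₜ[R] (r • x) = _
    rw [← TensorProduct.smul_tmul, Algebra.smul_def, mul_one]
  universal Q _ _ h hh := by
    let _ : Module R Q := Module.compHom Q (algebraMap R A)
    have : IsScalarTower R A Q := .of_algebraMap_smul fun _ _ => rfl
    let h' : E →ₗ[R] Q := { h with map_smul' := hh }
    refine ⟨TensorProduct.AlgebraTensorModule.lift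
      ((LinearMap.lsmul A (E →ₗ[R] Q)).flip h'), fun x => ?_, fun k hk => ?_⟩
    · change TensorProduct.AlgebraTensorModule.lift _ ((1 : A) ⊗ₜ[R] x) = _
      simp [h']
    · refine TensorProduct.AlgebraTensorModule.ext fun a x => ?_
      refine (congr_arg k (E.smul_toBaseChange A h2 a x)).symm.trans ((k.map_smul _ _).trans ?_)
      rw [hk]
      simp [h']
  map_vol x y := by
    rw [baseChange_vol]
    change LinearMap.BilinForm.baseChange A E.volForm ((1 : A) ⊗ₜ[R] x) ((1 : A) ⊗ₜ[R] y) = _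
    rw [LinearMap.BilinForm.baseChange_tmul, Algebra.smul_def]
    simp

end SLBundle

/-! ### Isomorphisms over a base -/

/-- Both functors constructed below start from the linearized moduli, so the equivalence is taken in
the direction `𝒴 ⥤ 𝒳` and inverted here. -/
theorem isIsomorphicOver_of_isEquivalence {ℬ 𝒳 𝒴 : Type*} [Category ℬ] [Category 𝒳] [Category 𝒴]
    {p : 𝒳 ⥤ ℬ} {q : 𝒴 ⥤ ℬ} (Φ : 𝒴 ⥤ 𝒳) [Φ.IsEquivalence] (i : Φ ⋙ p ≅ q) :
    IsIsomorphicOver p q :=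
  ⟨Φ.asEquivalence.symm, ⟨Functor.isoWhiskerLeft Φ.inv i.symm ≪≫ (Functor.associator _ _ _).symm ≪≫
    Functor.isoWhiskerRight Φ.asEquivalence.counitIso p ≪≫ p.leftUnitor⟩⟩

theorem IsIsomorphicOver.symm {ℬ 𝒳 𝒴 : Type*} [Category ℬ] [Category 𝒳] [Category 𝒴]
    {p : 𝒳 ⥤ ℬ} {q : 𝒴 ⥤ ℬ} (h : IsIsomorphicOver p q) : IsIsomorphicOver q p := by
  obtain ⟨e, ⟨i⟩⟩ := h
  exact isIsomorphicOver_of_isEquivalence e.functor i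

theorem IsIsomorphicOver.trans {ℬ 𝒳 𝒴 𝒵 : Type*} [Category ℬ] [Category 𝒳] [Category 𝒴]
    [Category 𝒵] {p : 𝒳 ⥤ ℬ} {q : 𝒴 ⥤ ℬ} {r : 𝒵 ⥤ ℬ} (h : IsIsomorphicOver p q)
    (h' : IsIsomorphicOver q r) : IsIsomorphicOver p r := by
  obtain ⟨e, ⟨i⟩⟩ := h
  obtain ⟨e', ⟨i'⟩⟩ := h'
  exact ⟨e.trans e', ⟨Functor.associator _ _ _ ≪≫ Functor.isoWhiskerLeft e.functor i' ≪≫ i⟩⟩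

/-! ### Vanishing of the first cohomology -/

section Vanishing

theorem coeff_X_mul_X_sub_one_mul_derivative {k : Type*} [CommRing k] (q : k[X]) (j : ℕ) :
    (X * (X - 1) * derivative q).coeff (j + 1) = j * q.coeff j - (j + 1) * q.coeff (j + 1) := by
  have : X * (X - 1) * derivative q = X * (X * derivative q) - X * derivative q := by ring
  rw [this, coeff_sub, coeff_X_mul, coeff_X_mul, coeff_derivative]
  cases j with
  | zero => simp
  | succ j => rw [coeff_X_mul, coeff_derivative]; push_cast; ring

theorem natDegree_X_mul_X_sub_one_mul_derivative_le {k : Type*} [CommRing k] {q : k[X]} {e : ℕ}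
    (hq : q.natDegree ≤ e) : (X * (X - 1) * derivative q).natDegree ≤ e + 1 := by
  refine natDegree_le_iff_coeff_eq_zero.2 fun j hj => ?_
  obtain ⟨j, rfl⟩ : ∃ i, j = i + 1 := ⟨j - 1, by omega⟩
  rw [coeff_X_mul_X_sub_one_mul_derivative, coeff_eq_zero_of_natDegree_lt (by omega),
    coeff_eq_zero_of_natDegree_lt (by omega)]
  simp

variable {R : Type*} [CommRing R] {F : Type*} [AddCommGroup F] [Module R[X] F]

/-- The sections over `ℙ¹ ∖ {∞}` of a bundle of rank two on `ℙ¹`, filtered by the order of the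
pole at `∞`, with a connection with nilpotent residues at `0`, `1`, `∞`. -/
structure IsLogFiltration (ω : LinearMap.BilinForm R[X] F) (D : F →+ F) (Fil : ℕ → Set F) :
    Prop where
  isVolumeForm : IsVolumeForm ω
  leibniz : ∀ (p : R[X]) m, D (p • m) = (X * (X - 1) * derivative p) • m + p • D m
  exists_mem : ∀ x, ∃ N, x ∈ Fil N
  map_mem : ∀ N, ∀ x ∈ Fil N, D x ∈ Fil (N + 1)
  -- A family of total volume one near `∞`, multiplied by `t ^ N` to clear its poles at `0`.
  exists_sum : ∃ (N n : ℕ) (a b : Fin n → F), (∀ i, a i ∈ Fil N) ∧ (∀ i, b i ∈ Fil N) ∧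
    ∑ i, ω (a i) (b i) = X ^ (2 * N)
  residue_zero : ∀ x, ∃ y, D (D x) = (X : R[X]) • y
  residue_one : ∀ x, ∃ y, D (D x) = (X - 1 : R[X]) • y
  -- For `x = t ^ N g` near `∞`, the two steps apply the connection of the other chart twice to `g`.
  -- Nilpotency of the residue is the gain of one: `N + 1` in place of `N + 2`.
  residue_infty : ∀ N, ∀ x ∈ Fil N, ∀ x' x'', x' = D x - ((N : R[X]) * (X - 1)) • x →
    x'' = D x' - (((N + 1 : ℕ) : R[X]) * (X - 1)) • x' → x'' ∈ Fil (N + 1)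

variable {k : Type*} [Field k] (φ : R →+* k)

/-- A semilinear functional which has at infinity a zero of order at least `n`. -/
structure IsFunctional (Fil : ℕ → Set F) (n : ℕ) (ξ : F →+ k[X]) : Prop where
  map_smul : ∀ (p : R[X]) x, ξ (p • x) = p.map φ * ξ x
  degree_le : ∀ N, ∀ x ∈ Fil N, ξ x ≠ 0 → (ξ x).natDegree + n ≤ N

variable {φ} {ω : LinearMap.BilinForm R[X] F} {D : F →+ F} {Fil : ℕ → Set F}

namespace IsLogFiltration

variable (h : IsLogFiltration ω D Fil)
include h

/-- The `a i` and `b i` generate `F` up to the factor `X ^ (2 * N)`, which is not a zero divisor in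
`k[X]`. -/
theorem exists_ne_zero_of_ne_zero {N n : ℕ} {a b : Fin n → F}
    (hab : ∑ i, ω (a i) (b i) = X ^ (2 * N)) {ξ : F →+ k[X]}
    (hξ : ∀ (p : R[X]) x, ξ (p • x) = p.map φ * ξ x) (hne : ξ ≠ 0) :
    ∃ i, ξ (a i) ≠ 0 ∨ ξ (b i) ≠ 0 := by
  by_contra! hcon
  refine hne (AddMonoidHom.ext fun x => ?_)
  have h1 : (X ^ (2 * N) : R[X]) • x = ∑ i, (ω x (b i) • a i - ω x (a i) • b i) := by
    rw [← hab, Finset.sum_smul]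
    exact Finset.sum_congr rfl fun i _ => h.isVolumeForm.smul_eq _ _ _
  have h2 := congr_arg ξ h1
  rw [hξ, map_sum, Finset.sum_eq_zero fun i _ => by
    rw [map_sub, hξ, hξ, (hcon i).1, (hcon i).2, mul_zero, mul_zero, sub_zero]] at h2
  simpa using h2

/-- A functional of maximal order is surjective, and the estimate of its order is sharp. -/
theorem exists_maximal (hφ : Function.Surjective φ) {ξ : F →+ k[X]}
    (hξ : IsFunctional φ Fil 1 ξ) (hne : ξ ≠ 0) :
    ∃ (n : ℕ) (ξ : F →+ k[X]), 1 ≤ n ∧ IsFunctional φ Fil n ξ ∧ (∃ x, ξ x = 1) ∧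
      ∃ N, ∃ x ∈ Fil N, ξ x ≠ 0 ∧ (ξ x).natDegree + n = N := by
  classical
  obtain ⟨N₀, m, a, b, ha, hb, hab⟩ := h.exists_sum
  -- The orders are bounded by `N₀`: a non-zero functional is non-zero on one of the `a i`, `b i`,
  -- and its value there has degree at least zero.
  let S : ℕ → Prop := fun n => ∃ ξ : F →+ k[X], IsFunctional φ Fil n ξ ∧ ξ ≠ 0
  have hS : ∀ n, S n → n ≤ N₀ := by
    rintro n ⟨ξ, hξ, hne⟩
    obtain ⟨i, hi | hi⟩ := h.exists_ne_zero_of_ne_zero hab hξ.map_smul hne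
    · have := hξ.degree_le _ _ (ha i) hi; omega
    · have := hξ.degree_le _ _ (hb i) hi; omega
  have h1 : S 1 := ⟨ξ, hξ, hne⟩
  set n := Nat.findGreatest S N₀ with hn
  have hn1 : 1 ≤ n := Nat.le_findGreatest (hS 1 h1) h1
  obtain ⟨ξ, hξ, hne⟩ : S n := Nat.findGreatest_spec (hS 1 h1) h1
  have hmax : ¬ S (n + 1) := fun hh => by
    have := Nat.le_findGreatest (hS _ hh) hh
    omega
  -- The image is an ideal because `φ` is onto. Dividing `ξ` by a generator `p` does not lower the
  -- order at `∞` and makes the functional surjective.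
  let I : Ideal k[X] :=
    { carrier := Set.range ξ
      add_mem' := by rintro _ _ ⟨x, rfl⟩ ⟨y, rfl⟩; exact ⟨x + y, map_add ξ x y⟩
      zero_mem' := ⟨0, map_zero ξ⟩
      smul_mem' := by
        rintro c _ ⟨x, rfl⟩
        obtain ⟨p, rfl⟩ := Polynomial.map_surjective φ hφ c
        exact ⟨p • x, hξ.map_smul p x⟩ }
  obtain ⟨p, hp⟩ := IsPrincipalIdealRing.principal I
  have hpI : p ∈ I := by rw [hp]; exact Submodule.mem_span_singleton_self p
  obtain ⟨x₁, hx₁⟩ := hpI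
  have hdvd : ∀ x, ∃ c, ξ x = p * c := fun x => by
    have : ξ x ∈ I := ⟨x, rfl⟩
    rw [hp] at this
    exact Ideal.mem_span_singleton.1 this
  have hp0 : p ≠ 0 := by
    rintro rfl
    refine hne (AddMonoidHom.ext fun x => ?_)
    obtain ⟨c, hc⟩ := hdvd x
    simpa using hc
  choose ξ₀ hξ₀ using hdvd
  let ξ' : F →+ k[X] := AddMonoidHom.mk' ξ₀ fun x y => by
    refine mul_left_cancel₀ hp0 ?_
    rw [← hξ₀, map_add, mul_add, hξ₀, hξ₀]
  have hξ' : ∀ x, ξ x = p * ξ' x := hξ₀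
  have hf : IsFunctional φ Fil n ξ' := by
    refine ⟨fun q x => mul_left_cancel₀ hp0 ?_, fun N x hx hx0 => ?_⟩
    · rw [← hξ', hξ.map_smul, hξ']; ring
    · have := hξ.degree_le N x hx (by rw [hξ']; exact mul_ne_zero hp0 hx0)
      rw [hξ', natDegree_mul hp0 hx0] at this
      omega
  have hx1 : ξ' x₁ = 1 := mul_left_cancel₀ hp0 (by rw [← hξ', hx₁, mul_one])
  refine ⟨n, ξ', hn1, hf, ⟨x₁, hx1⟩, ?_⟩
  -- If the estimate were never sharp, the order would be at least `n + 1`, against maximality.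
  by_contra! hcon
  refine hmax ⟨ξ', ⟨hf.map_smul, fun N x hx hx0 => ?_⟩, fun h0 => ?_⟩
  · have h1 := hf.degree_le N x hx hx0
    have h2 := hcon N x hx hx0
    omega
  · rw [h0] at hx1; simp at hx1

/-- The Wronskian of a functional vanishes. -/
theorem wronskian_eq_zero [CharZero k] {n : ℕ} (hn : 1 ≤ n) {ξ : F →+ k[X]}
    (hξ : IsFunctional φ Fil n ξ) (x y : F) :
    ξ x * (X * (X - 1) * derivative (ξ y) - ξ (D y)) =
      ξ y * (X * (X - 1) * derivative (ξ x) - ξ (D x)) := by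
  let _ : Module R[X] k[X] := Module.compHom k[X] (mapRingHom φ)
  have hsmul : ∀ (p : R[X]) (q : k[X]), p • q = p.map φ * q := fun _ _ => rfl
  -- The derivative of `ξ` for the dual connection. The Leibniz terms cancel, so it is linear again.
  set η : F → k[X] := fun x => X * (X - 1) * derivative (ξ x) - ξ (D x) with hη
  have hη_add : ∀ x y, η (x + y) = η x + η y := fun x y => by
    simp only [hη, map_add]; ring
  have hη_smul : ∀ (p : R[X]) x, η (p • x) = p.map φ * η x := fun p x => by
    simp only [hη, h.leibniz, map_add, hξ.map_smul, derivative_mul, Polynomial.map_mul,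
      Polynomial.map_sub, map_X, Polynomial.map_one, derivative_map]
    ring
  -- An alternating form, hence a multiple `c` of the volume; geometrically `c` is a section of `O(1
  -- - 2n)`.
  let β : F →ₗ[R[X]] F →ₗ[R[X]] k[X] := LinearMap.mk₂ R[X] (fun x y => ξ x * η y - ξ y * η x)
    (fun x x' y => by rw [map_add, hη_add]; ring)
    (fun p x y => by rw [hξ.map_smul, hη_smul, hsmul]; ring)
    (fun x y y' => by rw [map_add, hη_add]; ring)
    (fun p x y => by rw [hξ.map_smul, hη_smul, hsmul]; ring)
  have hβ : ∀ x y, β x y = ξ x * η y - ξ y * η x := fun _ _ => rfl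
  obtain ⟨m, a, b, hab⟩ := h.isVolumeForm.exists_sum_eq_one
  set c : k[X] := ∑ i, β (a i) (b i) with hc
  have key : ∀ x y, β x y = (ω x y).map φ * c := fun x y => by
    have := h.isVolumeForm.alternating_eq β (fun x => by rw [hβ]; ring) hab x y
    rw [hsmul, hsmul, hsmul] at this
    have h2 : Polynomial.map φ (2 : R[X]) ≠ 0 := by
      simp
    exact mul_left_cancel₀ h2 this
  obtain ⟨N, m', a', b', ha', hb', hab'⟩ := h.exists_sum
  -- The derivation raises the pole order by one, but `n ≥ 1`: the degree of `η y` is at most `N`,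
  -- and that of `ξ x` is strictly less than `N`.
  have hdeg : ∀ x ∈ Fil N, ∀ y ∈ Fil N, (ξ x * η y).degree < ((2 * N : ℕ) : WithBot ℕ) := fun x hx y hy => by
    by_cases hx0 : ξ x = 0
    · rw [hx0, zero_mul, degree_zero]; exact WithBot.bot_lt_coe _
    have h1 := hξ.degree_le N x hx hx0
    have h2 : (η y).natDegree ≤ N := by
      refine (natDegree_sub_le _ _).trans (max_le ?_ ?_)
      · by_cases hy0 : ξ y = 0
        · rw [hy0]; simp
        · have := hξ.degree_le N y hy hy0
          exact (natDegree_X_mul_X_sub_one_mul_derivative_le le_rfl).trans (by omega)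
      · by_cases hy0 : ξ (D y) = 0
        · rw [hy0]; simp
        · have := hξ.degree_le _ _ (h.map_mem N y hy) hy0
          omega
    refine degree_le_natDegree.trans_lt ?_
    have := natDegree_mul_le (p := ξ x) (q := η y)
    exact_mod_cast (by omega : (ξ x * η y).natDegree < 2 * N)
  -- Evaluating the form on the family near `∞` shows that `X ^ (2 * N) * c` has degree less than `2
  -- * N`.
  have hc0 : c = 0 := by
    by_contra hc0
    have h1 : X ^ (2 * N) * c = ∑ i, β (a' i) (b' i) := by
      simp_rw [key]
      rw [← Finset.sum_mul, ← Polynomial.map_sum, hab', Polynomial.map_pow, map_X]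
    have h2 : (X ^ (2 * N) * c).degree < ((2 * N : ℕ) : WithBot ℕ) := by
      rw [h1, ← mem_degreeLT]
      refine Submodule.sum_mem _ fun i _ => ?_
      rw [hβ]
      exact Submodule.sub_mem _ (mem_degreeLT.2 (hdeg _ (ha' i) _ (hb' i)))
        (mem_degreeLT.2 (hdeg _ (hb' i) _ (ha' i)))
    rw [degree_eq_natDegree (mul_ne_zero (pow_ne_zero _ X_ne_zero) hc0), natDegree_mul
      (pow_ne_zero _ X_ne_zero) hc0, natDegree_X_pow] at h2
    have : 2 * N + c.natDegree < 2 * N := by exact_mod_cast h2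
    omega
  have := key x y
  rw [hc0, mul_zero, hβ] at this
  exact sub_eq_zero.1 this

/-- There are no functionals which vanish at infinity. -/
theorem functional_eq_zero [CharZero k] (hφ : Function.Surjective φ) {ξ : F →+ k[X]}
    (hξ : IsFunctional φ Fil 1 ξ) : ξ = 0 := by
  by_contra hne
  obtain ⟨n, ξ, hn, hξ, ⟨x₁, hx₁⟩, N, x₂, hx₂, hx₂0, hN⟩ := h.exists_maximal hφ hξ hne
  -- Since `ξ x₁ = 1`, the vanishing Wronskian with `x₁` says that the connection induced on the
  -- quotient is `X (X - 1) d/dX + μ`.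
  set μ := ξ (D x₁) with hμ
  have hD : ∀ x, ξ (D x) = X * (X - 1) * derivative (ξ x) + μ * ξ x := fun x => by
    have := h.wronskian_eq_zero hn hξ x x₁
    rw [hx₁, derivative_one] at this
    linear_combination this
  -- This uses `x₂`, where the degree estimate is sharp: applying `D` raises the degree of the image
  -- by at most one.
  have hμdeg : μ.natDegree ≤ 1 := by
    by_cases hμ0 : μ = 0
    · simp [hμ0]
    have h1 : μ * ξ x₂ = ξ (D x₂) - X * (X - 1) * derivative (ξ x₂) := by rw [hD]; ring
    have h2 : (μ * ξ x₂).natDegree ≤ (ξ x₂).natDegree + 1 := by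
      rw [h1]
      refine (natDegree_sub_le _ _).trans (max_le ?_ ?_)
      · by_cases hy0 : ξ (D x₂) = 0
        · rw [hy0]; simp
        · have := hξ.degree_le _ _ (h.map_mem N x₂ hx₂) hy0
          omega
      · exact natDegree_X_mul_X_sub_one_mul_derivative_le le_rfl
    rw [natDegree_mul hμ0 hx₂0] at h2
    omega
  -- The derivation vanishes at `0`, so `ξ (D (D x₁))` has the value `μ(0) ^ 2` there, and
  -- nilpotency of the residue makes it zero; likewise at `1`.
  have e0 : μ.eval 0 = 0 := by
    obtain ⟨y, hy⟩ := h.residue_zero x₁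
    have := congr_arg (fun q => (ξ q).eval 0) hy
    simpa [hD, hξ.map_smul, hx₁] using this
  have e1 : μ.eval 1 = 0 := by
    obtain ⟨y, hy⟩ := h.residue_one x₁
    have := congr_arg (fun q => (ξ q).eval 1) hy
    simpa [hD, hξ.map_smul, hx₁] using this
  have hμ0 : μ = 0 := by
    have h1 := eq_X_add_C_of_natDegree_le_one hμdeg
    rw [h1] at e0 e1
    simp only [eval_add, eval_mul, eval_C, eval_X, mul_zero, zero_add, mul_one] at e0 e1
    rw [e0, add_zero] at e1
    rw [h1, e0, e1]; simp
  rw [hμ0] at hD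
  set q := ξ x₂ with hq
  set e := q.natDegree with he
  set x' := D x₂ - ((N : R[X]) * (X - 1)) • x₂ with hx'
  set x'' := D x' - (((N + 1 : ℕ) : R[X]) * (X - 1)) • x' with hx''
  have hmem := h.residue_infty N x₂ hx₂ x' x'' hx' hx''
  have f1 : ξ x' = X * (X - 1) * derivative q - (N : k[X]) * (X - 1) * q := by
    rw [hx', map_sub, hD, hξ.map_smul]
    simp [hq]
  have f2 : ξ x'' = X * (X - 1) * derivative (ξ x') - ((N + 1 : ℕ) : k[X]) * (X - 1) * ξ x' := by
    rw [hx'', map_sub, hD, hξ.map_smul, Polynomial.map_mul, Polynomial.map_natCast]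
    simp
  have g : ∀ (r : k[X]) (M j : ℕ), (X * (X - 1) * derivative r - (M : k[X]) * (X - 1) * r).coeff
      (j + 1) = (j - M) * r.coeff j + (M - j - 1) * r.coeff (j + 1) := fun r M j => by
    have : (M : k[X]) * (X - 1) * r = C (M : k) * (X * r) - C (M : k) * r := by
      rw [C_eq_natCast]; ring
    rw [coeff_sub, coeff_X_mul_X_sub_one_mul_derivative, this, coeff_sub, coeff_C_mul, coeff_C_mul,
      coeff_X_mul]
    ring
  have c0 : ∀ j, e < j → q.coeff j = 0 := fun j hj => coeff_eq_zero_of_natDegree_lt hj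
  -- Each of the two steps multiplies the top coefficient by `-n`, the effect at `∞` of a quotient
  -- of degree `-n`.
  have c1 : (ξ x').coeff (e + 1) = -n * q.coeff e := by
    rw [f1, g, c0 (e + 1) (by omega), ← hN]; push_cast; ring
  have c2 : (ξ x').coeff (e + 1 + 1) = 0 := by
    rw [f1, g, c0 (e + 1) (by omega), c0 (e + 1 + 1) (by omega)]; ring
  have c3 : (ξ x'').coeff (e + 1 + 1) = n ^ 2 * q.coeff e := by
    rw [f2, g, c1, c2, ← hN]; push_cast; ring
  -- As `x''` lies in `Fil (N + 1)`, its image has degree at most `N + 1 - n = e + 1`.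
  have c4 : (ξ x'').coeff (e + 1 + 1) = 0 := by
    by_cases h0 : ξ x'' = 0
    · rw [h0, coeff_zero]
    · have := hξ.degree_le _ _ hmem h0
      exact coeff_eq_zero_of_natDegree_lt (by omega)
  rw [c3] at c4
  have hl : q.coeff e ≠ 0 := leadingCoeff_ne_zero.2 hx₂0
  have : (n : k) ≠ 0 := by exact_mod_cast (by omega : n ≠ 0)
  exact mul_ne_zero (pow_ne_zero 2 this) hl c4

end IsLogFiltration

end Vanishing

/-- A semilinear map which is compatible with the volume forms is a pullback. -/
theorem IsCart.of_vol {R R' : Type u} [CommRing R] [CommRing R'] {f : R →+* R'}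
    {E : SLBundle R} {E' : SLBundle R'} {g : E →+ E'} (hg : ∀ (r : R) x, g (r • x) = f r • g x)
    (hv : ∀ x y, E'.vol (g x) (g y) = f (E.vol x y)) : IsCart f E E' g where
  map_smul := hg
  map_vol := hv
  universal Q _ _ h hh := by
    obtain ⟨n, a, b, hab⟩ := E.isVolumeForm.exists_sum_eq_one
    have hab' : ∑ i, E'.volForm (g (a i)) (g (b i)) = 1 := by
      simp only [SLBundle.volForm_apply, hv]
      rw [← map_sum, ← map_one f]
      exact congr_arg f hab
    -- The images of the `a i`, `b i` still have total volume one, so the expansion formula dictates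
    -- the extension and proves it unique.
    refine ⟨∑ i, ((E'.volForm.flip (g (b i))).smulRight (h (a i)) -
      (E'.volForm.flip (g (a i))).smulRight (h (b i))), fun x => ?_, fun k hk => ?_⟩
    · conv_rhs => rw [E.isVolumeForm.expand hab x, map_sum]
      simp [LinearMap.sum_apply, hv, hh]
    · refine LinearMap.ext fun z => ?_
      conv_lhs => rw [E'.isVolumeForm.expand hab' z, map_sum]
      simp [LinearMap.sum_apply, hk]

/-- A vector which vanishes at a point is divisible by the coordinate. -/
theorem IsCart.exists_eq_smul {R : Type u} [CommRing R] {c : R} {E : SLBundle R[X]}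
    {E' : SLBundle R} {g : E →+ E'} (hg : IsCart (evalRingHom c) E E' g) {x : E} (hx : g x = 0) :
    ∃ y, x = (X - C c) • y := by
  have h : ∀ y, ∃ q, E.vol x y = (X - C c) * q := fun y => by
    have : (E.vol x y).eval c = 0 := by
      have := hg.map_vol x y
      rw [hx] at this
      exact this.symm.trans (E'.volForm.map_zero₂ _)
    exact dvd_iff_isRoot.2 this
  choose q hq using h
  obtain ⟨n, a, b, hab⟩ := E.isVolumeForm.exists_sum_eq_one
  refine ⟨∑ i, (q (b i) • a i - q (a i) • b i), ?_⟩
  conv_lhs => rw [E.isVolumeForm.expand hab x]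
  simp only [SLBundle.volForm_apply, hq, Finset.smul_sum, smul_sub, smul_smul]

/-! ### Laurent polynomials and functions on the two charts -/

section Laurent

open LaurentPolynomial (T)

variable {R : Type u} [CommRing R]

theorem coeff_mul_T (f : R[T;T⁻¹]) (n j : ℤ) : (f * T n).coeff j = f.coeff (j - n) := by
  induction f using LaurentPolynomial.induction_on' with
  | add p q hp hq => rw [add_mul]; simp [hp, hq]
  | C_mul_T m a =>
    rw [mul_assoc, ← LaurentPolynomial.T_add, ← LaurentPolynomial.single_eq_C_mul_T,
      ← LaurentPolynomial.single_eq_C_mul_T, AddMonoidAlgebra.coeff_single,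
      AddMonoidAlgebra.coeff_single, Finsupp.single_apply, Finsupp.single_apply]
    congr 1
    exact propext ⟨fun h => by omega, fun h => by omega⟩

theorem coeff_toLaurent (p : R[X]) (n : ℕ) : (toLaurent p).coeff (n : ℤ) = p.coeff n := by
  induction p using Polynomial.induction_on' with
  | add p q hp hq => rw [map_add, AddMonoidAlgebra.coeff_add, Finsupp.add_apply, hp, hq, coeff_add]
  | monomial m a =>
    rw [toLaurent_C_mul_T, ← LaurentPolynomial.single_eq_C_mul_T,
      AddMonoidAlgebra.coeff_single, Finsupp.single_apply, coeff_monomial]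
    congr 1
    exact propext Int.ofNat_inj

theorem coeff_toLaurent_of_neg (p : R[X]) {j : ℤ} (hj : j < 0) : (toLaurent p).coeff j = 0 := by
  induction p using Polynomial.induction_on' with
  | add p q hp hq => rw [map_add, AddMonoidAlgebra.coeff_add, Finsupp.add_apply, hp, hq, add_zero]
  | monomial m a =>
    rw [toLaurent_C_mul_T, ← LaurentPolynomial.single_eq_C_mul_T,
      AddMonoidAlgebra.coeff_single, Finsupp.single_apply, if_neg (by omega)]

theorem toLaurentInv_apply (p : R[X]) :
    toLaurentInv R p = LaurentPolynomial.invert (toLaurent p) := rfl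

@[simp] theorem toLaurentInv_X : toLaurentInv R X = T (-1) := by
  rw [toLaurentInv_apply, toLaurent_X, LaurentPolynomial.invert_T]

@[simp] theorem toLaurentInv_C (r : R) : toLaurentInv R (C r) = LaurentPolynomial.C r := by
  rw [toLaurentInv_apply, toLaurent_C, LaurentPolynomial.invert_C]

theorem toLaurentInv_injective : Function.Injective (toLaurentInv R) := fun _ _ h =>
  toLaurent_injective (LaurentPolynomial.invert.injective h)

theorem coeff_toLaurentInv_of_pos (p : R[X]) {j : ℤ} (hj : 0 < j) :
    (toLaurentInv R p).coeff j = 0 := by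
  rw [toLaurentInv_apply, LaurentPolynomial.invert_apply, coeff_toLaurent_of_neg _ (by omega)]

/-- The global functions on the projective line are constant. -/
theorem eq_C_of_toLaurent_eq {p q : R[X]} (h : toLaurent p = toLaurentInv R q) :
    p = C (p.coeff 0) ∧ q = C (p.coeff 0) := by
  have hp : p = C (p.coeff 0) := by
    ext n
    rcases n with _ | n
    · simp
    · rw [coeff_C_succ, ← coeff_toLaurent, h, coeff_toLaurentInv_of_pos _ (by omega)]
  refine ⟨hp, toLaurentInv_injective ?_⟩
  rw [← h, toLaurentInv_C, ← toLaurent_C, ← hp]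

theorem exists_T_mul_eq_toLaurent (f : R[T;T⁻¹]) :
    ∃ (n : ℕ) (p : R[X]), T n * f = toLaurent p := by
  obtain ⟨n, p, h⟩ := f.exists_T_pow
  exact ⟨n, p, by rw [LaurentPolynomial.T_mul, h]⟩

theorem exists_T_mul_eq_toLaurentInv (f : R[T;T⁻¹]) :
    ∃ (n : ℕ) (p : R[X]), T (-n) * f = toLaurentInv R p := by
  obtain ⟨n, p, h⟩ := exists_T_mul_eq_toLaurent (LaurentPolynomial.invert f)
  refine ⟨n, p, ?_⟩
  rw [toLaurentInv_apply, ← h, map_mul, LaurentPolynomial.invert_T]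
  congr 1
  exact (LaurentPolynomial.involutive_invert f).symm

end Laurent

/-! ### Sections over the charts and their poles -/

namespace SLBundleP1

open LaurentPolynomial (T)

variable {R : Type u} [CommRing R] (E : SLBundleP1 R)

theorem resFin_injective : Function.Injective E.resFin := E.cart_resFin.injective toLaurent_injective

theorem resInf_injective : Function.Injective E.resInf :=
  E.cart_resInf.injective toLaurentInv_injective

theorem resFin_smul (p : R[X]) (x : E.fin) : E.resFin (p • x) = toLaurent p • E.resFin x :=
  E.cart_resFin.map_smul p x

theorem resInf_smul (p : R[X]) (x : E.inf) : E.resInf (p • x) = toLaurentInv R p • E.resInf x :=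
  E.cart_resInf.map_smul p x

theorem T_smul_T_smul (a b : ℤ) (m : E.mid) :
    (T a : R[T;T⁻¹]) • (T b : R[T;T⁻¹]) • m = (T (a + b) : R[T;T⁻¹]) • m := by
  rw [smul_smul, ← LaurentPolynomial.T_add]

theorem T_smul_resFin (n : ℕ) (x : E.fin) :
    (T n : R[T;T⁻¹]) • E.resFin x = E.resFin ((X ^ n : R[X]) • x) := by
  rw [resFin_smul, toLaurent_X_pow]

theorem T_smul_resInf (n : ℕ) (x : E.inf) :
    (T (-n) : R[T;T⁻¹]) • E.resInf x = E.resInf ((X ^ n : R[X]) • x) := by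
  rw [resInf_smul, map_pow, toLaurentInv_X, LaurentPolynomial.T_pow]
  simp

/-- Sections over the overlap are Laurent combinations of restrictions, so a power of `t` clears
their poles at `0`. All large `N` are allowed so that a finite family can share one exponent. -/
theorem exists_resFin (m : E.mid) : ∃ N₀ : ℕ, ∀ N : ℕ, N₀ ≤ N → ∃ x,
    (T N : R[T;T⁻¹]) • m = E.resFin x := by
  suffices h : ∃ (N : ℕ) (x : _), (T N : R[T;T⁻¹]) • m = E.resFin x by
    obtain ⟨N₀, x, hx⟩ := h
    refine ⟨N₀, fun N hN => ⟨(X ^ (N - N₀) : R[X]) • x, ?_⟩⟩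
    rw [← T_smul_resFin, ← hx, T_smul_T_smul]
    congr 2; omega
  refine E.cart_resFin.induction (P := fun m => ∃ (N : ℕ) (x : _),
    (T N : R[T;T⁻¹]) • m = E.resFin x) ⟨0, 0, by simp⟩ ?_ ?_ m
  · rintro a b ⟨N, x, hx⟩ ⟨N', x', hx'⟩
    refine ⟨N' + N, (X ^ N' : R[X]) • x + (X ^ N : R[X]) • x', ?_⟩
    rw [map_add, ← T_smul_resFin, ← T_smul_resFin, ← hx, ← hx', T_smul_T_smul, T_smul_T_smul,
      smul_add, add_comm (N : ℤ)]
    push_cast; rfl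
  · intro r x
    obtain ⟨n, p, hp⟩ := exists_T_mul_eq_toLaurent r
    exact ⟨n, p • x, by rw [smul_smul, hp, resFin_smul]⟩

theorem exists_resInf (m : E.mid) : ∃ N₀ : ℕ, ∀ N : ℕ, N₀ ≤ N → ∃ x,
    (T (-N) : R[T;T⁻¹]) • m = E.resInf x := by
  suffices h : ∃ (N : ℕ) (x : _), (T (-N) : R[T;T⁻¹]) • m = E.resInf x by
    obtain ⟨N₀, x, hx⟩ := h
    refine ⟨N₀, fun N hN => ⟨(X ^ (N - N₀) : R[X]) • x, ?_⟩⟩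
    rw [← T_smul_resInf, ← hx, T_smul_T_smul]
    congr 2; omega
  refine E.cart_resInf.induction (P := fun m => ∃ (N : ℕ) (x : _),
    (T (-N) : R[T;T⁻¹]) • m = E.resInf x) ⟨0, 0, by simp⟩ ?_ ?_ m
  · rintro a b ⟨N, x, hx⟩ ⟨N', x', hx'⟩
    refine ⟨N' + N, (X ^ N' : R[X]) • x + (X ^ N : R[X]) • x', ?_⟩
    rw [map_add, ← T_smul_resInf, ← T_smul_resInf, ← hx, ← hx', T_smul_T_smul, T_smul_T_smul,
      smul_add]
    congr 3 <;> push_cast <;> ring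
  · intro r x
    obtain ⟨n, p, hp⟩ := exists_T_mul_eq_toLaurentInv r
    exact ⟨n, p • x, by rw [smul_smul, hp, resInf_smul]⟩

/-- The sections over `ℙ¹ ∖ {∞}` with a pole of order at most `N` at infinity. -/
def poleFiltration (N : ℕ) : Set E.fin :=
  {x | ∃ g, E.resFin x = (T N : R[T;T⁻¹]) • E.resInf g}

theorem exists_mem_poleFiltration (x : E.fin) : ∃ N₀ : ℕ, ∀ N, N₀ ≤ N →
    x ∈ E.poleFiltration N := by
  obtain ⟨N₀, h⟩ := E.exists_resInf (E.resFin x)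
  refine ⟨N₀, fun N hN => ?_⟩
  obtain ⟨g, hg⟩ := h N hN
  exact ⟨g, by rw [← hg, T_smul_T_smul]; simp⟩

end SLBundleP1

/-! ### De Rham points as filtered modules with a connection -/

namespace DeRhamPoint

open LaurentPolynomial (T)

variable {R : Type u} [CommRing R] (P : DeRhamPoint R)

/-- This is the flatness of the volume evaluated at `s`, where the coefficient of the derivation
vanishes; it gives the residue trace zero. -/
theorem residue_vol (s : Pt) (x y : P.bundle.fib s) :
    (P.bundle.fib s).vol (P.conn.residue s x) y + (P.bundle.fib s).vol x (P.conn.residue s y) =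
      0 := by
  have hneg : ∀ (E : SLBundle R) (x y : E), E.vol (-x) y = -E.vol x y :=
    fun E x y => E.volForm.map_neg₂ x y
  have hneg' : ∀ (E : SLBundle R) (x y : E), E.vol x (-y) = -E.vol x y :=
    fun E x y => (E.volForm x).map_neg y
  have heval : ∀ c : R, Function.Surjective (evalRingHom c) := fun c r => ⟨C r, by simp⟩
  cases s with
  | zero =>
    obtain ⟨x, rfl⟩ := P.bundle.cart_evZero.surjective (heval 0) x
    obtain ⟨y, rfl⟩ := P.bundle.cart_evZero.surjective (heval 0) y
    have := congr_arg (evalRingHom 0) (P.conn.flat_fin x y)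
    rw [map_add, ← P.bundle.cart_evZero.map_vol, ← P.bundle.cart_evZero.map_vol] at this
    rw [P.conn.residue_zero, P.conn.residue_zero, hneg, hneg', ← neg_add, ← this]
    simp
  | one =>
    obtain ⟨x, rfl⟩ := P.bundle.cart_evOne.surjective (heval 1) x
    obtain ⟨y, rfl⟩ := P.bundle.cart_evOne.surjective (heval 1) y
    have := congr_arg (evalRingHom 1) (P.conn.flat_fin x y)
    rw [map_add, ← P.bundle.cart_evOne.map_vol, ← P.bundle.cart_evOne.map_vol] at this
    rw [P.conn.residue_one, P.conn.residue_one, ← this]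
    simp
  | infty =>
    obtain ⟨x, rfl⟩ := P.bundle.cart_evInfty.surjective (heval 0) x
    obtain ⟨y, rfl⟩ := P.bundle.cart_evInfty.surjective (heval 0) y
    have := congr_arg (evalRingHom 0) (P.conn.flat_inf x y)
    rw [map_add, ← P.bundle.cart_evInfty.map_vol, ← P.bundle.cart_evInfty.map_vol] at this
    rw [P.conn.residue_infty, P.conn.residue_infty, hneg, hneg', ← neg_add, ← this]
    simp

/-- The moduli problem only asks the residue to kill the line; trace zero supplies the other half of
nilpotency. -/
theorem residue_mem (s : Pt) (x : P.bundle.fib s) : P.conn.residue s x ∈ P.line s :=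
  (P.isLine s).mem_of_vol_map_add (P.residue_line s) (P.residue_vol s) x

theorem residue_residue (s : Pt) (x : P.bundle.fib s) :
    P.conn.residue s (P.conn.residue s x) = 0 :=
  P.residue_line s _ (P.residue_mem s x)

theorem nablaMid_T_smul (n : ℤ) (m : P.bundle.mid) :
    P.conn.nablaMid ((T n : R[T;T⁻¹]) • m) =
      ((n : R[T;T⁻¹]) * T n * (T 1 - 1)) • m + (T n : R[T;T⁻¹]) • P.conn.nablaMid m := by
  have := P.conn.leibniz_mid 1 n m
  simpa using this

theorem nablaMid_resInf (g : P.bundle.inf) :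
    P.conn.nablaMid (P.bundle.resInf g) =
      (T 1 : R[T;T⁻¹]) • P.bundle.resInf (P.conn.nablaInf g) := by
  rw [P.conn.res_inf, P.bundle.T_smul_T_smul]
  simp

/-- The subtracted term is the Leibniz contribution of `t ^ N`. The exponent rises to `N + 1`
because `ω = t⁻¹ ω'`. -/
theorem resFin_nabla_sub {N : ℕ} {x : P.bundle.fin} {g : P.bundle.inf}
    (h : P.bundle.resFin x = (T N : R[T;T⁻¹]) • P.bundle.resInf g) :
    P.bundle.resFin (P.conn.nablaFin x - ((N : R[X]) * (X - 1)) • x) =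
      (T (N + 1 : ℕ) : R[T;T⁻¹]) • P.bundle.resInf (P.conn.nablaInf g) := by
  rw [map_sub, P.conn.res_fin, P.bundle.resFin_smul, h, nablaMid_T_smul, nablaMid_resInf,
    P.bundle.T_smul_T_smul, smul_smul]
  simp only [map_mul, map_natCast, map_sub, toLaurent_X, map_one, Int.cast_natCast]
  rw [mul_assoc, mul_assoc, mul_comm (T 1 - 1) (T (N : ℤ))]
  push_cast
  rw [add_sub_cancel_left]

theorem isLogFiltration :
    IsLogFiltration P.bundle.fin.volForm P.conn.nablaFin P.bundle.poleFiltration where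
  isVolumeForm := P.bundle.fin.isVolumeForm
  leibniz := P.conn.leibniz_fin
  exists_mem x := by
    obtain ⟨N, h⟩ := P.bundle.exists_mem_poleFiltration x
    exact ⟨N, h N le_rfl⟩
  map_mem N x := by
    rintro ⟨g, hg⟩
    -- From `t ^ N (t - 1) = t ^ (N + 1) (1 - u)`, where `u = t⁻¹` is the variable of the other
    -- chart.
    refine ⟨P.conn.nablaInf g + ((N : R[X]) * (1 - X)) • g, ?_⟩
    have h1 := P.resFin_nabla_sub hg
    rw [map_sub, sub_eq_iff_eq_add] at h1
    rw [h1, map_add, smul_add]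
    congr 1
    rw [P.bundle.resFin_smul, hg, P.bundle.resInf_smul, smul_smul, smul_smul]
    congr 1
    simp only [map_mul, map_natCast, map_sub, toLaurent_X, map_one, toLaurentInv_X]
    push_cast
    rw [LaurentPolynomial.T_add]
    have : (T 1 : R[T;T⁻¹]) * T (-1) = 1 := by rw [← LaurentPolynomial.T_add]; simp
    linear_combination ((N : R[T;T⁻¹]) * T N) * this
  exists_sum := by
    obtain ⟨n, a, b, hab⟩ := P.bundle.inf.isVolumeForm.exists_sum_eq_one
    choose Na ha using fun i => P.bundle.exists_resFin (P.bundle.resInf (a i))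
    choose Nb hb using fun i => P.bundle.exists_resFin (P.bundle.resInf (b i))
    let N := ∑ i, (Na i + Nb i)
    have hN : ∀ i, Na i + Nb i ≤ N := fun i =>
      Finset.single_le_sum (f := fun i => Na i + Nb i) (fun _ _ => Nat.zero_le _)
        (Finset.mem_univ i)
    choose a' ha' using fun i => ha i N ((Nat.le_add_right _ _).trans (hN i))
    choose b' hb' using fun i => hb i N ((Nat.le_add_left _ _).trans (hN i))
    refine ⟨N, n, a', b', fun i => ⟨a i, (ha' i).symm⟩, fun i => ⟨b i, (hb' i).symm⟩, ?_⟩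
    refine toLaurent_injective ?_
    have : ∀ i, toLaurent (P.bundle.fin.vol (a' i) (b' i)) =
        T (2 * N : ℕ) * toLaurentInv R (P.bundle.inf.vol (a i) (b i)) := fun i => by
      rw [← P.bundle.cart_resFin.map_vol, ← ha', ← hb', SLBundle.vol_smul_left,
        SLBundle.vol_smul_right, P.bundle.cart_resInf.map_vol, ← mul_assoc,
        ← LaurentPolynomial.T_add]
      congr 2; push_cast; ring
    simp only [SLBundle.volForm_apply, map_sum, this] at hab ⊢
    rw [← Finset.mul_sum, ← map_sum, hab, map_one, mul_one, toLaurent_X_pow]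
  residue_zero x := by
    have h0 : P.bundle.evZero (P.conn.nablaFin (P.conn.nablaFin x)) = 0 := by
      rw [← neg_eq_zero, ← P.conn.residue_zero, ← neg_neg (P.bundle.evZero (P.conn.nablaFin x)),
        ← P.conn.residue_zero, map_neg, residue_residue, neg_zero]
    obtain ⟨y, hy⟩ := P.bundle.cart_evZero.exists_eq_smul h0
    exact ⟨y, by rw [hy, C_0, sub_zero]⟩
  residue_one x := by
    have h0 : P.bundle.evOne (P.conn.nablaFin (P.conn.nablaFin x)) = 0 := by
      rw [← P.conn.residue_one, ← P.conn.residue_one, residue_residue]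
    obtain ⟨y, hy⟩ := P.bundle.cart_evOne.exists_eq_smul h0
    exact ⟨y, by rw [hy, C_1]⟩
  residue_infty N x := by
    rintro ⟨g, hg⟩ x' x'' rfl rfl
    have h0 : P.bundle.evInfty (P.conn.nablaInf (P.conn.nablaInf g)) = 0 := by
      rw [← neg_eq_zero, ← P.conn.residue_infty, ← neg_neg (P.bundle.evInfty (P.conn.nablaInf g)),
        ← P.conn.residue_infty, map_neg, residue_residue, neg_zero]
    -- The square of the residue vanishes, so the twice differentiated section is `u y`, and this
    -- factor lowers the pole order from `N + 2` to `N + 1`.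
    obtain ⟨y, hy⟩ := P.bundle.cart_evInfty.exists_eq_smul h0
    refine ⟨y, ?_⟩
    rw [P.resFin_nabla_sub (P.resFin_nabla_sub hg), hy, C_0, sub_zero, P.bundle.resInf_smul,
      toLaurentInv_X, P.bundle.T_smul_T_smul]
    congr 2
    push_cast; ring

end DeRhamPoint

/-- A module over a commutative ring which is generated by a proper submodule and finitely many
vectors has a functional with values in a residue field which vanishes on the submodule. -/
theorem exists_residue_functional {R M : Type*} [CommRing R] [AddCommGroup M] [Module R M]
    {W : Submodule R M} (hW : W ≠ ⊤) {S : Set M} (hS : S.Finite)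
    (hWS : W ⊔ Submodule.span R S = ⊤) :
    ∃ (m : Ideal R) (_ : m.IsMaximal) (l : M →ₗ[R] R ⧸ m), l ≠ 0 ∧ ∀ x ∈ W, l x = 0 := by
  have hfin : Module.Finite R (M ⧸ W) := by
    refine ⟨⟨(hS.image W.mkQ).toFinset, ?_⟩⟩
    have := congr_arg (Submodule.map W.mkQ) hWS
    rw [Submodule.map_sup, Submodule.mkQ_map_self, bot_sup_eq, Submodule.map_top,
      Submodule.range_mkQ, Submodule.map_span] at this
    simpa using this
  have hnt : Nontrivial (M ⧸ W) := Submodule.Quotient.nontrivial_iff.2 hW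
  obtain h | ⟨N, hN, -⟩ := IsCoatomic.eq_top_or_exists_le_coatom (⊥ : Submodule R (M ⧸ W))
  · exact absurd h bot_ne_top
  have hs : IsSimpleModule R ((M ⧸ W) ⧸ N) := isSimpleModule_iff_isCoatom.2 hN
  obtain ⟨m, hm, ⟨e⟩⟩ := isSimpleModule_iff_quot_maximal.1 hs
  refine ⟨m, hm, e.toLinearMap ∘ₗ N.mkQ ∘ₗ W.mkQ, fun h0 => hN.1 ?_, fun x hx => ?_⟩
  · refine (Submodule.eq_top_iff').2 fun y => ?_
    obtain ⟨x, rfl⟩ := W.mkQ_surjective y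
    have := LinearMap.congr_fun h0 x
    simpa using this
  · have : W.mkQ x = 0 := by simpa using hx
    simp only [LinearMap.comp_apply, this, map_zero]

/-! ### Vanishing of cohomology and the frame of global sections -/

namespace DeRhamPoint

open LaurentPolynomial (T)

variable {R : Type u} [CommRing R] (P : DeRhamPoint R)

/-- Finite generation of `H¹(𝓔(-1))` over `R`. For a generator `c i`, the sections `t ^ j (c i)`
with `j ≥ 0` extend over `0`, and those with `j` very negative extend over `∞`, which leaves
finitely many exponents. -/
theorem exists_finite_generators : ∃ S : Set P.bundle.mid, S.Finite ∧ ∀ W : AddSubgroup P.bundle.mid,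
    (∀ x, P.bundle.resFin x ∈ W) → (∀ g, (T (-1) : R[T;T⁻¹]) • P.bundle.resInf g ∈ W) →
    (∀ (r : R), ∀ x ∈ S, (LaurentPolynomial.C r : R[T;T⁻¹]) • x ∈ W) → W = ⊤ := by
  set E := P.bundle
  obtain ⟨n, a, b, hab⟩ := E.fin.isVolumeForm.exists_sum_eq_one
  let c : Fin n ⊕ Fin n → E.fin := Sum.elim a b
  choose N hN using fun i => E.exists_mem_poleFiltration (c i)
  refine ⟨Set.range fun i : (i : Fin n ⊕ Fin n) × Fin (N i + 1) =>
    (T (-(i.2 : ℕ)) : R[T;T⁻¹]) • E.resFin (c i.1), Set.finite_range _, fun W hF hG hS => ?_⟩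
  have h1 : ∀ i (r : R) (j : ℤ), (LaurentPolynomial.C r * T j : R[T;T⁻¹]) • E.resFin (c i) ∈ W := by
    intro i r j
    rcases le_or_gt 0 j with hj | hj
    · lift j to ℕ using hj
      rw [mul_smul, E.T_smul_resFin, ← toLaurent_C, ← E.resFin_smul]
      exact hF _
    · obtain ⟨k, rfl⟩ : ∃ k : ℕ, j = -k := ⟨j.natAbs, by omega⟩
      by_cases hk : k < N i + 1
      · rw [mul_smul]
        exact hS r _ ⟨⟨i, k, hk⟩, rfl⟩
      -- The order is `k - 1` rather than `k`, because one factor `t⁻¹` is reserved for the twist.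
      · obtain ⟨g, hg⟩ := hN i (k - 1) (by omega)
        have : (LaurentPolynomial.C r * T (-(k : ℤ)) : R[T;T⁻¹]) • E.resFin (c i) =
            (T (-1) : R[T;T⁻¹]) • E.resInf (C r • g) := by
          rw [E.resInf_smul, toLaurentInv_C, hg, mul_smul, E.T_smul_T_smul, smul_comm]
          congr 3; omega
        rw [this]
        exact hG _
  have h2 : ∀ i (f : R[T;T⁻¹]), f • E.resFin (c i) ∈ W := fun i f => by
    induction f using LaurentPolynomial.induction_on' with
    | add p q hp hq => rw [add_smul]; exact W.add_mem hp hq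
    | C_mul_T j r => exact h1 i r j
  refine (AddSubgroup.eq_top_iff' W).2 fun m => ?_
  have hab' : ∑ i, E.mid.volForm (E.resFin (a i)) (E.resFin (b i)) = 1 := by
    simp only [SLBundle.volForm_apply, E.cart_resFin.map_vol]
    rw [← map_sum, ← map_one toLaurent]
    exact congr_arg _ hab
  rw [E.mid.isVolumeForm.expand hab' m]
  exact W.sum_mem fun i _ => W.sub_mem (h2 (Sum.inl i) _) (h2 (Sum.inr i) _)

variable [Algebra ℚ R]

/-- The first cohomology of the twist by `-1` of the bundle vanishes. -/
theorem exists_eq_add (m : P.bundle.mid) :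
    ∃ x g, m = P.bundle.resFin x + (T (-1) : R[T;T⁻¹]) • P.bundle.resInf g := by
  revert m
  set E := P.bundle
  let _ : Module R E.mid := Module.compHom E.mid (LaurentPolynomial.C (R := R))
  have hRsmul : ∀ (r : R) (m : E.mid), r • m = (LaurentPolynomial.C r : R[T;T⁻¹]) • m :=
    fun _ _ => rfl
  let W : Submodule R E.mid :=
    { carrier := {m | ∃ x g, m = E.resFin x + (T (-1) : R[T;T⁻¹]) • E.resInf g}
      zero_mem' := ⟨0, 0, by simp⟩
      add_mem' := by
        rintro _ _ ⟨x, g, rfl⟩ ⟨x', g', rfl⟩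
        exact ⟨x + x', g + g', by rw [map_add, map_add, smul_add]; abel⟩
      smul_mem' := by
        rintro r _ ⟨x, g, rfl⟩
        refine ⟨C r • x, C r • g, ?_⟩
        rw [hRsmul, smul_add, E.resFin_smul, E.resInf_smul, toLaurent_C, toLaurentInv_C, smul_comm] }
  have hWF : ∀ x, E.resFin x ∈ W := fun x => ⟨x, 0, by simp⟩
  have hWG : ∀ g, (T (-1) : R[T;T⁻¹]) • E.resInf g ∈ W := fun g => ⟨0, g, by simp⟩
  suffices hW : W = ⊤ by
    intro m
    have : m ∈ W := by rw [hW]; trivial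
    exact this
  by_contra hW
  obtain ⟨S, hS, hgen⟩ := P.exists_finite_generators
  have hWS : W ⊔ Submodule.span R S = ⊤ := by
    have := hgen (W ⊔ Submodule.span R S).toAddSubgroup
      (fun x => Submodule.mem_sup_left (hWF x)) (fun g => Submodule.mem_sup_left (hWG g))
      (fun r x hx => Submodule.mem_sup_right
        (Submodule.smul_mem _ r (Submodule.subset_span hx)))
    refine Submodule.eq_top_iff'.2 fun x => ?_
    have hx : x ∈ (W ⊔ Submodule.span R S).toAddSubgroup := by rw [this]; trivial
    exact hx
  -- If the cohomology is non-zero, some functional `l` with values in a residue field detects it.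
  obtain ⟨I, hI, l, hl0, hlW⟩ := exists_residue_functional hW hS hWS
  let _ : Field (R ⧸ I) := Ideal.Quotient.field I
  have : CharZero (R ⧸ I) := algebraRat.charZero _
  have hl : ∀ (r : R) m, l ((LaurentPolynomial.C r : R[T;T⁻¹]) • m) = Ideal.Quotient.mk I r * l m :=
    fun r m => by
      rw [← hRsmul, l.map_smul, Algebra.smul_def]; rfl
  have hvan : ∀ N, ∀ x ∈ E.poleFiltration N, ∀ n : ℕ, N ≤ n →
      l ((T (-(n + 1 : ℕ)) : R[T;T⁻¹]) • E.resFin x) = 0 := by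
    rintro N x ⟨g, hg⟩ n hn
    refine hlW _ ?_
    have : (T (-(n + 1 : ℕ)) : R[T;T⁻¹]) • E.resFin x =
        (T (-1) : R[T;T⁻¹]) • E.resInf ((X ^ (n - N) : R[X]) • g) := by
      rw [hg, ← E.T_smul_resInf, E.T_smul_T_smul, E.T_smul_T_smul]
      congr 2; push_cast [Nat.cast_sub hn]; ring
    rw [this]
    exact hWG _
  -- Explicit Serre duality: `x` is sent to the generating series of `l (t ^ (-n - 1) x)`. It is a
  -- polynomial since `l` kills `t ^ (-n - 1) x` once `n` reaches the pole order of `x` at `∞`.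
  have hex : ∀ x, ∃ q : (R ⧸ I)[X], ∀ n : ℕ,
      q.coeff n = l ((T (-(n + 1 : ℕ)) : R[T;T⁻¹]) • E.resFin x) := fun x => by
    obtain ⟨N, hN⟩ := E.exists_mem_poleFiltration x
    refine ⟨∑ n ∈ Finset.range N, monomial n (l ((T (-(n + 1 : ℕ)) : R[T;T⁻¹]) • E.resFin x)),
      fun n => ?_⟩
    simp only [finsetSum_coeff, coeff_monomial, Finset.sum_ite_eq', Finset.mem_range]
    split_ifs with hn
    · rfl
    · exact (hvan N x (hN N le_rfl) n (by omega)).symm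
  choose ξ₀ hξ₀ using hex
  let ξ : E.fin →+ (R ⧸ I)[X] := AddMonoidHom.mk' ξ₀ fun x y => by
    ext n; rw [coeff_add, hξ₀, hξ₀, hξ₀, map_add, smul_add, map_add]
  have hξ : ∀ x (n : ℕ), (ξ x).coeff n = l ((T (-(n + 1 : ℕ)) : R[T;T⁻¹]) • E.resFin x) := hξ₀
  -- Multiplication by `t ^ j` shifts coefficients; those with `n < j` vanish because `l` kills the
  -- sections over the first chart. The bound on the degree is `hvan`.
  have hfun : IsFunctional (Ideal.Quotient.mk I) E.poleFiltration 1 ξ := by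
    refine ⟨fun p x => ?_, fun N x hx hx0 => ?_⟩
    · induction p using Polynomial.induction_on' with
      | add p q hp hq => rw [add_smul, map_add, hp, hq, Polynomial.map_add, add_mul]
      | monomial j r =>
        ext n
        rw [hξ, map_monomial, ← C_mul_X_pow_eq_monomial, ← C_mul_X_pow_eq_monomial, mul_assoc,
          coeff_C_mul, coeff_X_pow_mul', E.resFin_smul, toLaurent_C_mul_X_pow, mul_smul, smul_comm,
          hl, E.T_smul_T_smul]
        congr 1
        split_ifs with hjn
        · rw [hξ]
          congr 3; push_cast [Nat.cast_sub hjn]; ring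
        · obtain ⟨k, hk⟩ : ∃ k : ℕ, -((n + 1 : ℕ) : ℤ) + j = k :=
            ⟨j - (n + 1), by push_cast [Nat.cast_sub (by omega : n + 1 ≤ j)]; ring⟩
          rw [hk, E.T_smul_resFin]
          exact hlW _ (hWF _)
    · by_contra! hcon
      refine hx0 (leadingCoeff_eq_zero.1 ?_)
      rw [leadingCoeff, hξ]
      exact hvan N x hx _ (by omega)
  have hξ0 := P.isLogFiltration.functional_eq_zero Ideal.Quotient.mk_surjective hfun
  -- Every `m` is `t ^ (-N - 1) x` with `x` over the first chart, so `l m` is a coefficient of `ξ x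
  -- = 0`.
  refine hl0 (LinearMap.ext fun m => ?_)
  obtain ⟨N, hN⟩ := E.exists_resFin m
  obtain ⟨x, hx⟩ := hN (N + 1) (by omega)
  have h1 := hξ x N
  rw [hξ0, ← hx, E.T_smul_T_smul] at h1
  simpa using h1.symm

-- The residue pairing of `H⁰(𝓔(-1))` with `H¹(𝓔(-1))` is well defined: the first summand
-- contributes exponents `≥ 0`, the second one exponents `≤ -2`, and `-1` is missed by both.
omit [Algebra ℚ R] in
theorem volume_coeff_eq_zero {x y : P.bundle.fin} {g g' : P.bundle.inf}
    (h : P.bundle.resFin x = (T (-1) : R[T;T⁻¹]) • P.bundle.resInf g) :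
    (P.bundle.mid.vol (P.bundle.resFin x)
      (P.bundle.resFin y + (T (-1) : R[T;T⁻¹]) • P.bundle.resInf g')).coeff (-1) = 0 := by
  have h2 : P.bundle.mid.vol (P.bundle.resFin x) ((T (-1) : R[T;T⁻¹]) • P.bundle.resInf g') =
      toLaurentInv R (P.bundle.inf.vol g g') * T (-2) := by
    rw [h, SLBundle.vol_smul_left, SLBundle.vol_smul_right, P.bundle.cart_resInf.map_vol,
      ← mul_assoc, ← LaurentPolynomial.T_add, LaurentPolynomial.T_mul]
    rfl
  rw [SLBundle.vol_add_right, AddMonoidAlgebra.coeff_add, Finsupp.add_apply,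
    P.bundle.cart_resFin.map_vol, coeff_toLaurent_of_neg _ (by omega), h2, coeff_mul_T,
    coeff_toLaurentInv_of_pos _ (by omega), add_zero]

/-- The twist by `-1` of the bundle has no global sections. -/
theorem eq_zero_of_resFin_eq {x : P.bundle.fin} {g : P.bundle.inf}
    (h : P.bundle.resFin x = (T (-1) : R[T;T⁻¹]) • P.bundle.resInf g) : x = 0 := by
  refine P.bundle.resFin_injective ((P.bundle.mid.eq_zero_of_vol fun m => ?_).trans
    (map_zero _).symm)
  ext j
  -- The shift of `m` moves the coefficient at `j` to the place `-1`.
  obtain ⟨y, g', hm⟩ := P.exists_eq_add ((T (-1 - j) : R[T;T⁻¹]) • m)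
  have h1 := P.volume_coeff_eq_zero (y := y) (g' := g') h
  rw [← hm, SLBundle.vol_smul_right, LaurentPolynomial.T_mul, coeff_mul_T] at h1
  rw [show (-1 : ℤ) - (-1 - j) = j by ring] at h1
  simpa using h1

/-- The vanishing of `H¹(𝓔(-1))` applied to `t⁻¹ x`. It makes the evaluation of global sections at
`0` surjective. -/
theorem exists_eq_add_X_smul (x : P.bundle.fin) : ∃ h y g,
    x = h + (X : R[X]) • y ∧ P.bundle.resFin h = P.bundle.resInf g := by
  obtain ⟨y, g, hx⟩ := P.exists_eq_add ((T (-1) : R[T;T⁻¹]) • P.bundle.resFin x)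
  refine ⟨x - (X : R[X]) • y, y, g, by abel, ?_⟩
  have := congr_arg (fun m => (T 1 : R[T;T⁻¹]) • m) hx
  simp only [smul_add, P.bundle.T_smul_T_smul] at this
  rw [map_sub, P.bundle.resFin_smul, toLaurent_X, sub_eq_iff_eq_add, add_comm]
  simpa using this

/-- A global section which vanishes at `0` is `t` times a section of the twist by `-1`, and that
twist has none. -/
theorem eq_zero_of_evZero {x : P.bundle.fin} {g : P.bundle.inf}
    (h : P.bundle.resFin x = P.bundle.resInf g) (h0 : P.bundle.evZero x = 0) : x = 0 := by
  obtain ⟨y, hy⟩ := P.bundle.cart_evZero.exists_eq_smul h0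
  rw [C_0, sub_zero] at hy
  have : y = 0 := P.eq_zero_of_resFin_eq (g := g) (by
    rw [← h, hy, P.bundle.resFin_smul, toLaurent_X, P.bundle.T_smul_T_smul]; simp)
  rw [hy, this, smul_zero]

theorem exists_section (e : P.bundle.fib .zero) : ∃ (x : P.bundle.fin) (g : P.bundle.inf),
    P.bundle.resFin x = P.bundle.resInf g ∧ P.bundle.evZero x = e := by
  obtain ⟨x, rfl⟩ := P.bundle.cart_evZero.surjective (fun r => ⟨C r, by simp⟩) e
  obtain ⟨h, y, g, rfl, hg⟩ := P.exists_eq_add_X_smul x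
  refine ⟨h, g, hg, ?_⟩
  rw [map_add, P.bundle.cart_evZero.map_smul]
  simp

theorem exists_sections : ∃ (j : P.bundle.fib .zero →+ P.bundle.fin)
    (k : P.bundle.fib .zero →+ P.bundle.inf),
    (∀ e, P.bundle.resFin (j e) = P.bundle.resInf (k e)) ∧ ∀ e, P.bundle.evZero (j e) = e := by
  choose j k h1 h2 using P.exists_section
  have hj : ∀ e e', j (e + e') = j e + j e' := fun e e' => by
    refine sub_eq_zero.1 (P.eq_zero_of_evZero (g := k (e + e') - (k e + k e')) ?_ ?_)
    · simp only [map_sub, map_add, h1]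
    · simp only [map_sub, map_add, h2, sub_self]
  refine ⟨AddMonoidHom.mk' j hj, AddMonoidHom.mk' k fun e e' => P.bundle.resInf_injective ?_,
    h1, h2⟩
  rw [map_add, ← h1, ← h1, ← h1, hj, map_add]

/-- The extension of a vector in the fibre at `0` to a global section, on `ℙ¹ ∖ {∞}`. -/
def secFin : P.bundle.fib .zero →+ P.bundle.fin := P.exists_sections.choose

/-- The extension of a vector in the fibre at `0` to a global section, on `ℙ¹ ∖ {0}`. -/
def secInf : P.bundle.fib .zero →+ P.bundle.inf := P.exists_sections.choose_spec.choose

theorem resFin_secFin (e : P.bundle.fib .zero) :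
    P.bundle.resFin (P.secFin e) = P.bundle.resInf (P.secInf e) :=
  P.exists_sections.choose_spec.choose_spec.1 e

theorem evZero_secFin (e : P.bundle.fib .zero) : P.bundle.evZero (P.secFin e) = e :=
  P.exists_sections.choose_spec.choose_spec.2 e

theorem eq_secFin {x : P.bundle.fin} {g : P.bundle.inf}
    (h : P.bundle.resFin x = P.bundle.resInf g) : x = P.secFin (P.bundle.evZero x) := by
  refine sub_eq_zero.1 (P.eq_zero_of_evZero (g := g - P.secInf (P.bundle.evZero x)) ?_ ?_)
  · rw [map_sub, map_sub, h, resFin_secFin]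
  · rw [map_sub, evZero_secFin, sub_self]

theorem secFin_smul (r : R) (e : P.bundle.fib .zero) : P.secFin (r • e) = C r • P.secFin e := by
  have h := P.eq_secFin (x := C r • P.secFin e) (g := C r • P.secInf e) (by
    rw [P.bundle.resFin_smul, P.bundle.resInf_smul, resFin_secFin, toLaurent_C, toLaurentInv_C])
  rw [h, P.bundle.cart_evZero.map_smul, evZero_secFin]
  simp

theorem secInf_smul (r : R) (e : P.bundle.fib .zero) : P.secInf (r • e) = C r • P.secInf e :=
  P.bundle.resInf_injective (by
    rw [← resFin_secFin, secFin_smul, P.bundle.resFin_smul, P.bundle.resInf_smul, resFin_secFin,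
      toLaurent_C, toLaurentInv_C])

/-- The volume of two global sections is a global function on the projective line, hence constant,
and its value is read off at `0`. -/
theorem vol_sec (e e' : P.bundle.fib .zero) :
    P.bundle.fin.vol (P.secFin e) (P.secFin e') = C ((P.bundle.fib .zero).vol e e') ∧
      P.bundle.inf.vol (P.secInf e) (P.secInf e') = C ((P.bundle.fib .zero).vol e e') := by
  have h := P.bundle.cart_resFin.map_vol (P.secFin e) (P.secFin e')
  rw [resFin_secFin, resFin_secFin, P.bundle.cart_resInf.map_vol] at h
  obtain ⟨h1, h2⟩ := eq_C_of_toLaurent_eq h.symm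
  have h3 := P.bundle.cart_evZero.map_vol (P.secFin e) (P.secFin e')
  rw [evZero_secFin, evZero_secFin, h1] at h3
  rw [h3]
  simp only [coe_evalRingHom, eval_C]
  exact ⟨h1, h2⟩

theorem cart_secFin : IsCart C (P.bundle.fib .zero) P.bundle.fin P.secFin :=
  .of_vol P.secFin_smul fun e e' => (P.vol_sec e e').1

theorem cart_secInf : IsCart C (P.bundle.fib .zero) P.bundle.inf P.secInf :=
  .of_vol P.secInf_smul fun e e' => (P.vol_sec e e').2

/-- The connection in terms of the trivialization by global sections. -/
theorem exists_nabla_sec (e : P.bundle.fib .zero) : ∃ p q,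
    P.conn.nablaFin (P.secFin e) = P.secFin p + (X : R[X]) • P.secFin q ∧
      P.conn.nablaInf (P.secInf e) = (X : R[X]) • P.secInf p + P.secInf q := by
  obtain ⟨h, y, g, hx, hg⟩ := P.exists_eq_add_X_smul (P.conn.nablaFin (P.secFin e))
  have h1 : P.bundle.resFin (P.conn.nablaFin (P.secFin e)) =
      (T 1 : R[T;T⁻¹]) • P.bundle.resInf (P.conn.nablaInf (P.secInf e)) := by
    rw [P.conn.res_fin, resFin_secFin, nablaMid_resInf]
  -- The derivative of a global section has at most a simple pole at `∞`. After the global part `h`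
  -- is removed, the quotient `y` by `t` extends over `∞`.
  have h2 : P.bundle.resFin y = P.bundle.resInf (P.conn.nablaInf (P.secInf e) - (X : R[X]) • g) := by
    rw [hx, map_add, P.bundle.resFin_smul, toLaurent_X] at h1
    have := congr_arg (fun m => (T (-1) : R[T;T⁻¹]) • m) h1
    simp only [smul_add, P.bundle.T_smul_T_smul] at this
    rw [map_sub, P.bundle.resInf_smul, toLaurentInv_X, ← hg, eq_sub_iff_add_eq, add_comm]
    simpa using this
  have h3 := P.eq_secFin hg
  have h4 := P.eq_secFin h2
  refine ⟨P.bundle.evZero h, P.bundle.evZero y, by rw [← h3, ← h4, hx], ?_⟩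
  refine P.bundle.resInf_injective ?_
  rw [map_add, P.bundle.resInf_smul, ← resFin_secFin, ← resFin_secFin, ← h3, ← h4, h2, hg, map_sub,
    P.bundle.resInf_smul]
  abel

end DeRhamPoint

theorem isUnit_two_of_algebra (R A : Type*) [CommRing R] [Algebra ℚ R] [CommRing A] [Algebra R A] :
    IsUnit (2 : A) := by
  have h : IsUnit (2 : ℚ) := isUnit_iff_ne_zero.2 two_ne_zero
  have := (h.map (algebraMap ℚ R)).map (algebraMap R A)
  simpa only [map_ofNat] using this

namespace IsCart

variable {R R' R'' : Type u} [CommRing R] [CommRing R'] [CommRing R'']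
  {f : R →+* R'} {f' : R' →+* R''} {E : SLBundle R} {E' : SLBundle R'} {E'' : SLBundle R''}
  {g : E →+ E'} {h : E →+ E''}

/-- The pullback map `E' → E''` for two pullbacks `E'`, `E''` of `E`. -/
def desc (hg : IsCart f E E' g) (hh : IsCart (f'.comp f) E E'' h) : E' →+ E'' :=
  hg.lift f' h hh.map_smul

theorem desc_smul_map (hg : IsCart f E E' g) (hh : IsCart (f'.comp f) E E'' h) (r : R') (x : E) :
    hg.desc hh (r • g x) = f' r • h x := hg.lift_smul_map f' h _ r x

theorem desc_map (hg : IsCart f E E' g) (hh : IsCart (f'.comp f) E E'' h) (x : E) :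
    hg.desc hh (g x) = h x := hg.lift_map f' h _ x

theorem desc_cart (hg : IsCart f E E' g) (hh : IsCart (f'.comp f) E E'' h) :
    IsCart f' E' E'' (hg.desc hh) :=
  hg.of_comp (hg.lift_smul f' h _) (by
    have : (hg.desc hh).comp g = h := AddMonoidHom.ext (hg.desc_map hh)
    rwa [this])

theorem congr {f₁ : R →+* R'} (hg : IsCart f E E' g) (hf : f = f₁) : IsCart f₁ E E' g := hf ▸ hg

end IsCart

/-! ### Connections on trivial bundles -/

section LaurentDerivation

open LaurentPolynomial (T)

variable (R : Type u) [CommRing R]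

/-- The derivation `t (t - 1) d / dt` of `R[t]`. -/
def polyDerivation : R[X] →ₗ[R] R[X] := (LinearMap.mulLeft R (X * (X - 1))) ∘ₗ derivative

theorem polyDerivation_apply (p : R[X]) : polyDerivation R p = X * (X - 1) * derivative p := rfl

/-- The derivation `t (t - 1) d / dt` of `R[t, t⁻¹]`. -/
def laurentDerivation : R[T;T⁻¹] →ₗ[R] R[T;T⁻¹] :=
  Finsupp.linearCombination R (fun n : ℤ => (n : R[T;T⁻¹]) * T n * (T 1 - 1)) ∘ₗ
    (AddMonoidAlgebra.coeffLinearEquiv R).toLinearMap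

variable {R}

theorem polyDerivation_mul (p q : R[X]) :
    polyDerivation R (p * q) = polyDerivation R p * q + p * polyDerivation R q := by
  simp only [polyDerivation_apply, derivative_mul]; ring

theorem laurentDerivation_C_mul_T (r : R) (n : ℤ) :
    laurentDerivation R (LaurentPolynomial.C r * T n) =
      (n : R[T;T⁻¹]) * LaurentPolynomial.C r * T n * (T 1 - 1) := by
  rw [← LaurentPolynomial.single_eq_C_mul_T]
  simp only [laurentDerivation, LinearMap.comp_apply, LinearEquiv.coe_coe]
  change Finsupp.linearCombination R _ (Finsupp.single n r) = _
  rw [Finsupp.linearCombination_single, LaurentPolynomial.smul_eq_C_mul]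
  ring

theorem laurentDerivation_mul (r : R) (n : ℤ) (f : R[T;T⁻¹]) :
    laurentDerivation R (LaurentPolynomial.C r * T n * f) =
      ((n : R[T;T⁻¹]) * LaurentPolynomial.C r * T n * (T 1 - 1)) * f +
        LaurentPolynomial.C r * T n * laurentDerivation R f := by
  induction f using LaurentPolynomial.induction_on' with
  | add p q hp hq => rw [mul_add, map_add, map_add, hp, hq]; ring
  | C_mul_T m s =>
    have : LaurentPolynomial.C r * T n * (LaurentPolynomial.C s * T m) =
        LaurentPolynomial.C (r * s) * T (n + m) := by
      rw [LaurentPolynomial.T_add, map_mul]; ring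
    rw [this, laurentDerivation_C_mul_T, laurentDerivation_C_mul_T, LaurentPolynomial.T_add, map_mul]
    push_cast
    ring

theorem toLaurent_polyDerivation (p : R[X]) :
    toLaurent (polyDerivation R p) = laurentDerivation R (toLaurent p) := by
  induction p using Polynomial.induction_on' with
  | add p q hp hq => simp only [map_add, hp, hq]
  | monomial n r =>
    rw [toLaurent_C_mul_T, laurentDerivation_C_mul_T, polyDerivation_apply, derivative_monomial]
    rcases n with _ | n
    · simp
    · rw [map_mul, map_mul, map_sub, toLaurent_X, map_one, toLaurent_C_mul_T]
      push_cast
      rw [map_mul, LaurentPolynomial.T_add]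
      simp only [map_add, map_natCast, map_one]
      ring

/-- With `u = t⁻¹`, the vector fields are related by `u (u - 1) d/du = t⁻¹ · t (t - 1) d/dt`. -/
theorem toLaurentInv_polyDerivation (p : R[X]) :
    toLaurentInv R (polyDerivation R p) = T (-1) * laurentDerivation R (toLaurentInv R p) := by
  induction p using Polynomial.induction_on' with
  | add p q hp hq => simp only [map_add, hp, hq, mul_add]
  | monomial n r =>
    have hT : (T (-1) : R[T;T⁻¹]) * T 1 = 1 := by rw [← LaurentPolynomial.T_add]; simp
    have hmon : ∀ (n : ℕ) (r : R), toLaurentInv R (monomial n r) =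
        LaurentPolynomial.C r * T (-(n : ℤ)) := fun n r => by
      rw [toLaurentInv_apply, toLaurent_C_mul_T, map_mul, LaurentPolynomial.invert_C,
        LaurentPolynomial.invert_T]
    rw [hmon, laurentDerivation_C_mul_T, polyDerivation_apply, derivative_monomial]
    rcases n with _ | n
    · simp
    · rw [map_mul, map_mul, map_sub, toLaurentInv_X, map_one, hmon, Nat.add_sub_cancel]
      have : (T (-((n + 1 : ℕ) : ℤ)) : R[T;T⁻¹]) = T (-1) * T (-(n : ℤ)) := by
        rw [← LaurentPolynomial.T_add]; congr 1; push_cast; ring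
      rw [this, map_mul]
      push_cast
      simp only [map_add, map_natCast, map_one]
      linear_combination (T (-1) * LaurentPolynomial.C r * T (-(n : ℤ)) * ((n : R[T;T⁻¹]) + 1)) * hT

end LaurentDerivation

namespace SLBundle

variable {R : Type u} [CommRing R] (E : SLBundle R) (A : Type u) [CommRing A] [Algebra R A]
  (h2 : IsUnit (2 : A))

/-- The first order operator `δ + a B + b B'` on the pullback of `E`. -/
def operator (δ : A →ₗ[R] A) (a b : A) (B B' : E →ₗ[R] E) :
    E.baseChange A h2 →+ E.baseChange A h2 :=
  (TensorProduct.map δ (LinearMap.id (R := R) (M := E))).toAddMonoidHom +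
    (a • B.baseChange A + b • B'.baseChange A : TensorProduct R A E →ₗ[A] _).toAddMonoidHom

theorem operator_smul_map (δ : A →ₗ[R] A) (a b : A) (B B' : E →ₗ[R] E) (p : A) (x : E) :
    E.operator A h2 δ a b B B' (p • E.toBaseChange A h2 x) =
      δ p • E.toBaseChange A h2 x + (a * p) • E.toBaseChange A h2 (B x) +
        (b * p) • E.toBaseChange A h2 (B' x) := by
  rw [smul_toBaseChange, smul_toBaseChange, smul_toBaseChange, smul_toBaseChange]
  change δ p ⊗ₜ[R] x + (a • (p ⊗ₜ[R] B x) + b • (p ⊗ₜ[R] B' x)) =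
    (δ p ⊗ₜ[R] x + (a * p) ⊗ₜ[R] B x + (b * p) ⊗ₜ[R] B' x : TensorProduct R A E)
  rw [TensorProduct.smul_tmul', TensorProduct.smul_tmul', smul_eq_mul, smul_eq_mul, add_assoc]

/-- The Leibniz rule is assumed for a single `p`, since over Laurent polynomials it is stated and
used for monomials only. -/
theorem operator_smul {δ : A →ₗ[R] A} (a b : A) (B B' : E →ₗ[R] E) {p d : A}
    (hp : ∀ q, δ (p * q) = d * q + p * δ q) (m : E.baseChange A h2) :
    E.operator A h2 δ a b B B' (p • m) = d • m + p • E.operator A h2 δ a b B B' m := by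
  refine (E.isCart_toBaseChange A h2).induction (P := fun m => E.operator A h2 δ a b B B' (p • m) =
    d • m + p • E.operator A h2 δ a b B B' m) (by simp) (fun x y hx hy => ?_) (fun q x => ?_) m
  · rw [smul_add, map_add, hx, hy, map_add, smul_add, smul_add]; abel
  · rw [smul_smul, operator_smul_map, operator_smul_map, hp]
    module

/-- The form is flat if the endomorphisms are infinitesimal automorphisms. -/
theorem operator_vol {δ : A →ₗ[R] A} (a b : A) {B B' : E →ₗ[R] E}
    (hδ : ∀ p q, δ (p * q) = δ p * q + p * δ q)
    (hδ' : ∀ r, δ (algebraMap R A r) = 0)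
    (hB : ∀ x y, E.vol (B x) y + E.vol x (B y) = 0)
    (hB' : ∀ x y, E.vol (B' x) y + E.vol x (B' y) = 0) (m n : E.baseChange A h2) :
    δ ((E.baseChange A h2).vol m n) =
      (E.baseChange A h2).vol (E.operator A h2 δ a b B B' m) n +
        (E.baseChange A h2).vol m (E.operator A h2 δ a b B B' n) := by
  have hc := E.isCart_toBaseChange A h2
  have z1 : ∀ n, (E.baseChange A h2).vol 0 n = 0 := fun n => (E.baseChange A h2).volForm.map_zero₂ n
  have z2 : ∀ m, (E.baseChange A h2).vol m 0 = 0 := fun m =>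
    ((E.baseChange A h2).volForm m).map_zero
  refine hc.induction (P := fun m => δ ((E.baseChange A h2).vol m n) =
      (E.baseChange A h2).vol (E.operator A h2 δ a b B B' m) n +
        (E.baseChange A h2).vol m (E.operator A h2 δ a b B B' n)) ?_ (fun x y hx hy => ?_)
        (fun p x => ?_) m
  · simp [z1]
  · rw [vol_add_left, map_add, map_add, hx, hy, vol_add_left, vol_add_left]; ring
  refine hc.induction (P := fun n => δ ((E.baseChange A h2).vol (p • E.toBaseChange A h2 x) n) =
      (E.baseChange A h2).vol (E.operator A h2 δ a b B B' (p • E.toBaseChange A h2 x)) n +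
        (E.baseChange A h2).vol (p • E.toBaseChange A h2 x) (E.operator A h2 δ a b B B' n)) ?_
        (fun x y hx hy => ?_) (fun q y => ?_) n
  · simp [z2]
  · rw [vol_add_right, map_add, map_add, hx, hy, vol_add_right, vol_add_right]; ring
  · rw [operator_smul_map, operator_smul_map]
    simp only [vol_add_left, vol_add_right, vol_smul_left, vol_smul_right, hc.map_vol, hδ, hδ']
    have e1 := congr_arg (algebraMap R A) (hB x y)
    have e2 := congr_arg (algebraMap R A) (hB' x y)
    rw [map_add, map_zero] at e1 e2
    linear_combination (-(a * p * q)) * e1 - (b * p * q) * e2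

end SLBundle

/-! ### The connection attached to a point of the linearized moduli -/

namespace CotangentPoint

open LaurentPolynomial (T)

variable {R : Type u} [CommRing R] (P : CotangentPoint R)

theorem vol_B (s : Pt) (x y : P.bundle) :
    P.bundle.vol (P.B s x) y + P.bundle.vol x (P.B s y) = 0 :=
  (P.isLine s).vol_map_add (P.B_line s) (P.B_mem s) x y

theorem B_infty (x : P.bundle) : P.B .infty x = -(P.B .zero x + P.B .one x) := by
  have := LinearMap.congr_fun P.sum_eq_zero x
  exact (neg_eq_of_add_eq_zero_right this).symm

theorem cart_eval (c : R) :
    IsCart ((evalRingHom c).comp C) P.bundle P.bundle (AddMonoidHom.id P.bundle) :=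
  (IsCart.id P.bundle).congr (by ext; simp)

variable [Algebra ℚ R]

/-- Sections of the trivial bundle over `ℙ¹ ∖ {∞}` and over `ℙ¹ ∖ {0}`. -/
abbrev poly : SLBundle R[X] := P.bundle.baseChange R[X] (isUnit_two_of_algebra R _)

/-- Sections of the trivial bundle over `ℙ¹ ∖ {0, ∞}`. -/
abbrev laurent : SLBundle R[T;T⁻¹] := P.bundle.baseChange R[T;T⁻¹] (isUnit_two_of_algebra R _)

/-- Constant sections. -/
abbrev toPoly : P.bundle →+ P.poly := P.bundle.toBaseChange R[X] (isUnit_two_of_algebra R _)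

/-- Constant sections. -/
abbrev toLaur : P.bundle →+ P.laurent := P.bundle.toBaseChange R[T;T⁻¹] (isUnit_two_of_algebra R _)

theorem cart_toPoly : IsCart C P.bundle P.poly P.toPoly := P.bundle.isCart_toBaseChange R[X] _

theorem cart_toLaur : IsCart LaurentPolynomial.C P.bundle P.laurent P.toLaur :=
  P.bundle.isCart_toBaseChange R[T;T⁻¹] _

theorem cart_toLaurent : IsCart (toLaurent.comp C) P.bundle P.laurent P.toLaur :=
  P.cart_toLaur.congr (by ext; simp)

theorem cart_toLaurentInv : IsCart ((toLaurentInv R).comp C) P.bundle P.laurent P.toLaur :=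
  P.cart_toLaur.congr (RingHom.ext fun r => (toLaurentInv_C r).symm)

/-- The trivial bundle on the projective line. -/
def bundleP1 : SLBundleP1 R where
  fin := P.poly
  inf := P.poly
  mid := P.laurent
  resFin := P.cart_toPoly.desc P.cart_toLaurent
  resInf := P.cart_toPoly.desc P.cart_toLaurentInv
  cart_resFin := P.cart_toPoly.desc_cart _
  cart_resInf := P.cart_toPoly.desc_cart _
  fib _ := P.bundle
  evZero := P.cart_toPoly.desc (P.cart_eval 0)
  evOne := P.cart_toPoly.desc (P.cart_eval 1)
  evInfty := P.cart_toPoly.desc (P.cart_eval 0)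
  cart_evZero := P.cart_toPoly.desc_cart _
  cart_evOne := P.cart_toPoly.desc_cart _
  cart_evInfty := P.cart_toPoly.desc_cart _

theorem resFin_smul_toPoly (p : R[X]) (x : P.bundle) :
    P.cart_toPoly.desc P.cart_toLaurent (p • P.toPoly x) = toLaurent p • P.toLaur x :=
  P.cart_toPoly.desc_smul_map P.cart_toLaurent p x

theorem resInf_smul_toPoly (p : R[X]) (x : P.bundle) :
    P.cart_toPoly.desc P.cart_toLaurentInv (p • P.toPoly x) = toLaurentInv R p • P.toLaur x :=
  P.cart_toPoly.desc_smul_map P.cart_toLaurentInv p x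

theorem ev_smul_toPoly (c : R) (p : R[X]) (x : P.bundle) :
    P.cart_toPoly.desc (P.cart_eval c) (p • P.toPoly x) = p.eval c • x :=
  P.cart_toPoly.desc_smul_map (P.cart_eval c) p x

/-- The connection on `ℙ¹ ∖ {∞}`. -/
def nablaFin : P.poly →+ P.poly :=
  -- Since `B_0 + B_1 = -B_∞`, one has `B_0 dt/t + B_1 dt/(t - 1) = (-B_0 - t B_∞) dt/(t (t - 1))`.
  P.bundle.operator R[X] _ (polyDerivation R) (-1) (-X) (P.B .zero) (P.B .infty)

/-- The connection on `ℙ¹ ∖ {0}`. -/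
def nablaInf : P.poly →+ P.poly :=
  -- The same form in the other chart: `ω = u ω'` turns `-B_0 - t B_∞` into `-u B_0 - B_∞`.
  P.bundle.operator R[X] _ (polyDerivation R) (-X) (-1) (P.B .zero) (P.B .infty)

/-- The connection on `ℙ¹ ∖ {0, ∞}`. -/
def nablaMid : P.laurent →+ P.laurent :=
  P.bundle.operator R[T;T⁻¹] _ (laurentDerivation R) (-1) (-T 1) (P.B .zero) (P.B .infty)

theorem nablaFin_smul_toPoly (p : R[X]) (x : P.bundle) : P.nablaFin (p • P.toPoly x) =
    (X * (X - 1) * derivative p) • P.toPoly x + (-1 * p) • P.toPoly (P.B .zero x) +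
      (-X * p) • P.toPoly (P.B .infty x) :=
  P.bundle.operator_smul_map ..

theorem nablaInf_smul_toPoly (p : R[X]) (x : P.bundle) : P.nablaInf (p • P.toPoly x) =
    (X * (X - 1) * derivative p) • P.toPoly x + (-X * p) • P.toPoly (P.B .zero x) +
      (-1 * p) • P.toPoly (P.B .infty x) :=
  P.bundle.operator_smul_map ..

theorem nablaMid_smul_toLaur (p : R[T;T⁻¹]) (x : P.bundle) : P.nablaMid (p • P.toLaur x) =
    laurentDerivation R p • P.toLaur x + (-1 * p) • P.toLaur (P.B .zero x) +
      (-T 1 * p) • P.toLaur (P.B .infty x) :=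
  P.bundle.operator_smul_map ..

theorem resFin_nablaFin (m : P.poly) : P.cart_toPoly.desc P.cart_toLaurent (P.nablaFin m) =
    P.nablaMid (P.cart_toPoly.desc P.cart_toLaurent m) := by
  refine P.cart_toPoly.induction (P := fun m => P.cart_toPoly.desc P.cart_toLaurent (P.nablaFin m) =
    P.nablaMid (P.cart_toPoly.desc P.cart_toLaurent m)) (by simp)
    (fun x y hx hy => by simp only [map_add, hx, hy]) (fun p x => ?_) m
  rw [nablaFin_smul_toPoly, resFin_smul_toPoly, nablaMid_smul_toLaur, map_add, map_add,
    resFin_smul_toPoly, resFin_smul_toPoly, resFin_smul_toPoly, ← polyDerivation_apply,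
    toLaurent_polyDerivation]
  simp

theorem resInf_nablaInf (m : P.poly) : P.cart_toPoly.desc P.cart_toLaurentInv (P.nablaInf m) =
    (T (-1) : R[T;T⁻¹]) • P.nablaMid (P.cart_toPoly.desc P.cart_toLaurentInv m) := by
  refine P.cart_toPoly.induction (P := fun m =>
    P.cart_toPoly.desc P.cart_toLaurentInv (P.nablaInf m) =
      (T (-1) : R[T;T⁻¹]) • P.nablaMid (P.cart_toPoly.desc P.cart_toLaurentInv m)) (by simp)
    (fun x y hx hy => by simp only [map_add, hx, hy, smul_add]) (fun p x => ?_) m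
  have hT : (T (-1) : R[T;T⁻¹]) * T 1 = 1 := by rw [← LaurentPolynomial.T_add]; simp
  have e : -1 * toLaurentInv R p = (T (-1) : R[T;T⁻¹]) * (-T 1 * toLaurentInv R p) := by
    linear_combination (toLaurentInv R p) * hT
  have e' : -T (-1) * toLaurentInv R p = (T (-1) : R[T;T⁻¹]) * (-1 * toLaurentInv R p) := by
    ring
  rw [nablaInf_smul_toPoly, resInf_smul_toPoly, nablaMid_smul_toLaur, map_add, map_add,
    resInf_smul_toPoly, resInf_smul_toPoly, resInf_smul_toPoly, ← polyDerivation_apply,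
    toLaurentInv_polyDerivation, smul_add, smul_add, smul_smul, smul_smul, smul_smul]
  simp only [map_mul, map_neg, map_one, toLaurentInv_X]
  rw [e', ← e]

/-- The connection with residues `B s` on the trivial bundle. -/
def logConnection : LogConnection P.bundleP1 where
  nablaFin := P.nablaFin
  nablaInf := P.nablaInf
  nablaMid := P.nablaMid
  leibniz_fin p m := P.bundle.operator_smul _ _ _ _ _ _ (fun q => polyDerivation_mul p q) m
  leibniz_inf p m := P.bundle.operator_smul _ _ _ _ _ _ (fun q => polyDerivation_mul p q) m
  leibniz_mid r n m := P.bundle.operator_smul _ _ _ _ _ _ (fun q => laurentDerivation_mul r n q) m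
  res_fin := P.resFin_nablaFin
  res_inf := P.resInf_nablaInf
  flat_fin m n := P.bundle.operator_vol _ _ _ _ polyDerivation_mul
    (fun r => by simp [polyDerivation_apply]) (P.vol_B _) (P.vol_B _) m n
  flat_inf m n := P.bundle.operator_vol _ _ _ _ polyDerivation_mul
    (fun r => by simp [polyDerivation_apply]) (P.vol_B _) (P.vol_B _) m n
  residue s := P.B s
  residue_zero m := by
    refine P.cart_toPoly.induction (P := fun m => P.B .zero (P.cart_toPoly.desc (P.cart_eval 0) m) =
      -P.cart_toPoly.desc (P.cart_eval 0) (P.nablaFin m)) (by simp)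
      (fun x y hx hy => by simp only [map_add, hx, hy, neg_add]) (fun p x => ?_) m
    rw [nablaFin_smul_toPoly, map_add, map_add]
    simp only [ev_smul_toPoly]
    simp
  residue_one m := by
    refine P.cart_toPoly.induction (P := fun m => P.B .one (P.cart_toPoly.desc (P.cart_eval 1) m) =
      P.cart_toPoly.desc (P.cart_eval 1) (P.nablaFin m)) (by simp)
      (fun x y hx hy => by simp only [map_add, hx, hy]) (fun p x => ?_) m
    rw [nablaFin_smul_toPoly, map_add, map_add]
    simp only [ev_smul_toPoly, B_infty]
    simp
  residue_infty m := by
    refine P.cart_toPoly.induction (P := fun m => P.B .infty (P.cart_toPoly.desc (P.cart_eval 0) m) =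
      -P.cart_toPoly.desc (P.cart_eval 0) (P.nablaInf m)) (by simp)
      (fun x y hx hy => by simp only [map_add, hx, hy, neg_add]) (fun p x => ?_) m
    rw [nablaInf_smul_toPoly, map_add, map_add]
    simp only [ev_smul_toPoly]
    simp

/-- The de Rham point attached to a point of the linearized moduli. -/
def toDeRham : DeRhamPoint R where
  bundle := P.bundleP1
  conn := P.logConnection
  line := P.line
  isLine := P.isLine
  residue_line := P.B_line

end CotangentPoint

/-! ### Inverses of pullback maps and isomorphisms of de Rham points -/

namespace IsCart

variable {R R' : Type u} [CommRing R] [CommRing R'] {f : R →+* R'} {f' : R' →+* R}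
  {E : SLBundle R} {E' : SLBundle R'} {g : E →+ E'}

theorem exists_inverse (hg : IsCart f E E' g) (h : f'.comp f = RingHom.id R)
    (h' : f.comp f' = RingHom.id R') :
    ∃ k : E' →+ E, IsCart f' E' E k ∧ (∀ x, k (g x) = x) ∧ ∀ y, g (k y) = y := by
  have hi : IsCart (f'.comp f) E E (AddMonoidHom.id E) := (IsCart.id E).congr h.symm
  refine ⟨hg.desc hi, hg.desc_cart hi, hg.desc_map hi, fun y => ?_⟩
  refine DFunLike.congr_fun (hg.hom_ext (k := g.comp (hg.desc hi)) (k' := AddMonoidHom.id E')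
    fun r x => ?_) y
  have e : f (f' r) = r := RingHom.congr_fun h' r
  simp only [AddMonoidHom.comp_apply, desc_smul_map, AddMonoidHom.id_apply, hg.map_smul, e]

/-- The equivalence given by a morphism over the identity. -/
def linearEquiv {E' : SLBundle R} {g : E →+ E'} (hg : IsCart (RingHom.id R) E E' g) :
    E ≃ₗ[R] E' :=
  LinearEquiv.ofBijective { toFun := g, map_add' := g.map_add, map_smul' := hg.map_smul }
    ⟨hg.injective Function.injective_id, hg.surjective Function.surjective_id⟩

/-- Lines are their own orthogonals, so membership is a vanishing of volumes, which an injective `f`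
reflects. Hence the inverse of a morphism automatically respects the lines. -/
theorem mem_line (hg : IsCart f E E' g) (hf : Function.Injective f) {ℓ : Submodule R E}
    {ℓ' : Submodule R' E'} (hℓ : E.IsLine ℓ) (hℓ' : E'.IsLine ℓ') (h : ∀ v ∈ ℓ, g v ∈ ℓ') {x : E}
    (hx : g x ∈ ℓ') : x ∈ ℓ :=
  hℓ.mem_iff.2 fun v hv => hf (by rw [← hg.map_vol, hℓ'.vol_eq_zero hx (h v hv), map_zero])

end IsCart

namespace SLBundleP1

variable {R : Type u} [CommRing R] (E : SLBundleP1 R)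

theorem evZero_surjective : Function.Surjective E.evZero :=
  E.cart_evZero.surjective fun r => ⟨C r, by simp⟩

theorem evOne_surjective : Function.Surjective E.evOne :=
  E.cart_evOne.surjective fun r => ⟨C r, by simp⟩

theorem evInfty_surjective : Function.Surjective E.evInfty :=
  E.cart_evInfty.surjective fun r => ⟨C r, by simp⟩

end SLBundleP1

namespace Conn

theorem Hom.map_residue {L L' : Conn.{u}} (F : Hom L L') (s : Pt) (v : L.pt.bundle.fib s) :
    F.mapFib s (L.pt.conn.residue s v) = L'.pt.conn.residue s (F.mapFib s v) := by
  cases s with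
  | zero =>
    obtain ⟨m, rfl⟩ := L.pt.bundle.evZero_surjective v
    rw [L.pt.conn.residue_zero, map_neg, F.map_evZero, F.map_evZero, L'.pt.conn.residue_zero,
      F.map_nablaFin]
  | one =>
    obtain ⟨m, rfl⟩ := L.pt.bundle.evOne_surjective v
    rw [L.pt.conn.residue_one, F.map_evOne, F.map_evOne, L'.pt.conn.residue_one, F.map_nablaFin]
  | infty =>
    obtain ⟨m, rfl⟩ := L.pt.bundle.evInfty_surjective v
    rw [L.pt.conn.residue_infty, map_neg, F.map_evInfty, F.map_evInfty, L'.pt.conn.residue_infty,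
      F.map_nablaInf]

/-- Fibredness in groupoids: pullback maps over an invertible ring homomorphism are invertible, and
their inverses inherit all compatibilities. -/
theorem isIso_of_base {L L' : Conn.{u}} (F : L ⟶ L') (b : L'.ring →ₐ[ℚ] L.ring)
    (h : b.comp (Hom.base F) = AlgHom.id ℚ _) (h' : (Hom.base F).comp b = AlgHom.id ℚ _) :
    IsIso F := by
  have e : b.toRingHom.comp (Hom.base F).toRingHom = RingHom.id _ :=
    RingHom.ext fun x => DFunLike.congr_fun h x
  have e' : (Hom.base F).toRingHom.comp b.toRingHom = RingHom.id _ :=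
    RingHom.ext fun x => DFunLike.congr_fun h' x
  have p : (mapRingHom b.toRingHom).comp (mapRingHom (Hom.base F).toRingHom) = RingHom.id _ := by
    rw [mapRingHom_comp, e, mapRingHom_id]
  have p' : (mapRingHom (Hom.base F).toRingHom).comp (mapRingHom b.toRingHom) = RingHom.id _ := by
    rw [mapRingHom_comp, e', mapRingHom_id]
  have l : (laurentMap b.toRingHom).comp (laurentMap (Hom.base F).toRingHom) = RingHom.id _ := by
    rw [← AddMonoidAlgebra.mapRingHom_comp, e, AddMonoidAlgebra.mapRingHom_id]
  have l' : (laurentMap (Hom.base F).toRingHom).comp (laurentMap b.toRingHom) = RingHom.id _ := by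
    rw [← AddMonoidAlgebra.mapRingHom_comp, e', AddMonoidAlgebra.mapRingHom_id]
  obtain ⟨kf, cf, kf1, kf2⟩ := (Hom.cart_fin F).exists_inverse p p'
  obtain ⟨ki, ci, ki1, ki2⟩ := (Hom.cart_inf F).exists_inverse p p'
  obtain ⟨km, cm, km1, km2⟩ := (Hom.cart_mid F).exists_inverse l l'
  choose k ck k1 k2 using fun s => (Hom.cart_fib F s).exists_inverse e e'
  have sf : Function.Surjective (Hom.mapFin F) := fun y => ⟨_, kf2 y⟩
  have si : Function.Surjective (Hom.mapInf F) := fun y => ⟨_, ki2 y⟩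
  let G : L' ⟶ L :=
    { base := b
      mapFin := kf
      mapInf := ki
      mapMid := km
      mapFib := k
      cart_fin := cf
      cart_inf := ci
      cart_mid := cm
      cart_fib := ck
      map_resFin := sf.forall.2 fun m => by rw [← Hom.map_resFin F, km1, kf1]
      map_resInf := si.forall.2 fun m => by rw [← Hom.map_resInf F, km1, ki1]
      map_evZero := sf.forall.2 fun m => by rw [← Hom.map_evZero F, k1, kf1]
      map_evOne := sf.forall.2 fun m => by rw [← Hom.map_evOne F, k1, kf1]
      map_evInfty := si.forall.2 fun m => by rw [← Hom.map_evInfty F, k1, ki1]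
      map_nablaFin := sf.forall.2 fun m => by rw [← Hom.map_nablaFin F, kf1, kf1]
      map_nablaInf := si.forall.2 fun m => by rw [← Hom.map_nablaInf F, ki1, ki1]
      map_line := fun s v hv => (Hom.cart_fib F s).mem_line
        (Function.LeftInverse.injective (g := b) fun x => DFunLike.congr_fun h x)
        (L.pt.isLine s) (L'.pt.isLine s) (Hom.map_line F s) (by rwa [k2]) }
  exact ⟨G, Hom.ext h (AddMonoidHom.ext kf1) (AddMonoidHom.ext ki1) (AddMonoidHom.ext km1)
      (funext fun s => AddMonoidHom.ext (k1 s)),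
    Hom.ext h' (AddMonoidHom.ext kf2) (AddMonoidHom.ext ki2) (AddMonoidHom.ext km2)
      (funext fun s => AddMonoidHom.ext (k2 s))⟩

end Conn

/-! ### The linearized moduli as connections on trivial bundles -/

namespace CotangentPoint

open LaurentPolynomial (T)

variable {R R' : Type u} [CommRing R] [Algebra ℚ R] [CommRing R'] [Algebra ℚ R']
  {P : CotangentPoint R} {P' : CotangentPoint R'} {φ : R →+* R'} {g : P.bundle →+ P'.bundle}
  (hg : IsCart φ P.bundle P'.bundle g)

omit [Algebra ℚ R] in
include hg in
theorem cart_toPoly_comp :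
    IsCart ((mapRingHom φ).comp C) P.bundle P'.poly (P'.toPoly.comp g) :=
  (P'.cart_toPoly.comp hg).congr (by ext; simp)

omit [Algebra ℚ R] in
include hg in
theorem cart_toLaur_comp :
    IsCart ((laurentMap φ).comp LaurentPolynomial.C) P.bundle P'.laurent (P'.toLaur.comp g) :=
  (P'.cart_toLaur.comp hg).congr (RingHom.ext fun r => by
    change _ = AddMonoidAlgebra.mapRingHom ℤ φ (AddMonoidAlgebra.single 0 r)
    rw [AddMonoidAlgebra.mapRingHom_single]
    rfl)

/-- The extension of a morphism of bundles to polynomial sections. -/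
def mapPoly : P.poly →+ P'.poly := P.cart_toPoly.desc (cart_toPoly_comp hg)

/-- The extension of a morphism of bundles to sections on `ℙ¹ ∖ {0, ∞}`. -/
def mapLaurent : P.laurent →+ P'.laurent := P.cart_toLaur.desc (cart_toLaur_comp hg)

theorem mapPoly_smul (p : R[X]) (x : P.bundle) :
    mapPoly hg (p • P.toPoly x) = p.map φ • P'.toPoly (g x) :=
  P.cart_toPoly.desc_smul_map (cart_toPoly_comp hg) p x

theorem mapLaurent_smul (p : R[T;T⁻¹]) (x : P.bundle) :
    mapLaurent hg (p • P.toLaur x) = laurentMap φ p • P'.toLaur (g x) :=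
  P.cart_toLaur.desc_smul_map (cart_toLaur_comp hg) p x

omit [Algebra ℚ R] [Algebra ℚ R'] in
theorem laurentMap_toLaurent (φ : R →+* R') (p : R[X]) :
    laurentMap φ (toLaurent p) = toLaurent (p.map φ) := by
  induction p using Polynomial.induction_on' with
  | add p q hp hq => simp only [map_add, Polynomial.map_add, hp, hq]
  | monomial n r =>
    rw [map_monomial, toLaurent_C_mul_T, toLaurent_C_mul_T, ← LaurentPolynomial.single_eq_C_mul_T,
      ← LaurentPolynomial.single_eq_C_mul_T]
    exact AddMonoidAlgebra.mapRingHom_single ..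

omit [Algebra ℚ R] [Algebra ℚ R'] in
theorem laurentMap_toLaurentInv (φ : R →+* R') (p : R[X]) :
    laurentMap φ (toLaurentInv R p) = toLaurentInv R' (p.map φ) := by
  have h : ∀ (n : ℕ), laurentMap φ (T (-n : ℤ)) = (T (-n : ℤ) : R'[T;T⁻¹]) := fun n => by
    refine (AddMonoidAlgebra.mapRingHom_single ..).trans ?_
    rw [map_one]; rfl
  have hC : ∀ r, laurentMap φ (LaurentPolynomial.C r) = LaurentPolynomial.C (φ r) := fun r =>
    AddMonoidAlgebra.mapRingHom_single ..
  induction p using Polynomial.induction_on' with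
  | add p q hp hq => simp only [map_add, Polynomial.map_add, hp, hq]
  | monomial n r =>
    rw [map_monomial, toLaurentInv_apply, toLaurentInv_apply, toLaurent_C_mul_T, toLaurent_C_mul_T,
      map_mul, map_mul, LaurentPolynomial.invert_C, LaurentPolynomial.invert_T, map_mul,
      LaurentPolynomial.invert_C, LaurentPolynomial.invert_T, h, hC]

theorem mapLaurent_resFin (m : P.poly) :
    mapLaurent hg (P.cart_toPoly.desc P.cart_toLaurent m) =
      P'.cart_toPoly.desc P'.cart_toLaurent (mapPoly hg m) :=
  DFunLike.congr_fun (P.cart_toPoly.hom_ext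
    (k := (mapLaurent hg).comp (P.cart_toPoly.desc P.cart_toLaurent))
    (k' := (P'.cart_toPoly.desc P'.cart_toLaurent).comp (mapPoly hg)) fun p x => by
      simp only [AddMonoidHom.comp_apply, resFin_smul_toPoly, mapPoly_smul, mapLaurent_smul,
        laurentMap_toLaurent]) m

theorem mapLaurent_resInf (m : P.poly) :
    mapLaurent hg (P.cart_toPoly.desc P.cart_toLaurentInv m) =
      P'.cart_toPoly.desc P'.cart_toLaurentInv (mapPoly hg m) :=
  DFunLike.congr_fun (P.cart_toPoly.hom_ext
    (k := (mapLaurent hg).comp (P.cart_toPoly.desc P.cart_toLaurentInv))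
    (k' := (P'.cart_toPoly.desc P'.cart_toLaurentInv).comp (mapPoly hg)) fun p x => by
      simp only [AddMonoidHom.comp_apply, resInf_smul_toPoly, mapPoly_smul, mapLaurent_smul,
        laurentMap_toLaurentInv]) m

theorem map_ev (c : R) {c' : R'} (hc : φ c = c') (m : P.poly) :
    g (P.cart_toPoly.desc (P.cart_eval c) m) =
      P'.cart_toPoly.desc (P'.cart_eval c') (mapPoly hg m) :=
  DFunLike.congr_fun (P.cart_toPoly.hom_ext
    (k := g.comp (P.cart_toPoly.desc (P.cart_eval c)))
    (k' := (P'.cart_toPoly.desc (P'.cart_eval c')).comp (mapPoly hg)) fun p x => by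
      simp only [AddMonoidHom.comp_apply, ev_smul_toPoly, mapPoly_smul, hg.map_smul, ← hc,
        eval_map_apply]) m

theorem mapPoly_nablaFin (hB : ∀ s x, g (P.B s x) = P'.B s (g x)) (m : P.poly) :
    mapPoly hg (P.nablaFin m) = P'.nablaFin (mapPoly hg m) :=
  DFunLike.congr_fun (P.cart_toPoly.hom_ext (k := (mapPoly hg).comp P.nablaFin)
    (k' := P'.nablaFin.comp (mapPoly hg)) fun p x => by
      simp only [AddMonoidHom.comp_apply, nablaFin_smul_toPoly, map_add, mapPoly_smul, hB]
      simp) m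

theorem mapPoly_nablaInf (hB : ∀ s x, g (P.B s x) = P'.B s (g x)) (m : P.poly) :
    mapPoly hg (P.nablaInf m) = P'.nablaInf (mapPoly hg m) :=
  DFunLike.congr_fun (P.cart_toPoly.hom_ext (k := (mapPoly hg).comp P.nablaInf)
    (k' := P'.nablaInf.comp (mapPoly hg)) fun p x => by
      simp only [AddMonoidHom.comp_apply, nablaInf_smul_toPoly, map_add, mapPoly_smul, hB]
      simp) m

theorem desc_toPoly_toLaurent (x : P.bundle) :
    P.cart_toPoly.desc P.cart_toLaurent (P.toPoly x) = P.toLaur x :=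
  P.cart_toPoly.desc_map P.cart_toLaurent x

theorem desc_toPoly_toLaurentInv (x : P.bundle) :
    P.cart_toPoly.desc P.cart_toLaurentInv (P.toPoly x) = P.toLaur x :=
  P.cart_toPoly.desc_map P.cart_toLaurentInv x

theorem desc_toPoly_eval (c : R) (x : P.bundle) :
    P.cart_toPoly.desc (P.cart_eval c) (P.toPoly x) = x :=
  P.cart_toPoly.desc_map (P.cart_eval c) x

/-- Maps of trivial bundles on the projective line preserve constant sections. -/
theorem maps_eq {gf gi : P.poly →+ P'.poly} {gm : P.laurent →+ P'.laurent}
    {gs : Pt → P.bundle →+ P'.bundle}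
    (hf : ∀ m, gm (P.cart_toPoly.desc P.cart_toLaurent m) =
      P'.cart_toPoly.desc P'.cart_toLaurent (gf m))
    (hi : ∀ m, gm (P.cart_toPoly.desc P.cart_toLaurentInv m) =
      P'.cart_toPoly.desc P'.cart_toLaurentInv (gi m))
    (h0 : ∀ m, gs .zero (P.cart_toPoly.desc (P.cart_eval 0) m) =
      P'.cart_toPoly.desc (P'.cart_eval 0) (gf m))
    (h1 : ∀ m, gs .one (P.cart_toPoly.desc (P.cart_eval 1) m) =
      P'.cart_toPoly.desc (P'.cart_eval 1) (gf m))
    (h' : ∀ m, gs .infty (P.cart_toPoly.desc (P.cart_eval 0) m) =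
      P'.cart_toPoly.desc (P'.cart_eval 0) (gi m)) (e : P.bundle) :
    gf (P.toPoly e) = P'.toPoly (gs .zero e) ∧ gi (P.toPoly e) = P'.toPoly (gs .zero e) ∧
      gm (P.toLaur e) = P'.toLaur (gs .zero e) ∧ ∀ s, gs s e = gs .zero e := by
  -- The image of a constant section is a global section, so it is determined by its value at `0`,
  -- which it shares with a constant section.
  have hr : P'.cart_toPoly.desc P'.cart_toLaurent (gf (P.toPoly e)) =
      P'.cart_toPoly.desc P'.cart_toLaurentInv (gi (P.toPoly e)) := by
    rw [← hf, ← hi, desc_toPoly_toLaurent, desc_toPoly_toLaurentInv]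
  have hr' : P'.cart_toPoly.desc P'.cart_toLaurent (P'.toPoly (gs .zero e)) =
      P'.cart_toPoly.desc P'.cart_toLaurentInv (P'.toPoly (gs .zero e)) := by
    rw [desc_toPoly_toLaurent, desc_toPoly_toLaurentInv]
  have e0 : P'.cart_toPoly.desc (P'.cart_eval 0) (gf (P.toPoly e)) =
      P'.cart_toPoly.desc (P'.cart_eval 0) (P'.toPoly (gs .zero e)) := by
    rw [← h0, desc_toPoly_eval, desc_toPoly_eval]
  have ef : gf (P.toPoly e) = P'.toPoly (gs .zero e) :=
    (P'.toDeRham.eq_secFin hr).trans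
      ((congr_arg P'.toDeRham.secFin e0).trans (P'.toDeRham.eq_secFin hr').symm)
  have ei : gi (P.toPoly e) = P'.toPoly (gs .zero e) :=
    P'.bundleP1.resInf_injective (hr.symm.trans ((congr_arg _ ef).trans hr'))
  refine ⟨ef, ei, ?_, fun s => ?_⟩
  · rw [← desc_toPoly_toLaurent, hf, ef, desc_toPoly_toLaurent]
  · cases s with
    | zero => rfl
    | one =>
      have := h1 (P.toPoly e)
      rwa [ef, desc_toPoly_eval, desc_toPoly_eval] at this
    | infty =>
      have := h' (P.toPoly e)
      rwa [ei, desc_toPoly_eval, desc_toPoly_eval] at this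

end CotangentPoint

namespace Cotangent

/-- The morphism of de Rham points attached to a morphism of the linearized moduli. -/
def Hom.toConn {L L' : Cotangent.{u}} (g : Hom L L') :
    Conn.Hom ⟨L.ring, L.pt.toDeRham⟩ ⟨L'.ring, L'.pt.toDeRham⟩ where
  base := g.base
  mapFin := CotangentPoint.mapPoly g.cart
  mapInf := CotangentPoint.mapPoly g.cart
  mapMid := CotangentPoint.mapLaurent g.cart
  mapFib _ := g.map
  cart_fin := L.pt.cart_toPoly.desc_cart _
  cart_inf := L.pt.cart_toPoly.desc_cart _
  cart_mid := L.pt.cart_toLaur.desc_cart _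
  cart_fib _ := g.cart
  map_resFin := CotangentPoint.mapLaurent_resFin g.cart
  map_resInf := CotangentPoint.mapLaurent_resInf g.cart
  map_evZero := CotangentPoint.map_ev g.cart 0 (map_zero _)
  map_evOne := CotangentPoint.map_ev g.cart 1 (map_one _)
  map_evInfty := CotangentPoint.map_ev g.cart 0 (map_zero _)
  map_nablaFin := CotangentPoint.mapPoly_nablaFin g.cart g.map_B
  map_nablaInf := CotangentPoint.mapPoly_nablaInf g.cart g.map_B
  map_line := g.map_line

/-- The functor from the linearized moduli to the de Rham moduli. -/
def toConn : Cotangent.{u} ⥤ Conn.{u} where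
  obj L := ⟨L.ring, L.pt.toDeRham⟩
  map g := Hom.toConn g
  map_id L := by
    have h1 : CotangentPoint.mapPoly (IsCart.id L.pt.bundle) = AddMonoidHom.id _ :=
      L.pt.cart_toPoly.hom_ext fun p x => by rw [CotangentPoint.mapPoly_smul]; simp
    have h2 : CotangentPoint.mapLaurent (IsCart.id L.pt.bundle) = AddMonoidHom.id _ :=
      L.pt.cart_toLaur.hom_ext fun p x => by
        rw [CotangentPoint.mapLaurent_smul, laurentMap, AddMonoidAlgebra.mapRingHom_id]; rfl
    exact Conn.Hom.ext rfl h1 h1 h2 rfl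
  map_comp {L L' L''} g h := by
    have h1 : CotangentPoint.mapPoly (h.cart.comp g.cart) =
        (CotangentPoint.mapPoly h.cart).comp (CotangentPoint.mapPoly g.cart) :=
      L.pt.cart_toPoly.hom_ext fun p x => by
        simp only [AddMonoidHom.comp_apply, CotangentPoint.mapPoly_smul, Polynomial.map_map]
    have h2 : CotangentPoint.mapLaurent (h.cart.comp g.cart) =
        (CotangentPoint.mapLaurent h.cart).comp (CotangentPoint.mapLaurent g.cart) :=
      L.pt.cart_toLaur.hom_ext fun p x => by
        simp only [AddMonoidHom.comp_apply, CotangentPoint.mapLaurent_smul, laurentMap,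
          AddMonoidAlgebra.mapRingHom_comp, RingHom.comp_apply]
    exact Conn.Hom.ext rfl h1 h1 h2 rfl

/-- The functor to the de Rham moduli is compatible with the maps to `BSL(2)`. -/
def toConnIso (s : Pt) : toConn.{u} ⋙ Conn.toBSL s ≅ toBSL.{u} :=
  NatIso.ofComponents (fun L => Iso.refl (toBSL.obj L)) fun _ =>
    (Category.comp_id _).trans (Category.id_comp _).symm

instance : toConn.{u}.Faithful where
  map_injective e :=
    Hom.ext (congr_arg Conn.Hom.base e) (congr_fun (congr_arg Conn.Hom.mapFib e) .zero)

/-- Morphisms preserve constant sections, so they are extended from their fibre at `0`. They commute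
with residues, hence with the endomorphisms `B s`. -/
instance : toConn.{u}.Full where
  map_surjective {L L'} F := by
    have key := CotangentPoint.maps_eq (P := L.pt) (P' := L'.pt) (gf := Conn.Hom.mapFin F)
      (gi := Conn.Hom.mapInf F) (gm := Conn.Hom.mapMid F) (gs := Conn.Hom.mapFib F)
      (Conn.Hom.map_resFin F) (Conn.Hom.map_resInf F) (Conn.Hom.map_evZero F)
      (Conn.Hom.map_evOne F) (Conn.Hom.map_evInfty F)
    let g : L ⟶ L' :=
      { base := Conn.Hom.base F
        map := Conn.Hom.mapFib F .zero
        cart := Conn.Hom.cart_fib F .zero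
        map_line := fun s v hv => Eq.mp (congrArg (fun w => w ∈ L'.pt.line s) ((key v).2.2.2 s))
          (Conn.Hom.map_line F s v hv)
        map_B := fun s v => ((key _).2.2.2 s).symm.trans ((Conn.Hom.map_residue F s v).trans
          (congr_arg (L'.pt.B s) ((key v).2.2.2 s))) }
    have h1 : CotangentPoint.mapPoly g.cart = Conn.Hom.mapFin F :=
      L.pt.cart_toPoly.hom_ext fun p x => (CotangentPoint.mapPoly_smul g.cart p x).trans
        ((congr_arg (fun y : L'.pt.poly => p.map g.base.toRingHom • y) (key x).1.symm).trans
        ((Conn.Hom.cart_fin F).map_smul p _).symm)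
    have h2 : CotangentPoint.mapPoly g.cart = Conn.Hom.mapInf F :=
      L.pt.cart_toPoly.hom_ext fun p x => (CotangentPoint.mapPoly_smul g.cart p x).trans
        ((congr_arg (fun y : L'.pt.poly => p.map g.base.toRingHom • y) (key x).2.1.symm).trans
        ((Conn.Hom.cart_inf F).map_smul p _).symm)
    have h3 : CotangentPoint.mapLaurent g.cart = Conn.Hom.mapMid F :=
      L.pt.cart_toLaur.hom_ext fun p x => (CotangentPoint.mapLaurent_smul g.cart p x).trans
        ((congr_arg (fun y : L'.pt.laurent => laurentMap g.base.toRingHom p • y)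
          (key x).2.2.1.symm).trans ((Conn.Hom.cart_mid F).map_smul p _).symm)
    exact ⟨g, Conn.Hom.ext rfl h1 h2 h3
      (funext fun s => AddMonoidHom.ext fun x => ((key x).2.2.2 s).symm)⟩

end Cotangent

/-! ### Logarithmic connections are connections on trivial bundles -/

namespace DeRhamPoint

variable {R : Type u} [CommRing R] (P : DeRhamPoint R)

theorem evFin_X_smul (m : P.bundle.fin) : P.bundle.evZero ((X : R[X]) • m) = 0 ∧
    P.bundle.evOne ((X : R[X]) • m) = P.bundle.evOne m := by
  rw [P.bundle.cart_evZero.map_smul, P.bundle.cart_evOne.map_smul]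
  simp

theorem evInfty_X_smul (m : P.bundle.inf) : P.bundle.evInfty ((X : R[X]) • m) = 0 := by
  rw [P.bundle.cart_evInfty.map_smul]
  simp

variable [Algebra ℚ R]

theorem cart_evOne_secFin :
    IsCart (RingHom.id R) (P.bundle.fib .zero) (P.bundle.fib .one)
      (P.bundle.evOne.comp P.secFin) :=
  (P.bundle.cart_evOne.comp P.cart_secFin).congr (by ext; simp)

theorem cart_evInfty_secInf :
    IsCart (RingHom.id R) (P.bundle.fib .zero) (P.bundle.fib .infty)
      (P.bundle.evInfty.comp P.secInf) :=
  (P.bundle.cart_evInfty.comp P.cart_secInf).congr (by ext; simp)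

/-- The identification of the fibres by global sections. -/
def fibEquiv : ∀ s, P.bundle.fib .zero ≃ₗ[R] P.bundle.fib s
  | .zero => LinearEquiv.refl R _
  | .one => P.cart_evOne_secFin.linearEquiv
  | .infty => P.cart_evInfty_secInf.linearEquiv

theorem fibEquiv_zero (e : P.bundle.fib .zero) : P.fibEquiv .zero e = P.bundle.evZero (P.secFin e) :=
  (P.evZero_secFin e).symm

theorem fibEquiv_one (e : P.bundle.fib .zero) : P.fibEquiv .one e = P.bundle.evOne (P.secFin e) :=
  rfl

theorem fibEquiv_infty (e : P.bundle.fib .zero) :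
    P.fibEquiv .infty e = P.bundle.evInfty (P.secInf e) := rfl

/-- The residues as endomorphisms of the fibre at `0`. -/
def residueZero (s : Pt) : P.bundle.fib .zero →ₗ[R] P.bundle.fib .zero :=
  (P.fibEquiv s).symm.toLinearMap ∘ₗ P.conn.residue s ∘ₗ (P.fibEquiv s).toLinearMap

theorem fibEquiv_residueZero (s : Pt) (e : P.bundle.fib .zero) :
    P.fibEquiv s (P.residueZero s e) = P.conn.residue s (P.fibEquiv s e) :=
  (P.fibEquiv s).apply_symm_apply _

/-- In the frame of global sections the connection sends `e` to `p + t q`. Its residues at `0`, `1`,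
`∞` are therefore `-p`, `p + q`, `-q`. -/
theorem residueZero_spec (e : P.bundle.fib .zero) :
    P.conn.nablaFin (P.secFin e) =
        P.secFin (-P.residueZero .zero e) + (X : R[X]) • P.secFin (-P.residueZero .infty e) ∧
      P.conn.nablaInf (P.secInf e) =
        (X : R[X]) • P.secInf (-P.residueZero .zero e) + P.secInf (-P.residueZero .infty e) ∧
      P.residueZero .zero e + P.residueZero .one e + P.residueZero .infty e = 0 := by
  obtain ⟨p, q, h1, h2⟩ := P.exists_nabla_sec e
  have h0 : P.residueZero .zero e = -p := by
    refine (P.fibEquiv .zero).injective ?_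
    rw [fibEquiv_residueZero, fibEquiv_zero, P.conn.residue_zero, h1, map_add,
      (P.evFin_X_smul _).1, add_zero, evZero_secFin]
    exact (map_neg (P.fibEquiv .zero) p).symm
  have h1' : P.residueZero .one e = p + q := by
    refine (P.fibEquiv .one).injective ?_
    rw [fibEquiv_residueZero, fibEquiv_one, P.conn.residue_one, h1, map_add,
      (P.evFin_X_smul _).2, fibEquiv_one, map_add, map_add]
  have h' : P.residueZero .infty e = -q := by
    refine (P.fibEquiv .infty).injective ?_
    rw [fibEquiv_residueZero, fibEquiv_infty, P.conn.residue_infty, h2, map_add,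
      P.evInfty_X_smul, zero_add, map_neg, fibEquiv_infty]
  rw [h0, h1', h', neg_neg, neg_neg]
  exact ⟨h1, h2, by abel⟩

/-- The point of the linearized moduli attached to a de Rham point. -/
def toCotangent : CotangentPoint R where
  bundle := P.bundle.fib .zero
  line s := (P.line s).map ((P.fibEquiv s).symm : P.bundle.fib s →ₗ[R] P.bundle.fib .zero)
  isLine s := (P.isLine s).map _
  B := P.residueZero
  B_line s v hv := by
    obtain ⟨w, hw, rfl⟩ := Submodule.mem_map.1 hv
    change (P.fibEquiv s).symm (P.conn.residue s (P.fibEquiv s ((P.fibEquiv s).symm w))) = 0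
    rw [LinearEquiv.apply_symm_apply, P.residue_line s w hw, map_zero]
  B_mem s v := Submodule.mem_map.2 ⟨_, P.residue_mem s _, rfl⟩
  sum_eq_zero := LinearMap.ext fun e => (P.residueZero_spec e).2.2

/-- The identification of the fibres by global sections. -/
def fibHom (s : Pt) : P.toCotangent.bundle →+ P.bundle.fib s :=
  show P.bundle.fib .zero →+ P.bundle.fib s from (P.fibEquiv s).toLinearMap.toAddMonoidHom

theorem cart_fibHom (s : Pt) :
    IsCart (RingHom.id R) P.toCotangent.bundle (P.bundle.fib s) (P.fibHom s) :=
  match s with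
  | .zero => IsCart.id _
  | .one => P.cart_evOne_secFin
  | .infty => P.cart_evInfty_secInf

theorem fibHom_mem (s : Pt) (v : P.toCotangent.bundle) (hv : v ∈ P.toCotangent.line s) :
    P.fibHom s v ∈ P.line s := by
  have h : ∀ v ∈ (P.line s).map
      ((P.fibEquiv s).symm : P.bundle.fib s →ₗ[R] P.bundle.fib .zero), P.fibEquiv s v ∈ P.line s := by
    rintro _ ⟨w, hw, rfl⟩
    exact Eq.mpr (congrArg (fun w => w ∈ P.line s) ((P.fibEquiv s).apply_symm_apply w)) hw
  exact h v hv

/-- The trivialization by global sections, on `ℙ¹ ∖ {∞}`. -/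
def trivFin : P.toCotangent.poly →+ P.bundle.fin :=
  P.toCotangent.cart_toPoly.desc (f' := RingHom.id _) P.cart_secFin

/-- The trivialization by global sections, on `ℙ¹ ∖ {0}`. -/
def trivInf : P.toCotangent.poly →+ P.bundle.inf :=
  P.toCotangent.cart_toPoly.desc (f' := RingHom.id _) P.cart_secInf

theorem cart_mid : IsCart ((RingHom.id R[T;T⁻¹]).comp LaurentPolynomial.C) P.toCotangent.bundle
    P.bundle.mid (P.bundle.resFin.comp P.secFin) :=
  (P.bundle.cart_resFin.comp P.cart_secFin).congr (by ext; simp)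

/-- The trivialization by global sections, on `ℙ¹ ∖ {0, ∞}`. -/
def trivMid : P.toCotangent.laurent →+ P.bundle.mid :=
  P.toCotangent.cart_toLaur.desc P.cart_mid

theorem trivFin_smul (p : R[X]) (x : P.toCotangent.bundle) :
    P.trivFin (p • P.toCotangent.toPoly x) = p • P.secFin x :=
  P.toCotangent.cart_toPoly.desc_smul_map _ p x

theorem trivInf_smul (p : R[X]) (x : P.toCotangent.bundle) :
    P.trivInf (p • P.toCotangent.toPoly x) = p • P.secInf x :=
  P.toCotangent.cart_toPoly.desc_smul_map _ p x

theorem trivMid_smul (p : R[T;T⁻¹]) (x : P.toCotangent.bundle) :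
    P.trivMid (p • P.toCotangent.toLaur x) = p • P.bundle.resFin (P.secFin x) :=
  P.toCotangent.cart_toLaur.desc_smul_map P.cart_mid p x

theorem trivMid_resFin (m : P.toCotangent.poly) :
    P.trivMid (P.toCotangent.cart_toPoly.desc P.toCotangent.cart_toLaurent m) =
      P.bundle.resFin (P.trivFin m) :=
  DFunLike.congr_fun (P.toCotangent.cart_toPoly.hom_ext
    (k := P.trivMid.comp (P.toCotangent.cart_toPoly.desc P.toCotangent.cart_toLaurent))
    (k' := P.bundle.resFin.comp P.trivFin) fun p x => by
      rw [AddMonoidHom.comp_apply, AddMonoidHom.comp_apply, CotangentPoint.resFin_smul_toPoly,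
        trivMid_smul, trivFin_smul, P.bundle.resFin_smul]) m

theorem trivMid_resInf (m : P.toCotangent.poly) :
    P.trivMid (P.toCotangent.cart_toPoly.desc P.toCotangent.cart_toLaurentInv m) =
      P.bundle.resInf (P.trivInf m) :=
  DFunLike.congr_fun (P.toCotangent.cart_toPoly.hom_ext
    (k := P.trivMid.comp (P.toCotangent.cart_toPoly.desc P.toCotangent.cart_toLaurentInv))
    (k' := P.bundle.resInf.comp P.trivInf) fun p x => by
      rw [AddMonoidHom.comp_apply, AddMonoidHom.comp_apply, CotangentPoint.resInf_smul_toPoly,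
        trivMid_smul, trivInf_smul, P.bundle.resInf_smul]
      exact congr_arg _ (P.resFin_secFin x)) m

theorem fibHom_evZero (m : P.toCotangent.poly) :
    P.fibHom .zero (P.toCotangent.cart_toPoly.desc (P.toCotangent.cart_eval 0) m) =
      P.bundle.evZero (P.trivFin m) :=
  DFunLike.congr_fun (P.toCotangent.cart_toPoly.hom_ext
    (k := (P.fibHom .zero).comp (P.toCotangent.cart_toPoly.desc (P.toCotangent.cart_eval 0)))
    (k' := P.bundle.evZero.comp P.trivFin) fun p x => by
      rw [AddMonoidHom.comp_apply, AddMonoidHom.comp_apply, CotangentPoint.ev_smul_toPoly,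
        trivFin_smul, P.bundle.cart_evZero.map_smul, (P.cart_fibHom _).map_smul]
      exact congr_arg _ (P.fibEquiv_zero x)) m

theorem fibHom_evOne (m : P.toCotangent.poly) :
    P.fibHom .one (P.toCotangent.cart_toPoly.desc (P.toCotangent.cart_eval 1) m) =
      P.bundle.evOne (P.trivFin m) :=
  DFunLike.congr_fun (P.toCotangent.cart_toPoly.hom_ext
    (k := (P.fibHom .one).comp (P.toCotangent.cart_toPoly.desc (P.toCotangent.cart_eval 1)))
    (k' := P.bundle.evOne.comp P.trivFin) fun p x => by
      rw [AddMonoidHom.comp_apply, AddMonoidHom.comp_apply, CotangentPoint.ev_smul_toPoly,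
        trivFin_smul, P.bundle.cart_evOne.map_smul, (P.cart_fibHom _).map_smul]
      exact congr_arg _ (P.fibEquiv_one x)) m

theorem fibHom_evInfty (m : P.toCotangent.poly) :
    P.fibHom .infty (P.toCotangent.cart_toPoly.desc (P.toCotangent.cart_eval 0) m) =
      P.bundle.evInfty (P.trivInf m) :=
  DFunLike.congr_fun (P.toCotangent.cart_toPoly.hom_ext
    (k := (P.fibHom .infty).comp (P.toCotangent.cart_toPoly.desc (P.toCotangent.cart_eval 0)))
    (k' := P.bundle.evInfty.comp P.trivInf) fun p x => by
      rw [AddMonoidHom.comp_apply, AddMonoidHom.comp_apply, CotangentPoint.ev_smul_toPoly,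
        trivInf_smul, P.bundle.cart_evInfty.map_smul, (P.cart_fibHom _).map_smul]
      exact congr_arg _ (P.fibEquiv_infty x)) m

theorem trivFin_nablaFin (m : P.toCotangent.poly) :
    P.trivFin (P.toCotangent.nablaFin m) = P.conn.nablaFin (P.trivFin m) :=
  DFunLike.congr_fun (P.toCotangent.cart_toPoly.hom_ext
    (k := P.trivFin.comp P.toCotangent.nablaFin)
    (k' := P.conn.nablaFin.comp P.trivFin) fun p x => by
      rw [AddMonoidHom.comp_apply, AddMonoidHom.comp_apply, CotangentPoint.nablaFin_smul_toPoly,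
        map_add, map_add, trivFin_smul, trivFin_smul, trivFin_smul, trivFin_smul,
        P.conn.leibniz_fin, (P.residueZero_spec x).1, map_neg, map_neg]
      change _ + (-1 * p) • P.secFin (P.residueZero .zero x) +
        (-X * p) • P.secFin (P.residueZero .infty x) = _
      module) m

theorem trivInf_nablaInf (m : P.toCotangent.poly) :
    P.trivInf (P.toCotangent.nablaInf m) = P.conn.nablaInf (P.trivInf m) :=
  DFunLike.congr_fun (P.toCotangent.cart_toPoly.hom_ext
    (k := P.trivInf.comp P.toCotangent.nablaInf)
    (k' := P.conn.nablaInf.comp P.trivInf) fun p x => by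
      rw [AddMonoidHom.comp_apply, AddMonoidHom.comp_apply, CotangentPoint.nablaInf_smul_toPoly,
        map_add, map_add, trivInf_smul, trivInf_smul, trivInf_smul, trivInf_smul,
        P.conn.leibniz_inf, (P.residueZero_spec x).2.1, map_neg, map_neg]
      change _ + (-X * p) • P.secInf (P.residueZero .zero x) +
        (-1 * p) • P.secInf (P.residueZero .infty x) = _
      module) m

end DeRhamPoint

namespace Conn

/-- The trivialization of a logarithmic connection by global sections. -/
def triv (L : Conn.{u}) : Cotangent.toConn.obj ⟨L.ring, L.pt.toCotangent⟩ ⟶ L :=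
  have hp : RingHom.id L.ring[X] = mapRingHom (AlgHom.id ℚ L.ring).toRingHom := mapRingHom_id.symm
  have hl : RingHom.id L.ring[T;T⁻¹] = laurentMap (AlgHom.id ℚ L.ring).toRingHom :=
    (AddMonoidAlgebra.mapRingHom_id ..).symm
  { base := AlgHom.id ℚ L.ring
    mapFin := L.pt.trivFin
    mapInf := L.pt.trivInf
    mapMid := L.pt.trivMid
    mapFib := L.pt.fibHom
    cart_fin := (L.pt.toCotangent.cart_toPoly.desc_cart _).congr hp
    cart_inf := (L.pt.toCotangent.cart_toPoly.desc_cart _).congr hp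
    cart_mid := (L.pt.toCotangent.cart_toLaur.desc_cart L.pt.cart_mid).congr hl
    cart_fib := L.pt.cart_fibHom
    map_resFin := L.pt.trivMid_resFin
    map_resInf := L.pt.trivMid_resInf
    map_evZero := L.pt.fibHom_evZero
    map_evOne := L.pt.fibHom_evOne
    map_evInfty := L.pt.fibHom_evInfty
    map_nablaFin := L.pt.trivFin_nablaFin
    map_nablaInf := L.pt.trivInf_nablaInf
    map_line := L.pt.fibHom_mem }

end Conn

instance : Cotangent.toConn.{u}.EssSurj where
  mem_essImage L :=
    have := Conn.isIso_of_base L.triv (AlgHom.id ℚ L.ring) rfl rfl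
    ⟨⟨L.ring, L.pt.toCotangent⟩, ⟨asIso L.triv⟩⟩

instance : Cotangent.toConn.{u}.IsEquivalence where

theorem isIsomorphicOver_conn (s : Pt) :
    IsIsomorphicOver (Conn.toBSL.{u} s) Cotangent.toBSL.{u} :=
  isIsomorphicOver_of_isEquivalence Cotangent.toConn (Cotangent.toConnIso s)

/-! ### The complete intersections -/

section Regular

open RingTheory.Sequence

variable {A : Type} [CommRing A]

/-- The retraction `ψ` has kernel `(q)`, so `A / q` is a subring of the domain `A` which contains
`f` and `g`. There regularity of `f, g` follows from `f` being prime and not dividing `g`. -/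
theorem isWeaklyRegular_of_retract [IsDomain A] {q f g : A} (ψ : A →+* A) (hq : q ≠ 0)
    (hψq : ψ q = 0) (hψf : ψ f = f) (hψg : ψ g = g) (hψ : ∀ y, q ∣ y - ψ y) (hf : Prime f)
    (hg : ¬ f ∣ g) : IsWeaklyRegular A [q, f, g] := by
  have e : ∀ {y}, ψ y = 0 → q ∣ y := fun {y} h => by simpa [h] using hψ y
  rw [isWeaklyRegular_iff]
  intro i hi
  have key : ∀ (rs : List A) (x : A), (∀ y, x * y ∈ Ideal.ofList rs → y ∈ Ideal.ofList rs) →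
      IsSMulRegular (A ⧸ (Ideal.ofList rs • ⊤ : Submodule A A)) x := by
    intro rs x h
    rw [isSMulRegular_quotient_iff_mem_of_smul_mem]
    intro y hy
    rw [smul_eq_mul, Ideal.mul_top] at *
    exact h y hy
  refine key _ _ fun y hy => ?_
  simp only [List.length_cons, List.length_nil] at hi
  interval_cases i
  · simp only [List.take_zero, Ideal.ofList_nil, Ideal.mem_bot, List.getElem_cons_zero,
      mul_eq_zero] at hy ⊢
    exact hy.resolve_left hq
  · simp only [List.take_succ_cons, List.take_zero, Ideal.ofList_singleton,
      Ideal.mem_span_singleton, List.getElem_cons_succ, List.getElem_cons_zero] at hy ⊢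
    obtain ⟨z, hz⟩ := hy
    have := congr_arg ψ hz
    rw [map_mul, map_mul, hψq, zero_mul, hψf] at this
    exact e ((mul_eq_zero.1 this).resolve_left hf.ne_zero)
  · simp only [List.take_succ_cons, List.take_zero, List.getElem_cons_succ,
      List.getElem_cons_zero, Ideal.ofList_cons, Ideal.ofList_nil, sup_bot_eq] at hy ⊢
    rw [← Ideal.span_union, Set.singleton_union, Ideal.mem_span_pair] at hy ⊢
    obtain ⟨z, w, hz⟩ := hy
    have := congr_arg ψ hz
    rw [map_add, map_mul, map_mul, hψq, mul_zero, zero_add, hψf, map_mul, hψg] at this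
    obtain ⟨k, hk⟩ := (hf.dvd_or_dvd (Dvd.intro_left _ this)).resolve_left hg
    obtain ⟨l, hl⟩ := hψ y
    exact ⟨l, k, by linear_combination -hl - hk⟩

/-- Weak regularity survives localization, and the sequence lies in the maximal ideal. Since `u`
becomes a unit, it generates all of `I` there. -/
theorem exists_isRegular_of_isWeaklyRegular {q f g : A} {I p : Ideal A} [p.IsPrime] (hI : I ≤ p)
    (h : IsWeaklyRegular A [q, f, g]) (hJ : Ideal.span {q, f, g} ≤ I) {u : A} (hu : u ∉ p)
    (hu' : ∀ x ∈ I, u * x ∈ Ideal.span {q, f, g}) :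
    ∃ rs : List (Localization.AtPrime p), rs.length = 3 ∧
      IsRegular (Localization.AtPrime p) rs ∧
      Ideal.ofList rs = I.map (algebraMap A (Localization.AtPrime p)) := by
  have e : Ideal.ofList [q, f, g] = Ideal.span {q, f, g} := by
    simp only [Ideal.ofList]
    congr 1
    ext x
    simp
  refine ⟨[q, f, g].map (algebraMap A _), rfl,
    h.isRegular_of_isLocalization_of_mem _ p fun r hr => hI (hJ ?_), ?_⟩
  · rw [← e]
    exact Ideal.subset_span hr
  rw [← Ideal.map_ofList, e]
  refine le_antisymm (Ideal.map_mono hJ) (Ideal.map_le_iff_le_comap.2 fun x hx => ?_)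
  have h1 := Ideal.mem_map_of_mem (algebraMap A (Localization.AtPrime p)) (hu' x hx)
  rw [map_mul] at h1
  have hunit : IsUnit (algebraMap A (Localization.AtPrime p) u) :=
    IsLocalization.map_units _ (⟨u, hu⟩ : p.primeCompl)
  exact (Ideal.unit_mul_mem_iff_mem _ hunit).1 h1

end Regular

/-! ### Nilpotent two by two matrices and their equations -/

section Entries

variable {A : Type} [CommRing A]

theorem entry_mem (M : Matrix (Fin 2) (Fin 2) A) (i j : Fin 2) : M i j ∈ entriesIdeal M :=
  Ideal.subset_span ⟨(i, j), rfl⟩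

theorem entriesIdeal_le {M : Matrix (Fin 2) (Fin 2) A} {I : Ideal A} (h : ∀ i j, M i j ∈ I) :
    entriesIdeal M ≤ I :=
  Ideal.span_le.2 (by rintro _ ⟨ij, rfl⟩; exact h _ _)

theorem entriesIdeal_mul_le (M N : Matrix (Fin 2) (Fin 2) A) :
    entriesIdeal (M * N) ≤ entriesIdeal M :=
  entriesIdeal_le fun i j => by
    rw [Matrix.mul_apply]
    exact Ideal.sum_mem _ fun k _ => Ideal.mul_mem_right _ _ (entry_mem M i k)

/-- The nilpotent matrix `w ↦ a det(v, w) v`. -/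
def nilp (a : A) (v : Fin 2 → A) : Matrix (Fin 2) (Fin 2) A :=
  a • Matrix.vecMulVec v ![-v 1, v 0]

theorem nilp_apply (a : A) (v : Fin 2 → A) :
    nilp a v = !![-(a * v 0 * v 1), a * v 0 * v 0; -(a * v 1 * v 1), a * v 1 * v 0] := by
  ext i j
  fin_cases i <;> fin_cases j <;>
    simp [nilp] <;> ring

/-- The determinant of two vectors. -/
def det₂ (v w : Fin 2 → A) : A := v 0 * w 1 - v 1 * w 0

theorem nilp_mul_nilp (a : A) (v : Fin 2 → A) : nilp a v * nilp a v = 0 := by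
  rw [nilp_apply]
  ext i j
  fin_cases i <;> fin_cases j <;> simp [Matrix.mul_apply, Fin.sum_univ_two] <;> ring

theorem det_one_add_nilp (a : A) (v : Fin 2 → A) : (1 + nilp a v).det = 1 := by
  rw [nilp_apply, Matrix.det_fin_two]
  simp
  ring

/-- The span of the entries of a matrix in terms of the images of two vectors. -/
theorem mem_span_of_det {K : Matrix (Fin 2) (Fin 2) A} {v w : Fin 2 → A} (hvw : det₂ v w = 1)
    {z : Fin 2 → A} (hz : K.mulVec v = z) {q : A} (hq : det₂ (K.mulVec w) w = q) {J : Ideal A}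
    (hJq : q ∈ J) (hJz : ∀ i, z i ∈ J) {u : A} (hu : u * det₂ v (K.mulVec w) ∈ J) :
    ∀ x ∈ entriesIdeal K, u * x ∈ J := by
  have hz0 := hJz 0
  have hz1 := hJz 1
  subst hz hq
  simp only [det₂, Matrix.mulVec, dotProduct, Fin.sum_univ_two] at *
  set k := K 0 0
  set l := K 0 1
  set m := K 1 0
  set n := K 1 1
  set d := v 0 * (m * w 0 + n * w 1) - v 1 * (k * w 0 + l * w 1)
  set q := (k * w 0 + l * w 1) * w 1 - (m * w 0 + n * w 1) * w 0
  have hle : entriesIdeal K ≤ Submodule.comap (LinearMap.mulLeft A u) J := by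
    refine entriesIdeal_le fun i j => ?_
    change u * K i j ∈ J
    -- In the basis `v, w`, every entry of `K` is a combination of the entries of `K v` and of the
    -- two components `q` and `d` of `K w`; only `d` needs the factor `u` to be in `J`.
    have key : ∀ x a b c e : A, x = a * (k * v 0 + l * v 1) + b * (m * v 0 + n * v 1) + c * q + e * d →
        u * x ∈ J := by
      rintro x a b c e rfl
      have : u * (a * (k * v 0 + l * v 1) + b * (m * v 0 + n * v 1) + c * q + e * d) =
        u * a * (k * v 0 + l * v 1) + u * b * (m * v 0 + n * v 1) + u * c * q + e * (u * d) := by ring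
      rw [this]
      exact J.add_mem (J.add_mem (J.add_mem (J.mul_mem_left _ hz0) (J.mul_mem_left _ hz1))
        (J.mul_mem_left _ hJq)) (J.mul_mem_left _ hu)
    fin_cases i <;> fin_cases j
    · exact key k (w 1) 0 (-v 1 * v 0) (-v 1 * w 0) (by
        simp only [q, d]; linear_combination (-k + v 1 * (k * w 0 + l * w 1)) * hvw)
    · exact key l (-w 0) 0 (v 0 * v 0) (v 0 * w 0) (by
        simp only [q, d]; linear_combination (-l - v 0 * (k * w 0 + l * w 1)) * hvw)
    · exact key m 0 (w 1) (-v 1 * v 1) (-v 1 * w 1) (by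
        simp only [q, d]; linear_combination (-m + v 1 * (m * w 0 + n * w 1)) * hvw)
    · exact key n 0 (-w 0) (v 0 * v 1) (v 0 * w 1) (by
        simp only [q, d]; linear_combination (-n - v 0 * (m * w 0 + n * w 1)) * hvw)
  exact fun x hx => hle hx

theorem mulVec_mem_entriesIdeal (K : Matrix (Fin 2) (Fin 2) A) (v : Fin 2 → A) (i : Fin 2) :
    K.mulVec v i ∈ entriesIdeal K := by
  simp only [Matrix.mulVec, dotProduct]
  exact Ideal.sum_mem _ fun j _ => Ideal.mul_mem_right _ _ (entry_mem K i j)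

theorem det₂_mulVec_mem_entriesIdeal (K : Matrix (Fin 2) (Fin 2) A) (v w : Fin 2 → A) :
    det₂ (K.mulVec v) w ∈ entriesIdeal K :=
  sub_mem (Ideal.mul_mem_right _ _ (mulVec_mem_entriesIdeal K v 0))
    (Ideal.mul_mem_right _ _ (mulVec_mem_entriesIdeal K v 1))

/-- The coefficient of `c` is `det₂ v w ^ 2 = 1`, so this equation can be solved for `c`. -/
theorem det₂_sum_mulVec (a b c : A) (v₀ v₁ : Fin 2 → A) {v w : Fin 2 → A} (hvw : det₂ v w = 1) :
    det₂ ((nilp a v₀ + nilp b v₁ + nilp c v).mulVec w) w =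
      c + (a * (det₂ v₀ w * det₂ v₀ w) + b * (det₂ v₁ w * det₂ v₁ w)) := by
  simp only [det₂, Matrix.mulVec, dotProduct, Fin.sum_univ_two, nilp_apply, Matrix.add_apply,
    Matrix.of_apply, Matrix.cons_val', Matrix.cons_val_zero, Matrix.cons_val_one,
    Matrix.cons_val_fin_one] at *
  linear_combination (c * (v 0 * w 1 - v 1 * w 0 + 1)) * hvw

/-- Nilpotent matrices have trace zero, so this entry is redundant given the image of `v`. -/
theorem det₂_sum_mulVec' (a b c : A) (v₀ v₁ v w : Fin 2 → A) :
    det₂ v ((nilp a v₀ + nilp b v₁ + nilp c v).mulVec w) =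
      -det₂ ((nilp a v₀ + nilp b v₁ + nilp c v).mulVec v) w := by
  simp only [det₂, Matrix.mulVec, dotProduct, Fin.sum_univ_two, nilp_apply, Matrix.add_apply,
    Matrix.of_apply, Matrix.cons_val', Matrix.cons_val_zero, Matrix.cons_val_one,
    Matrix.cons_val_fin_one] at *
  ring

theorem det₂_prod_mulVec (a b c : A) (v₀ v₁ : Fin 2 → A) {v w : Fin 2 → A} (hvw : det₂ v w = 1) :
    det₂ (((1 + nilp a v₀) * (1 + nilp b v₁) - (1 - nilp c v)).mulVec w) w =
      c + (a * (det₂ v₀ w * det₂ v₀ w) + b * (det₂ v₁ w * det₂ v₁ w) +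
        a * b * (det₂ v₀ v₁ * (det₂ v₀ w * det₂ v₁ w))) := by
  rw [show (1 + nilp a v₀) * (1 + nilp b v₁) - (1 - nilp c v) =
    nilp a v₀ + nilp b v₁ + nilp a v₀ * nilp b v₁ + nilp c v by noncomm_ring]
  simp only [det₂, Matrix.mulVec, dotProduct, Fin.sum_univ_two, nilp_apply, Matrix.add_apply,
    Matrix.mul_apply, Matrix.of_apply, Matrix.cons_val', Matrix.cons_val_zero, Matrix.cons_val_one,
    Matrix.cons_val_fin_one] at *
  linear_combination (c * (v 0 * w 1 - v 1 * w 0 + 1)) * hvw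

/-- The multiplicative analogue of trace zero: `P` and `1 - nilp c v` both have determinant one.
Modulo the entries of the image of `v`, the factor on the left is `1` and the right side vanishes.
-/
theorem det₂_sub_mulVec {P : Matrix (Fin 2) (Fin 2) A} (hP : P.det = 1) (c : A) {v w : Fin 2 → A}
    (hvw : det₂ v w = 1) :
    (1 + det₂ ((P - (1 - nilp c v)).mulVec v) w) * det₂ v ((P - (1 - nilp c v)).mulVec w) =
      det₂ v ((P - (1 - nilp c v)).mulVec v) * (det₂ ((P - (1 - nilp c v)).mulVec w) w - c) -
        det₂ ((P - (1 - nilp c v)).mulVec v) w := by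
  rw [Matrix.det_fin_two] at hP
  simp only [det₂, Matrix.mulVec, dotProduct, Fin.sum_univ_two, nilp_apply, Matrix.sub_apply,
    Matrix.one_apply, Matrix.of_apply, Matrix.cons_val', Matrix.cons_val_zero, Matrix.cons_val_one,
    Matrix.cons_val_fin_one, if_true, zero_ne_one, one_ne_zero, if_false] at *
  linear_combination (v 0 * w 1 - v 1 * w 0) ^ 2 * hP -
    (((P 0 0 * v 0 + P 0 1 * v 1) * w 1 - (P 1 0 * v 0 + P 1 1 * v 1) * w 0) +
      (v 0 * (P 1 0 * w 0 + P 1 1 * w 1) - v 1 * (P 0 0 * w 0 + P 0 1 * w 1)) -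
      2 * (v 0 * w 1 - v 1 * w 0) +
      (v 0 * (P 1 0 * v 0 + P 1 1 * v 1) - v 1 * (P 0 0 * v 0 + P 0 1 * v 1)) * c *
        (1 + (v 0 * w 1 - v 1 * w 0))) * hvw

/-- The two matrices differ by the invertible factor `1 + N`. The second form is the equation `A_0
A_1 = A_∞⁻¹`, in which `N` is no longer multiplied by `P`. -/
theorem entriesIdeal_mul_sub_one {P N : Matrix (Fin 2) (Fin 2) A} (hN : N * N = 0) :
    entriesIdeal (P * (1 + N) - 1) = entriesIdeal (P - (1 - N)) := by
  have h1 : P * (1 + N) - 1 = (P - (1 - N)) * (1 + N) := by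
    rw [sub_mul, sub_mul, one_mul, mul_add, mul_add, mul_one, mul_one, hN]; abel
  have h2 : P - (1 - N) = (P * (1 + N) - 1) * (1 - N) := by
    have h3 : (1 + N) * (1 - N) = 1 - N * N := by noncomm_ring
    rw [sub_mul, mul_assoc, h3, hN, sub_zero, mul_one, one_mul]
  refine le_antisymm ?_ ?_
  · rw [h1]; exact entriesIdeal_mul_le _ _
  · conv_lhs => rw [h2]
    exact entriesIdeal_mul_le _ _

end Entries

/-! ### The regular sequences in the eight charts -/

section Charts

open MvPolynomial (supported)

variable (ε : Pt → Bool)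

theorem chartNilp_eq (s : Pt) :
    chartNilp ε s = nilp (MvPolynomial.X (s, true)) (chartVec ε s) := rfl

theorem chartVec_apply (s : Pt) (i : Fin 2) :
    chartVec ε s i = 1 ∨ chartVec ε s i = MvPolynomial.X (s, false) := by
  unfold chartVec
  split <;> fin_cases i <;> simp

theorem chartVec_mem {i : Pt × Bool} {s : Pt} (h : i ≠ (s, false)) (j : Fin 2) :
    chartVec ε s j ∈ supported ℚ {i}ᶜ := by
  rcases chartVec_apply ε s j with e | e <;> rw [e]
  · exact one_mem _
  · exact MvPolynomial.X_mem_supported.2 (by simpa using h.symm)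

theorem det₂_mem {A : Type} [CommRing A] [Algebra ℚ A] {S : Subalgebra ℚ A} {v w : Fin 2 → A}
    (hv : ∀ i, v i ∈ S) (hw : ∀ i, w i ∈ S) : det₂ v w ∈ S :=
  sub_mem (mul_mem (hv 0) (hw 1)) (mul_mem (hv 1) (hw 0))

theorem notMem_vars_of_mem_supported {i : Pt × Bool} {p : ChartRing}
    (h : p ∈ supported ℚ {i}ᶜ) : i ∉ p.vars := fun hi =>
  MvPolynomial.mem_supported.1 h hi rfl

/-- A vector which completes `chartVec ε s` to a basis of determinant one. -/
def chartDual (s : Pt) : Fin 2 → ChartRing := if ε s then ![-1, 0] else ![0, 1]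

theorem det₂_chartDual (s : Pt) : det₂ (chartVec ε s) (chartDual ε s) = 1 := by
  unfold det₂ chartVec chartDual
  split <;> simp

theorem chartDual_mem (S : Subalgebra ℚ ChartRing) (s : Pt) (j : Fin 2) : chartDual ε s j ∈ S := by
  unfold chartDual
  split <;> fin_cases j <;> simp [zero_mem, one_mem]

/-- The determinant is linear in the coordinate of `ℓ_0`. Up to sign its coefficients are the
entries of the vector of `ℓ_∞`, one of which is `1`, so they are relatively prime. -/
theorem irreducible_det₂ :
    Irreducible (det₂ (chartVec ε .zero) (chartVec ε .infty)) := by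
  have h : ∀ i, chartVec ε .infty i ∈ supported ℚ {(Pt.zero, false)}ᶜ :=
    chartVec_mem ε (by simp)
  have hu : IsUnit (chartVec ε .infty 0) ∨ IsUnit (chartVec ε .infty 1) := by
    unfold chartVec
    split <;> simp
  have hn : ∀ i, chartVec ε .infty i ≠ 0 := fun i => by
    rcases chartVec_apply ε .infty i with e | e <;> rw [e]
    · exact one_ne_zero
    · exact MvPolynomial.X_ne_zero _
  rcases hε : ε .zero with _ | _
  · have e : det₂ (chartVec ε .zero) (chartVec ε .infty) =
        -chartVec ε .infty 0 * MvPolynomial.X (Pt.zero, false) + chartVec ε .infty 1 := by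
      simp only [det₂, chartVec, hε]; simp; ring
    rw [e]
    refine MvPolynomial.irreducible_mul_X_add _ _ _ (neg_ne_zero.2 (hn 0))
      (notMem_vars_of_mem_supported (neg_mem (h 0))) (notMem_vars_of_mem_supported (h 1)) ?_
    exact hu.elim (fun hu => hu.neg.isRelPrime_left) fun hu => hu.isRelPrime_right
  · have e : det₂ (chartVec ε .zero) (chartVec ε .infty) =
        chartVec ε .infty 1 * MvPolynomial.X (Pt.zero, false) + -chartVec ε .infty 0 := by
      simp only [det₂, chartVec, hε]; simp; ring
    rw [e]
    refine MvPolynomial.irreducible_mul_X_add _ _ _ (hn 1)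
      (notMem_vars_of_mem_supported (h 1)) (notMem_vars_of_mem_supported (neg_mem (h 0))) ?_
    exact hu.elim (fun hu => hu.neg.isRelPrime_right) fun hu => hu.isRelPrime_left

/-- The coordinate of the second line which is not eliminated. -/
def chartCoord : ChartRing := chartVec ε .one (if ε .zero then 1 else 0)

/-- The first equation for the lines. -/
def chartEq : ChartRing :=
  det₂ (chartVec ε .zero) (chartVec ε .infty) * MvPolynomial.X (Pt.zero, true) +
    MvPolynomial.X (Pt.one, true) * det₂ (chartVec ε .one) (chartVec ε .infty) * chartCoord ε

/-- The second equation for the lines. -/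
def chartEq' : ChartRing :=
  MvPolynomial.X (Pt.one, true) * det₂ (chartVec ε .one) (chartVec ε .infty) *
    det₂ (chartVec ε .zero) (chartVec ε .one)

/-- The point with the given coordinates of lines and vectors. -/
def chartPoint (x y z a b c : ℚ) : Pt × Bool → ℚ
  | (.zero, false) => x
  | (.one, false) => y
  | (.infty, false) => z
  | (.zero, true) => a
  | (.one, true) => b
  | (.infty, true) => c

/-- The equation is linear in the cotangent coordinate at `0`. Its leading coefficient is
irreducible, so it suffices that this does not divide the constant term. -/
theorem prime_chartEq : Prime (chartEq ε) := by
  refine UniqueFactorizationMonoid.irreducible_iff_prime.1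
    (MvPolynomial.irreducible_mul_X_add _ _ _ (irreducible_det₂ ε).ne_zero
      (notMem_vars_of_mem_supported (det₂_mem (chartVec_mem ε (by simp)) (chartVec_mem ε (by simp))))
      (notMem_vars_of_mem_supported (mul_mem (mul_mem (MvPolynomial.X_mem_supported.2 (by simp))
        (det₂_mem (chartVec_mem ε (by simp)) (chartVec_mem ε (by simp))))
        (chartVec_mem ε (by simp) _))) ?_)
  refine (irreducible_det₂ ε).isRelPrime_iff_not_dvd.2 fun ⟨k, hk⟩ => ?_
  -- At this point `ℓ_∞` equals `ℓ_0` and differs from `ℓ_1`. The two choices `2` and `1 / 2`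
  -- express the same line in equal or different charts.
  have := congr_arg (MvPolynomial.eval
    (chartPoint 2 5 (if ε .zero = ε .infty then 2 else 1 / 2) 0 1 0)) hk
  rcases h0 : ε .zero with _ | _ <;> rcases h1 : ε .one with _ | _ <;>
    rcases h2 : ε .infty with _ | _ <;>
    simp [det₂, chartVec, chartCoord, chartPoint, h0, h1, h2] at this <;> norm_num at this

theorem not_chartEq_dvd : ¬ chartEq ε ∣ chartEq' ε := by
  rintro ⟨k, hk⟩
  -- The coordinates `2, 3, 5` give distinct lines in every chart. The fourth coordinate is solved
  -- from the first equation, so that it vanishes while the second one does not.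
  have h := congr_arg (MvPolynomial.eval (chartPoint 2 3 5
    (-(MvPolynomial.eval (chartPoint 2 3 5 0 1 0)
      (det₂ (chartVec ε .one) (chartVec ε .infty) * chartCoord ε)) /
      MvPolynomial.eval (chartPoint 2 3 5 0 1 0) (det₂ (chartVec ε .zero) (chartVec ε .infty)))
    1 0)) hk
  rcases h0 : ε .zero with _ | _ <;> rcases h1 : ε .one with _ | _ <;>
    rcases h2 : ε .infty with _ | _ <;>
    simp [det₂, chartVec, chartCoord, chartPoint, chartEq, chartEq', h0, h1, h2] at h <;>
    norm_num at h

/-- Substituting `-h` for the cotangent coordinate at `∞` is the required retraction; the other two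
equations do not involve that coordinate. -/
theorem isWeaklyRegular_chart {h : ChartRing} (hh : h ∈ supported ℚ {(Pt.infty, true)}ᶜ) :
    RingTheory.Sequence.IsWeaklyRegular ChartRing
      [MvPolynomial.X (Pt.infty, true) + h, chartEq ε, chartEq' ε] := by
  let ψ : ChartRing →ₐ[ℚ] ChartRing := MvPolynomial.aeval fun
    | (.infty, true) => -h
    | i => MvPolynomial.X i
  have hψ : ∀ p ∈ supported ℚ {(Pt.infty, true)}ᶜ, ψ p = p := fun p hp => by
    refine MvPolynomial.hom_congr_vars (f₁ := ψ.toRingHom) (f₂ := RingHom.id _) (by ext; simp)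
      (fun i hi _ => ?_) rfl
    have hi' := MvPolynomial.mem_supported.1 hp hi
    rcases i with ⟨_ | _ | _, _ | _⟩ <;> first | exact (hi' rfl).elim | simp [ψ]
  have hX : ψ (MvPolynomial.X (Pt.infty, true)) = -h := by simp [ψ]
  have hd : ∀ {s t}, det₂ (chartVec ε s) (chartVec ε t) ∈ supported ℚ {(Pt.infty, true)}ᶜ :=
    fun {s t} => det₂_mem (chartVec_mem ε (by simp)) (chartVec_mem ε (by simp))
  have hmem : MvPolynomial.X (Pt.one, true) * det₂ (chartVec ε .one) (chartVec ε .infty) ∈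
      supported ℚ {(Pt.infty, true)}ᶜ := mul_mem (MvPolynomial.X_mem_supported.2 (by simp)) hd
  refine isWeaklyRegular_of_retract ψ.toRingHom ?_ ?_ (hψ _ (add_mem (mul_mem hd
    (MvPolynomial.X_mem_supported.2 (by simp))) (mul_mem hmem (chartVec_mem ε (by simp) _))))
    (hψ _ (mul_mem hmem hd)) ?_ (prime_chartEq ε) (not_chartEq_dvd ε)
  · intro h0
    have : MvPolynomial.X (Pt.infty, true) = -h := eq_neg_of_add_eq_zero_left h0
    have hs := MvPolynomial.X_mem_supported.1 (this ▸ neg_mem hh :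
      (MvPolynomial.X (Pt.infty, true) : ChartRing) ∈ supported ℚ {(Pt.infty, true)}ᶜ)
    exact hs rfl
  · change ψ (_ + _) = 0
    rw [map_add, hX, hψ h hh, neg_add_cancel]
  · intro y
    rw [← Ideal.mem_span_singleton, ← Ideal.Quotient.eq]
    have : (Ideal.Quotient.mkₐ ℚ (Ideal.span {MvPolynomial.X (Pt.infty, true) + h})).comp ψ =
        Ideal.Quotient.mkₐ ℚ _ := by
      refine MvPolynomial.algHom_ext fun i => ?_
      have hi : Ideal.Quotient.mk (Ideal.span {MvPolynomial.X (Pt.infty, true) + h}) (-h) =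
          Ideal.Quotient.mk _ (MvPolynomial.X (Pt.infty, true)) := by
        rw [Ideal.Quotient.eq, Ideal.mem_span_singleton]
        exact ⟨-1, by ring⟩
      rcases i with ⟨_ | _ | _, _ | _⟩ <;> simp [ψ, hi]
    exact (DFunLike.congr_fun this y).symm

/-- The vector of `ℓ_0` has an entry `1`, so `z` is recovered from its entry at that place and its
determinant with that vector. The former is `chartEq + t * chartEq'`, the latter `chartEq'`. -/
theorem chartEq_mem {I : Ideal ChartRing} {z : Fin 2 → ChartRing} (t : ChartRing)
    (hz : ∀ i, z i = (MvPolynomial.X (Pt.zero, true) *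
      det₂ (chartVec ε .zero) (chartVec ε .infty) + t * chartEq' ε) * chartVec ε .zero i +
      MvPolynomial.X (Pt.one, true) * det₂ (chartVec ε .one) (chartVec ε .infty) *
        chartVec ε .one i) :
    (∀ i, z i ∈ I) ↔ chartEq ε ∈ I ∧ chartEq' ε ∈ I := by
  have h0 := hz 0
  have h1 := hz 1
  have hg : chartEq' ε = chartVec ε .zero 0 * z 1 - chartVec ε .zero 1 * z 0 := by
    rw [h0, h1]; simp only [chartEq', det₂]; ring
  constructor
  · intro h
    have hg' : chartEq' ε ∈ I := by
      rw [hg]; exact sub_mem (I.mul_mem_left _ (h 1)) (I.mul_mem_left _ (h 0))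
    refine ⟨?_, hg'⟩
    rcases hε : ε .zero with _ | _
    · have : chartEq ε = z 0 - t * chartEq' ε := by
        rw [h0]; simp [chartEq, chartCoord, chartVec, hε]; ring
      rw [this]
      exact sub_mem (h 0) (I.mul_mem_left _ hg')
    · have : chartEq ε = z 1 - t * chartEq' ε := by
        rw [h1]; simp [chartEq, chartCoord, chartVec, hε]; ring
      rw [this]
      exact sub_mem (h 1) (I.mul_mem_left _ hg')
  · rintro ⟨hf, hg'⟩
    have hs := add_mem hf (I.mul_mem_left t hg')
    rcases hε : ε .zero with _ | _
    · have e0 : z 0 = chartEq ε + t * chartEq' ε := by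
        rw [h0]; simp [chartEq, chartCoord, chartVec, hε]; ring
      have e1 : z 1 = chartEq' ε + chartVec ε .zero 1 * z 0 := by
        rw [hg]; simp [chartVec, hε]
      have m0 : z 0 ∈ I := e0 ▸ hs
      refine Fin.forall_fin_two.2 ⟨m0, ?_⟩
      rw [e1]
      exact add_mem hg' (I.mul_mem_left _ m0)
    · have e1 : z 1 = chartEq ε + t * chartEq' ε := by
        rw [h1]; simp [chartEq, chartCoord, chartVec, hε]; ring
      have e0 : z 0 = -chartEq' ε + chartVec ε .zero 0 * z 1 := by
        rw [hg]; simp [chartVec, hε]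
      have m1 : z 1 ∈ I := e1 ▸ hs
      refine Fin.forall_fin_two.2 ⟨?_, m1⟩
      rw [e0]
      exact add_mem (neg_mem hg') (I.mul_mem_left _ m1)

/-- The criterion for complete intersections in a chart, in terms of the matrix `K` of equations. -/
theorem isCompleteIntersection_of_matrix {K : Matrix (Fin 2) (Fin 2) ChartRing} {t h : ChartRing}
    (hz : ∀ i, K.mulVec (chartVec ε .infty) i = (MvPolynomial.X (Pt.zero, true) *
      det₂ (chartVec ε .zero) (chartVec ε .infty) + t * chartEq' ε) * chartVec ε .zero i +
      MvPolynomial.X (Pt.one, true) * det₂ (chartVec ε .one) (chartVec ε .infty) *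
        chartVec ε .one i)
    (hh : h ∈ supported ℚ {(Pt.infty, true)}ᶜ)
    (hq : det₂ (K.mulVec (chartDual ε .infty)) (chartDual ε .infty) =
      MvPolynomial.X (Pt.infty, true) + h) {u : ChartRing}
    (hu : ∀ J : Ideal ChartRing, (∀ i, K.mulVec (chartVec ε .infty) i ∈ J) →
      u - 1 ∈ J ∧ u * det₂ (chartVec ε .infty) (K.mulVec (chartDual ε .infty)) ∈ J) :
    IsCompleteIntersection (entriesIdeal K) 3 := by
  intro p _ hp
  have hfg := (chartEq_mem ε t hz).1 (mulVec_mem_entriesIdeal K (chartVec ε .infty))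
  set J := Ideal.span {MvPolynomial.X (Pt.infty, true) + h, chartEq ε, chartEq' ε}
  have hJ : ∀ i, K.mulVec (chartVec ε .infty) i ∈ J := (chartEq_mem ε t hz).2
    ⟨Ideal.subset_span (by simp), Ideal.subset_span (by simp)⟩
  refine exists_isRegular_of_isWeaklyRegular hp (isWeaklyRegular_chart ε hh) ?_ (u := u) ?_
    (mem_span_of_det (det₂_chartDual ε .infty) rfl hq (Ideal.subset_span (by simp)) hJ (hu J hJ).2)
  · refine Ideal.span_le.2 ?_
    rintro x (rfl | rfl | rfl)
    · rw [SetLike.mem_coe, ← hq]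
      exact det₂_mulVec_mem_entriesIdeal K _ _
    · exact hfg.1
    · exact hfg.2
  · intro hup
    have h1 : u - 1 ∈ p :=
      hp ((hu _ (mulVec_mem_entriesIdeal K (chartVec ε .infty))).1)
    exact (Ideal.ne_top_iff_one p).1 (Ideal.IsPrime.ne_top ‹_›) (by simpa using sub_mem hup h1)

theorem det₂_chart_mem (s t : Pt) :
    det₂ (chartVec ε s) (chartVec ε t) ∈ supported ℚ {(Pt.infty, true)}ᶜ :=
  det₂_mem (chartVec_mem ε (by simp)) (chartVec_mem ε (by simp))

theorem det₂_chartDual_mem (s t : Pt) :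
    det₂ (chartVec ε s) (chartDual ε t) ∈ supported ℚ {(Pt.infty, true)}ᶜ :=
  det₂_mem (chartVec_mem ε (by simp)) (chartDual_mem ε _ _)

theorem isCompleteIntersection_sumIdeal : IsCompleteIntersection (sumIdeal ε) 3 := by
  have hX : ∀ s, s ≠ Pt.infty →
      (MvPolynomial.X (s, true) : ChartRing) ∈ supported ℚ {(Pt.infty, true)}ᶜ :=
    fun s hs => MvPolynomial.X_mem_supported.2 (by simpa using hs)
  refine isCompleteIntersection_of_matrix ε (t := 0) (u := 1) (fun i => ?_) ?_
    (det₂_sum_mulVec _ _ _ _ _ (det₂_chartDual ε .infty)) fun J hJ => ⟨by simp, ?_⟩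
  · rw [chartNilp_eq, chartNilp_eq, chartNilp_eq]
    fin_cases i <;> simp [nilp_apply, Matrix.mulVec, dotProduct, Fin.sum_univ_two, det₂] <;> ring
  · exact add_mem (mul_mem (hX _ (by simp)) (mul_mem (det₂_chartDual_mem ε _ _)
      (det₂_chartDual_mem ε _ _))) (mul_mem (hX _ (by simp))
      (mul_mem (det₂_chartDual_mem ε _ _) (det₂_chartDual_mem ε _ _)))
  · rw [one_mul, chartNilp_eq, chartNilp_eq, chartNilp_eq, det₂_sum_mulVec']
    exact neg_mem (sub_mem (J.mul_mem_right _ (hJ 0)) (J.mul_mem_right _ (hJ 1)))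

theorem isCompleteIntersection_prodIdeal : IsCompleteIntersection (prodIdeal ε) 3 := by
  have hX : ∀ s, s ≠ Pt.infty →
      (MvPolynomial.X (s, true) : ChartRing) ∈ supported ℚ {(Pt.infty, true)}ᶜ :=
    fun s hs => MvPolynomial.X_mem_supported.2 (by simpa using hs)
  unfold prodIdeal
  rw [entriesIdeal_mul_sub_one (N := chartNilp ε .infty) (nilp_mul_nilp _ _)]
  refine isCompleteIntersection_of_matrix ε (t := MvPolynomial.X (Pt.zero, true)) (fun i => ?_) ?_
    (det₂_prod_mulVec _ _ _ _ _ (det₂_chartDual ε .infty)) (u := 1 + det₂ ((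
      (1 + chartNilp ε .zero) * (1 + chartNilp ε .one) - (1 - chartNilp ε .infty)).mulVec
      (chartVec ε .infty)) (chartDual ε .infty)) fun J hJ => ⟨?_, ?_⟩
  · rw [chartNilp_eq, chartNilp_eq, chartNilp_eq]
    fin_cases i <;> simp [nilp_apply, Matrix.mulVec, dotProduct, Fin.sum_univ_two, det₂,
      Matrix.mul_apply, chartEq'] <;> ring
  · exact add_mem (add_mem (mul_mem (hX _ (by simp)) (mul_mem (det₂_chartDual_mem ε _ _)
      (det₂_chartDual_mem ε _ _))) (mul_mem (hX _ (by simp))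
      (mul_mem (det₂_chartDual_mem ε _ _) (det₂_chartDual_mem ε _ _))))
      (mul_mem (mul_mem (hX _ (by simp)) (hX _ (by simp))) (mul_mem (det₂_chart_mem ε _ _)
      (mul_mem (det₂_chartDual_mem ε _ _) (det₂_chartDual_mem ε _ _))))
  · rw [add_sub_cancel_left]
    exact sub_mem (J.mul_mem_right _ (hJ 0)) (J.mul_mem_right _ (hJ 1))
  · have hP : ((1 + chartNilp ε .zero) * (1 + chartNilp ε .one)).det = 1 := by
      rw [Matrix.det_mul, chartNilp_eq, chartNilp_eq, det_one_add_nilp, det_one_add_nilp, one_mul]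
    refine (congr_arg (· ∈ J) (det₂_sub_mulVec hP _ (det₂_chartDual ε .infty))).mpr ?_
    refine sub_mem (J.mul_mem_right _ ?_)
      (sub_mem (J.mul_mem_right _ (hJ 0)) (J.mul_mem_right _ (hJ 1)))
    exact sub_mem (J.mul_mem_left _ (hJ 1)) (J.mul_mem_left _ (hJ 0))

end Charts

/-! ### Paths and open covers -/

/-- A property of paths which is compatible with homotopies and concatenation can be checked
locally. -/
theorem path_induction {Y : Type*} [TopologicalSpace Y] {ι : Type*} {D : Set Y} {V : ι → Set Y}
    (hV : ∀ i, IsOpen (V i)) (hD : D ⊆ ⋃ i, V i) {P : ∀ {x y : Y}, Path x y → Prop}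
    (hom : ∀ {x y : Y} {γ γ' : Path x y}, γ.Homotopic γ' → P γ → P γ')
    (trans : ∀ {x y z : Y} {γ : Path x y} {γ' : Path y z}, P γ → P γ' → P (γ.trans γ'))
    (piece : ∀ {x y : Y} (γ : Path x y) (i : ι), (∀ t, γ t ∈ D) → (∀ t, γ t ∈ V i) → P γ)
    {x y : Y} (γ : Path x y) (hγ : ∀ t, γ t ∈ D) : P γ := by
  have hcast : ∀ {x' y' : Y} (hx : x' = x) (hy : y' = y), P (γ.cast hx hy) → P γ := by
    rintro _ _ rfl rfl h
    exact h
  -- A subdivision of the unit interval adapted to the cover.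
  obtain ⟨t, ht0, htm, ⟨n, hn⟩, ht⟩ := exists_monotone_Icc_subset_open_cover_unitInterval
    (c := fun i => γ ⁻¹' V i) (fun i => (hV i).preimage γ.continuous)
    (fun s _ => by simpa using hD (hγ s))
  have hsub : ∀ s, P (γ.subpath (t s) (t (s + 1))) := fun s => by
    obtain ⟨i, hi⟩ := ht s
    have hr : ∀ r, γ.subpath (t s) (t (s + 1)) r ∈ γ '' Set.Icc (t s) (t (s + 1)) := fun r => by
      rw [← Path.range_subpath_of_le _ _ _ (htm s.le_succ)]
      exact ⟨r, rfl⟩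
    refine piece _ i (fun r => ?_) fun r => ?_
    · obtain ⟨q, -, hq⟩ := hr r
      exact hq ▸ hγ q
    · obtain ⟨q, hq, hq'⟩ := hr r
      exact hq' ▸ hi hq
  -- The induction starts with the first piece rather than with a constant path, for which nothing
  -- is assumed.
  have key : ∀ m, P (γ.subpath 0 (t (m + 1))) := fun m => by
    induction m with
    | zero => have := hsub 0; rwa [ht0] at this
    | succ m ih => exact hom ⟨Path.Homotopy.subpathTransSubpath γ _ _ _⟩ (trans ih (hsub (m + 1)))
  have := key n
  rw [hn (n + 1) n.le_succ, Path.subpath_zero_one] at this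
  exact hcast _ _ this

/-! ### A cover of the punctured line -/

/-- The three components of the complement of the lines `Re z = 0` and `Re z = 1`. -/
inductive Strip : Type
  | left | mid | right

/-- The points of a strip. -/
def Strip.set : Strip → Set ℂ
  | .left => {z | z.re < 0}
  | .mid => {z | 0 < z.re} ∩ {z | z.re < 1}
  | .right => {z | 1 < z.re}

/-- The pieces of a cover of the punctured line: the two half planes, and the three strips. -/
inductive Piece : Type
  | up | low
  | strip (j : Strip)

namespace Piece

/-- The points of a piece. -/
def set : Piece → Set ℂ
  | up => {z | 0 < z.im}
  | low => {z | z.im < 0}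
  | strip j => j.set

theorem isOpen_set (i : Piece) : IsOpen i.set := by
  rcases i with _ | _ | _ | _ | _
  · exact isOpen_lt continuous_const Complex.continuous_im
  · exact isOpen_lt Complex.continuous_im continuous_const
  · exact isOpen_lt Complex.continuous_re continuous_const
  · exact (isOpen_lt continuous_const Complex.continuous_re).inter
      (isOpen_lt Complex.continuous_re continuous_const)
  · exact isOpen_lt continuous_const Complex.continuous_re

theorem convex_set (i : Piece) : Convex ℝ i.set := by
  rcases i with _ | _ | _ | _ | _
  · exact convex_halfSpace_im_gt 0
  · exact convex_halfSpace_im_lt 0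
  · exact convex_halfSpace_re_lt 0
  · exact (convex_halfSpace_re_gt 0).inter (convex_halfSpace_re_lt 1)
  · exact convex_halfSpace_re_gt 1

theorem ne_of_mem {i : Piece} {z : ℂ} (h : z ∈ i.set) : z ≠ 0 ∧ z ≠ 1 := by
  constructor <;> rintro rfl <;> rcases i with _ | _ | _ | _ | _ <;>
    simp [set, Strip.set] at h <;> linarith

/-- A piece which contains the point. -/
def index (z : ℂ) : Piece :=
  if 0 < z.im then up else if z.im < 0 then low else if z.re < 0 then strip .left else
    if z.re < 1 then strip .mid else strip .right

theorem mem_index {z : ℂ} (hz : z ≠ 0 ∧ z ≠ 1) : z ∈ (index z).set := by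
  unfold index
  split_ifs with h1 h2 h3 h4
  · exact h1
  · exact h2
  · exact h3
  · refine ⟨lt_of_le_of_ne (not_lt.1 h3) fun h => hz.1 ?_, h4⟩
    exact Complex.ext h.symm (le_antisymm (not_lt.1 h1) (not_lt.1 h2))
  · refine lt_of_le_of_ne (not_lt.1 h4) fun h => hz.2 ?_
    exact Complex.ext h.symm (le_antisymm (not_lt.1 h1) (not_lt.1 h2))

theorem index_of_pos {z : ℂ} (h : 0 < z.im) : index z = up := if_pos h

theorem index_of_neg {z : ℂ} (h : z.im < 0) : index z = low :=
  (if_neg h.not_gt).trans (if_pos h)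

theorem strip_eq_of_mem {j k : Strip} {z : ℂ} (hj : z ∈ j.set) (hk : z ∈ k.set) : j = k := by
  rcases j with _ | _ | _ <;> rcases k with _ | _ | _ <;> first | rfl | (
    simp only [Strip.set, Set.mem_ofPred_eq, Set.mem_inter_iff] at hj hk; linarith)

theorem not_mem_up_low {z : ℂ} (h : z ∈ up.set) (h' : z ∈ low.set) : False :=
  lt_asymm (show 0 < z.im from h) h'

/-- The transition functions of the universal local system: it is glued from constant local
systems on the pieces, and only the gluing between the lower half plane and the strips is
non-trivial. -/
def change : Piece → Piece → FreeGroup Strip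
  | low, strip j => (FreeGroup.of j)⁻¹
  | strip j, low => FreeGroup.of j
  | _, _ => 1

theorem change_self (i : Piece) : change i i = 1 := by
  rcases i with _ | _ | _ <;> rfl

/-- A point lies in at most one half plane and one strip, so two of the three pieces coincide and
the cocycle condition is immediate. -/
theorem change_comp {i j k : Piece} {z : ℂ} (hi : z ∈ i.set) (hj : z ∈ j.set) (hk : z ∈ k.set) :
    change j k * change i j = change i k := by
  rcases i with _ | _ | i <;> rcases j with _ | _ | j <;> rcases k with _ | _ | k <;>
    first
    | exact (not_mem_up_low hi hj).elim
    | exact (not_mem_up_low hj hi).elim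
    | exact (not_mem_up_low hi hk).elim
    | exact (not_mem_up_low hk hi).elim
    | exact (not_mem_up_low hj hk).elim
    | exact (not_mem_up_low hk hj).elim
    | skip
  all_goals
    first
    | obtain rfl := strip_eq_of_mem hi hk
    | obtain rfl := strip_eq_of_mem hi hj
    | obtain rfl := strip_eq_of_mem hj hk
    | skip
  all_goals simp [change]

end Piece

/-- The points of the punctured line in a piece. -/
def pieceSet (i : Piece) : Set PuncturedLine := Subtype.val ⁻¹' i.set

theorem isOpen_pieceSet (i : Piece) : IsOpen (pieceSet i) :=
  i.isOpen_set.preimage continuous_subtype_val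

/-- The discrete topology on the structure group of the universal local system. -/
instance : TopologicalSpace (FreeGroup Strip) := ⊥

instance : DiscreteTopology (FreeGroup Strip) := ⟨rfl⟩

/-- The universal local system. -/
def windingCore : FiberBundleCore Piece PuncturedLine (FreeGroup Strip) where
  baseSet := pieceSet
  isOpen_baseSet := isOpen_pieceSet
  indexAt x := Piece.index x.1
  mem_baseSet_at x := Piece.mem_index x.2
  coordChange i j _ g := Piece.change i j * g
  coordChange_self i _ _ g := by rw [Piece.change_self, one_mul]
  continuousOn_coordChange i j :=
    ((continuous_of_discreteTopology (f := fun g => Piece.change i j * g)).comp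
      continuous_snd).continuousOn
  coordChange_comp i j k x hx g := by
    rw [← mul_assoc, Piece.change_comp hx.1.1 hx.1.2 hx.2]

theorem isCoveringMap_winding : IsCoveringMap windingCore.proj :=
  FiberBundle.isCoveringMap (F := FreeGroup Strip) (E := windingCore.Fiber)

/-- The parallel transport of the universal local system. -/
def windingMap {x y : PuncturedLine} (γ : Path.Homotopic.Quotient x y) (g : FreeGroup Strip) :
    FreeGroup Strip :=
  let e : windingCore.proj ⁻¹' {y} := isCoveringMap_winding.monodromy γ ⟨⟨x, g⟩, rfl⟩
  (show Bundle.TotalSpace (FreeGroup Strip) windingCore.Fiber from e.1).2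

theorem monodromy_eq {x y : PuncturedLine} (γ : Path.Homotopic.Quotient x y) (g : FreeGroup Strip) :
    isCoveringMap_winding.monodromy γ ⟨⟨x, g⟩, rfl⟩ = ⟨⟨y, windingMap γ g⟩, rfl⟩ := by
  unfold windingMap
  obtain ⟨⟨z, w⟩, hz⟩ := isCoveringMap_winding.monodromy γ ⟨⟨x, g⟩, rfl⟩
  obtain rfl : z = y := hz
  rfl

theorem windingMap_refl (x : PuncturedLine) (g : FreeGroup Strip) :
    windingMap (.refl x) g = g := by
  unfold windingMap
  rw [isCoveringMap_winding.monodromy_refl]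
  rfl

theorem windingMap_trans {x y z : PuncturedLine} (γ : Path.Homotopic.Quotient x y)
    (γ' : Path.Homotopic.Quotient y z) (g : FreeGroup Strip) :
    windingMap (γ.trans γ') g = windingMap γ' (windingMap γ g) := by
  conv_lhs => unfold windingMap
  rw [isCoveringMap_winding.monodromy_trans_apply, monodromy_eq, monodromy_eq]

/-- Over a piece the lift of a path is constant in the local trivialization. The two transition
functions pass to it from the frame chosen at `x`, and from it to the frame chosen at `y`. -/
theorem windingMap_piece {x y : PuncturedLine} (γ : Path x y) (i : Piece)
    (hγ : ∀ t, γ t ∈ pieceSet i) (g : FreeGroup Strip) :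
    windingMap (.mk γ) g =
      Piece.change i (Piece.index y.1) * Piece.change (Piece.index x.1) i * g := by
  have hx : x.1 ∈ i.set := by have := hγ 0; rwa [γ.source] at this
  let f : unitInterval → windingCore.TotalSpace := fun t =>
    (windingCore.localTriv i).toOpenPartialHomeomorph.symm
      (γ t, Piece.change (Piece.index x.1) i * g)
  have hf : Continuous f := by
    refine (windingCore.localTriv i).toOpenPartialHomeomorph.symm.continuousOn.comp_continuous
      (γ.continuous.prodMk continuous_const) fun t => ?_
    exact ((windingCore.localTriv i).mem_target).2 (hγ t)
  let Γ : Path (f 0) (f 1) := ⟨⟨f, hf⟩, rfl, rfl⟩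
  have h0 : f 0 = ⟨x, g⟩ := by
    change (⟨γ 0, Piece.change i (Piece.index (γ 0).1) * (Piece.change (Piece.index x.1) i * g)⟩ :
      windingCore.TotalSpace) = ⟨x, g⟩
    rw [γ.source, ← mul_assoc, Piece.change_comp (Piece.mem_index x.2) hx (Piece.mem_index x.2),
      Piece.change_self, one_mul]
  have h1 : f 1 = ⟨y, Piece.change i (Piece.index y.1) * (Piece.change (Piece.index x.1) i * g)⟩ := by
    change (⟨γ 1, Piece.change i (Piece.index (γ 1).1) * (Piece.change (Piece.index x.1) i * g)⟩ :
      windingCore.TotalSpace) = _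
    rw [γ.target]
  have hm := isCoveringMap_winding.monodromy_eq_of_map_eq (γ := .mk γ) (ex := ⟨⟨x, g⟩, rfl⟩)
    (ey := ⟨⟨y, Piece.change i (Piece.index y.1) * (Piece.change (Piece.index x.1) i * g)⟩, rfl⟩)
    (.mk (Γ.cast h0.symm h1.symm)) (by
      refine congr_arg Path.Homotopic.Quotient.mk ?_
      ext1
      rfl)
  rw [monodromy_eq] at hm
  rw [mul_assoc]
  injection Subtype.ext_iff.1 hm with _ h

/-- The universal monodromy of a path. -/
def winding {x y : PuncturedLine} (γ : Path.Homotopic.Quotient x y) : FreeGroup Strip :=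
  windingMap γ 1

theorem iUnion_pieceSet : Set.univ ⊆ ⋃ i, pieceSet i := fun x _ =>
  Set.mem_iUnion.2 ⟨_, Piece.mem_index x.2⟩

/-- The gluing is by left multiplications, so transport commutes with right multiplications and is
determined by the image of `1`. -/
theorem windingMap_eq {x y : PuncturedLine} (γ : Path.Homotopic.Quotient x y)
    (g : FreeGroup Strip) : windingMap γ g = winding γ * g := by
  obtain ⟨γ, rfl⟩ := Path.Homotopic.Quotient.mk_surjective γ
  refine path_induction (D := Set.univ) isOpen_pieceSet iUnion_pieceSet
    (P := fun γ => ∀ g, windingMap (.mk γ) g = winding (.mk γ) * g) (fun h hP => ?_)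
    (fun {x y z γ γ'} h h' g => ?_) (fun γ i _ hi g => ?_) γ (fun _ => trivial) g
  · rwa [← Path.Homotopic.Quotient.eq.2 h]
  · rw [winding, Path.Homotopic.Quotient.mk_trans, windingMap_trans, windingMap_trans, h, h', h', h]
    simp only [mul_assoc, mul_one]
  · rw [winding, windingMap_piece γ i hi, windingMap_piece γ i hi, mul_one]

theorem winding_refl (x : PuncturedLine) : winding (.refl x) = 1 := windingMap_refl x 1

theorem winding_trans {x y z : PuncturedLine} (γ : Path.Homotopic.Quotient x y)
    (γ' : Path.Homotopic.Quotient y z) : winding (γ.trans γ') = winding γ' * winding γ := by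
  rw [winding, windingMap_trans, windingMap_eq γ']
  rfl

theorem winding_piece {x y : PuncturedLine} (γ : Path x y) (i : Piece)
    (hγ : ∀ t, γ t ∈ pieceSet i) : winding (.mk γ) =
      Piece.change i (Piece.index y.1) * Piece.change (Piece.index x.1) i := by
  rw [winding, windingMap_piece γ i hγ, mul_one]

/-! ### Unipotent automorphisms -/

namespace SLBundle

variable {R : Type u} [CommRing R] (E : SLBundle R)

/-- The automorphisms of an `SL(2)`-torsor. -/
def slGroup : Subgroup (E ≃ₗ[R] E) where
  carrier := {g | ∀ x y, E.vol (g x) (g y) = E.vol x y}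
  mul_mem' {g h} hg hh x y := (hg (h x) (h y)).trans (hh x y)
  one_mem' _ _ := rfl
  inv_mem' {g} hg x y := by
    have := hg (g⁻¹ x) (g⁻¹ y)
    rw [← LinearEquiv.mul_apply, ← LinearEquiv.mul_apply, mul_inv_cancel] at this
    exact this.symm

/-- The automorphisms which act trivially on a submodule and on the quotient. -/
def unipotent {E : SLBundle R} (ℓ : Submodule R E) : Subgroup (E ≃ₗ[R] E) where
  carrier := {g | (∀ v ∈ ℓ, g v = v) ∧ ∀ v, g v - v ∈ ℓ}
  mul_mem' {g h} hg hh := ⟨fun v hv => by rw [LinearEquiv.mul_apply, hh.1 v hv, hg.1 v hv],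
    fun v => by
      have := ℓ.add_mem (hg.2 (h v)) (hh.2 v)
      rwa [sub_add_sub_cancel] at this⟩
  one_mem' := ⟨fun _ _ => rfl, fun v => by simp⟩
  inv_mem' {g} hg := by
    have e : ∀ v, g (g⁻¹ v) = v := fun v => by rw [← LinearEquiv.mul_apply, mul_inv_cancel]; rfl
    have e' : ∀ v, g⁻¹ (g v) = v := fun v => by rw [← LinearEquiv.mul_apply, inv_mul_cancel]; rfl
    refine ⟨fun v hv => by rw [← hg.1 v hv, e', hg.1 v hv], fun v => ?_⟩
    have := ℓ.neg_mem (hg.2 (g⁻¹ v))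
    rwa [e, neg_sub] at this

variable {E}

/-- The automorphism `1 + N`. -/
def oneAdd (N : E →ₗ[R] E) (hN : ∀ x, N (N x) = 0) : E ≃ₗ[R] E :=
  LinearEquiv.ofLinearMap (LinearMap.id + N) (LinearMap.id - N)
    (LinearMap.ext fun x => by simp [hN]) (LinearMap.ext fun x => by simp [hN])

theorem oneAdd_apply (N : E →ₗ[R] E) (hN : ∀ x, N (N x) = 0) (x : E) : oneAdd N hN x = x + N x := rfl

theorem oneAdd_inv_apply (N : E →ₗ[R] E) (hN : ∀ x, N (N x) = 0) (x : E) :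
    (oneAdd N hN)⁻¹ x = x - N x := rfl

theorem oneAdd_mem_slGroup {N : E →ₗ[R] E} {hN : ∀ x, N (N x) = 0}
    (h : ∀ x y, E.vol (N x) y + E.vol x (N y) = 0) : oneAdd N hN ∈ E.slGroup := fun x y => by
  have h' := h x (N y)
  rw [hN, show E.vol x 0 = 0 from (E.volForm x).map_zero, add_zero] at h'
  rw [oneAdd_apply, oneAdd_apply, vol_add_left, vol_add_right, vol_add_right, h']
  linear_combination h x y

theorem oneAdd_mem_unipotent {N : E →ₗ[R] E} {hN : ∀ x, N (N x) = 0} {ℓ : Submodule R E}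
    (h : ∀ v ∈ ℓ, N v = 0) (h' : ∀ v, N v ∈ ℓ) : oneAdd N hN ∈ unipotent ℓ :=
  ⟨fun v hv => by rw [oneAdd_apply, h v hv, add_zero],
    fun v => by rw [oneAdd_apply, add_sub_cancel_left]; exact h' v⟩

end SLBundle

theorem SLBundle.IsLine.comap {R : Type u} [CommRing R] {E E' : SLBundle R} {ℓ : Submodule R E}
    (h : E.IsLine ℓ) (e : E' ≃ₗ[R] E) : E'.IsLine (ℓ.comap (e : E' →ₗ[R] E)) := by
  rw [Submodule.comap_equiv_eq_map_symm]
  exact h.map _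

/-! ### Local systems in terms of the monodromy of the strips -/

/-- The strip to the left of a puncture, and the strip to the right of it, as seen from the
puncture when coming from the upper half plane. -/
def Pt.leftStrip : Pt → Strip
  | .zero => .left
  | .one => .mid
  | .infty => .right

/-- See `Pt.leftStrip`. -/
def Pt.rightStrip : Pt → Strip
  | .zero => .mid
  | .one => .right
  | .infty => .left

/-- Monodromy data: an automorphism for each strip, and lines which are compatible with them. -/
structure StripData (R : Type u) [CommRing R] where
  bundle : SLBundle R
  τ : Strip → bundle.slGroup
  line : Pt → Submodule R bundle
  isLine : ∀ s, bundle.IsLine (line s)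
  -- A loop around `s` from the upper half plane goes down through the left strip and back up
  -- through the right one.
  mem_unipotent : ∀ s : Pt,
    (((τ s.rightStrip)⁻¹ * τ s.leftStrip : bundle.slGroup) : bundle ≃ₗ[R] bundle) ∈
      SLBundle.unipotent (line s)

namespace StripData

variable {R : Type u} [CommRing R] (M : StripData R)

/-- The monodromy representation. -/
def rep : FreeGroup Strip →* M.bundle.slGroup := FreeGroup.lift M.τ

theorem rep_of (j : Strip) : M.rep (.of j) = M.τ j := FreeGroup.lift_apply_of

/-- The local system. -/
def sys : LocalSystem R where
  obj _ := M.bundle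
  map f := ⟨(M.rep (winding f)).1, (M.rep (winding f)).2⟩
  map_id x := Subtype.ext (by
    change (M.rep (winding (.refl x.as))).1 = 1
    rw [winding_refl, map_one]; rfl)
  map_comp f g := Subtype.ext (by
    change (M.rep (winding (Path.Homotopic.Quotient.trans f g))).1 = _
    rw [winding_trans, map_mul]; rfl)

/-- The identification of the frame on a piece with the frame of the line at `s`. -/
def frame (s : Pt) : Piece → M.bundle.slGroup
  -- The lower half plane is framed through the right strip, which confines the monodromy to the
  -- passage through the left strip.
  | .low => (M.τ s.rightStrip)⁻¹
  | _ => 1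

/-- The pieces which cover the punctured disc at `s`. -/
def adjacent (s : Pt) (i : Piece) : Prop :=
  i = .up ∨ i = .low ∨ i = .strip s.leftStrip ∨ i = .strip s.rightStrip

/-- The chosen piece of a point is a strip only if the point is real, and then the inequality
defining the disc excludes the remote strip. -/
theorem adjacent_index {s : Pt} {x : PuncturedLine} (hx : x ∈ puncturedDisc s) :
    adjacent s (Piece.index x.1) := by
  rcases x with ⟨z, hz⟩
  have hre : |z.re| ≤ ‖z‖ := Complex.abs_re_le_norm z
  have hre' : |(z - 1).re| ≤ ‖z - 1‖ := Complex.abs_re_le_norm _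
  rw [Complex.sub_re, Complex.one_re] at hre'
  unfold Piece.index adjacent
  split_ifs with h1 h2 h3 h4 <;> cases s <;>
    simp only [puncturedDisc, Set.mem_ofPred_eq, Pt.leftStrip, Pt.rightStrip] at hx ⊢ <;> simp
  · linarith [(abs_le.1 (hre'.trans hx.le)).1]
  · have him : z.im = 0 := le_antisymm (not_lt.1 h1) (not_lt.1 h2)
    have hn : ‖z‖ = |z.re| := by
      rw [← Complex.re_add_im z, him]; simp
    rw [hn, abs_of_nonneg (not_lt.1 h3)] at hx
    linarith
  · have h4' : 1 ≤ z.re := not_lt.1 h4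
    linarith [le_abs_self z.re]

/-- In the frame of `s`, the transitions between adjacent pieces are trivial except between the
lower half plane and the left strip. There they are the monodromy around `s` or its inverse. -/
theorem frame_change_mem {s : Pt} {i j : Piece} {z : ℂ} (hi : z ∈ i.set) (hj : z ∈ j.set)
    (hi' : adjacent s i) (hj' : adjacent s j) :
    ((M.frame s i * M.rep (Piece.change j i) * (M.frame s j)⁻¹ : M.bundle.slGroup) :
      M.bundle ≃ₗ[R] M.bundle) ∈ SLBundle.unipotent (M.line s) := by
  have h1 := one_mem (SLBundle.unipotent (M.line s))
  have key : ∀ a : Strip, adjacent s (.strip a) →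
      (((M.τ s.rightStrip)⁻¹ * M.τ a : M.bundle.slGroup) : M.bundle ≃ₗ[R] M.bundle) ∈
      SLBundle.unipotent (M.line s) := by
    rintro a (h | h | h | h)
    · cases h
    · cases h
    · cases h; exact M.mem_unipotent s
    · cases h; rw [inv_mul_cancel]; exact h1
  rcases i with _ | _ | a <;> rcases j with _ | _ | b
  · simp [Piece.change, frame, h1]
  · exact (Piece.not_mem_up_low hi hj).elim
  · simp [Piece.change, frame, h1]
  · exact (Piece.not_mem_up_low hj hi).elim
  · simp [Piece.change, frame, h1]
  · simpa [Piece.change, frame, rep_of] using key b hj'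
  · simp [Piece.change, frame, h1]
  · simpa [Piece.change, frame, rep_of] using inv_mem (key a hi')
  · simp [Piece.change, frame, h1]

theorem frame_winding_mem {s : Pt} {x y : PuncturedLine} (γ : Path x y)
    (hγ : ∀ t, γ t ∈ puncturedDisc s) :
    ((M.frame s (Piece.index y.1) * M.rep (winding (.mk γ)) * (M.frame s (Piece.index x.1))⁻¹ :
      M.bundle.slGroup) : M.bundle ≃ₗ[R] M.bundle) ∈ SLBundle.unipotent (M.line s) := by
  refine path_induction (D := puncturedDisc s) (V := fun i : {i // adjacent s i} => pieceSet i.1)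
    (fun i => isOpen_pieceSet i.1)
    (fun x hx => Set.mem_iUnion.2 ⟨⟨_, adjacent_index hx⟩, Piece.mem_index x.2⟩)
    (P := fun {x y} γ => ((M.frame s (Piece.index y.1) * M.rep (winding (.mk γ)) *
      (M.frame s (Piece.index x.1))⁻¹ : M.bundle.slGroup) : M.bundle ≃ₗ[R] M.bundle) ∈
      SLBundle.unipotent (M.line s)) (fun h hP => ?_)
    (fun {x y z γ γ'} h h' => ?_) (fun {x y} γ i hi hi' => ?_) γ hγ
  · rwa [← Path.Homotopic.Quotient.eq.2 h]
  · have := mul_mem h' h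
    rw [← Subgroup.coe_mul] at this
    convert! this using 2
    rw [Path.Homotopic.Quotient.mk_trans, winding_trans, map_mul]
    group
  · have hx : x ∈ puncturedDisc s := by simpa using hi 0
    have hy : y ∈ puncturedDisc s := by simpa using hi 1
    have hx' : x.1 ∈ i.1.set := by simpa [pieceSet] using hi' 0
    have hy' : y.1 ∈ i.1.set := by simpa [pieceSet] using hi' 1
    have := mul_mem (M.frame_change_mem (Piece.mem_index y.2) hy' (adjacent_index hy) i.2)
      (M.frame_change_mem hx' (Piece.mem_index x.2) i.2 (adjacent_index hx))
    rw [← Subgroup.coe_mul] at this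
    convert! this using 2
    rw [winding_piece γ i.1 hi', map_mul]
    group

theorem exists_unipotent {s : Pt} {x y : PuncturedLine} (γ : Path x y)
    (hγ : ∀ t, γ t ∈ puncturedDisc s) : ∃ h ∈ SLBundle.unipotent (M.line s), ∀ v,
      (M.frame s (Piece.index y.1)).1 (M.sys.transport γ v) =
        h ((M.frame s (Piece.index x.1)).1 v) := by
  refine ⟨_, M.frame_winding_mem γ hγ, fun v => ?_⟩
  have : M.frame s (Piece.index y.1) * M.rep (winding (.mk γ)) =
      (M.frame s (Piece.index y.1) * M.rep (winding (.mk γ)) * (M.frame s (Piece.index x.1))⁻¹) *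
        M.frame s (Piece.index x.1) := by group
  exact LinearEquiv.congr_fun (congr_arg Subtype.val this) v

/-- The Betti point with the given monodromy data. -/
def toBetti : BettiPoint R where
  sys := M.sys
  line s x := (M.line s).comap
    ((M.frame s (Piece.index x.1.1)).1 : M.bundle →ₗ[R] M.bundle)
  isLine s x := (M.isLine s).comap (M.frame s (Piece.index x.1.1)).1
  flat s x y γ hγ v hv := by
    obtain ⟨h, hh, e⟩ := M.exists_unipotent γ hγ
    change (M.frame s (Piece.index y.1.1)).1 (M.sys.transport γ v) ∈ M.line s
    have hv' : (M.frame s (Piece.index x.1.1)).1 v ∈ M.line s := hv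
    rwa [e, hh.1 _ hv']
  unipotent_sub s x γ hγ v hv := by
    obtain ⟨h, hh, e⟩ := M.exists_unipotent γ hγ
    have hv' : (M.frame s (Piece.index x.1.1)).1 v ∈ M.line s := hv
    exact (M.frame s (Piece.index x.1.1)).1.injective ((e v).trans (hh.1 _ hv'))
  unipotent_quot s x γ hγ v := by
    obtain ⟨h, hh, e⟩ := M.exists_unipotent γ hγ
    change (M.frame s (Piece.index x.1.1)).1 (M.sys.transport γ v - v) ∈ M.line s
    have := hh.2 ((M.frame s (Piece.index x.1.1)).1 v)
    rw [← e] at this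
    exact Eq.mpr (congrArg (· ∈ M.line s)
      (map_sub (M.frame s (Piece.index x.1.1)).1 (M.sys.transport γ v : M.bundle) v)) this

section Map

variable {R' : Type u} [CommRing R'] {M} {M' : StripData R'} {g : M.bundle →+ M'.bundle}

theorem map_inv_apply {a : M.bundle.slGroup} {a' : M'.bundle.slGroup}
    (h : ∀ v, g (a.1 v) = a'.1 (g v)) (v : M.bundle) : g ((a⁻¹).1 v) = (a'⁻¹).1 (g v) := by
  refine a'.1.injective ?_
  rw [← h]
  have e1 : a.1 ((a⁻¹).1 v) = v := LinearEquiv.congr_fun (congr_arg Subtype.val (mul_inv_cancel a)) v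
  have e2 : a'.1 ((a'⁻¹).1 (g v)) = g v :=
    LinearEquiv.congr_fun (congr_arg Subtype.val (mul_inv_cancel a')) (g v)
  rw [e1, e2]

variable (hτ : ∀ j v, g ((M.τ j).1 v) = (M'.τ j).1 (g v))

include hτ

theorem map_rep (w : FreeGroup Strip) : ∀ v, g ((M.rep w).1 v) = (M'.rep w).1 (g v) := by
  induction w using FreeGroup.induction_on with
  | C1 => intro v; rw [map_one, map_one]; rfl
  | of j => intro v; rw [rep_of, rep_of, hτ]
  | inv_of j _ => intro v; rw [map_inv, map_inv, rep_of, rep_of, map_inv_apply (hτ j)]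
  | mul a b ha hb =>
    intro v
    rw [map_mul, map_mul]
    exact (ha _).trans (congr_arg _ (hb v))

theorem map_frame (s : Pt) (i : Piece) (v : M.bundle) :
    g ((M.frame s i).1 v) = (M'.frame s i).1 (g v) := by
  rcases i with _ | _ | j
  · rfl
  · exact map_inv_apply (hτ _) v
  · rfl

end Map

end StripData

/-! ### Monodromy data of a point of the linearized moduli -/

/-- One half. -/
def half (R : Type u) [CommRing R] [Algebra ℚ R] : R := algebraMap ℚ R (1 / 2)

theorem half_add_half (R : Type u) [CommRing R] [Algebra ℚ R] : half R + half R = 1 := by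
  rw [half, ← map_add, ← map_one (algebraMap ℚ R)]
  norm_num

namespace CotangentPoint

variable {R : Type u} [CommRing R] (P : CotangentPoint R)

theorem B_B (s : Pt) (x : P.bundle) : P.B s (P.B s x) = 0 := P.B_line s _ (P.B_mem s x)

/-- Expand `(B_0 + B_1)² = B_∞² = 0`. -/
theorem B_zero_B_one (x : P.bundle) : P.B .one (P.B .zero x) = -P.B .zero (P.B .one x) := by
  have h := P.B_B .infty x
  simp only [B_infty, map_neg, map_add, B_B] at h
  simp only [zero_add, add_zero] at h
  rw [neg_add, neg_neg, neg_neg] at h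
  exact eq_neg_of_add_eq_zero_left h

variable [Algebra ℚ R]

/-- The automorphism `1 - B₀ / 2`. -/
def twist : P.bundle ≃ₗ[R] P.bundle :=
  SLBundle.oneAdd (-half R • P.B .zero) fun x => by simp [B_B]

theorem twist_apply (x : P.bundle) : P.twist x = x - half R • P.B .zero x := by
  rw [twist, SLBundle.oneAdd_apply, LinearMap.smul_apply, neg_smul, sub_eq_add_neg]

theorem twist_inv_apply (x : P.bundle) : P.twist⁻¹ x = x + half R • P.B .zero x := by
  rw [twist, SLBundle.oneAdd_inv_apply, LinearMap.smul_apply, neg_smul, sub_neg_eq_add]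

theorem twist_inv_twist (x : P.bundle) : P.twist⁻¹ (P.twist x) = x :=
  LinearEquiv.congr_fun (inv_mul_cancel P.twist) x

/-- The logarithm of the monodromy around `1`. -/
def logOne : P.bundle →ₗ[R] P.bundle :=
  P.twist.toLinearMap ∘ₗ P.B .one ∘ₗ (P.twist⁻¹).toLinearMap

theorem logOne_apply (x : P.bundle) : P.logOne x = P.twist (P.B .one (P.twist⁻¹ x)) := rfl

theorem logOne_logOne (x : P.bundle) : P.logOne (P.logOne x) = 0 := by
  rw [logOne_apply, logOne_apply, twist_inv_twist, B_B, map_zero]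

/-- In `(1 - B_0/2) B_1 (1 + B_0/2)`, anticommutation makes the two linear corrections equal and
kills `B_0 B_1 B_0`. -/
theorem logOne_eq (x : P.bundle) : P.logOne x = P.B .one x - P.B .zero (P.B .one x) := by
  rw [logOne_apply, twist_inv_apply, map_add, map_smul, B_zero_B_one, twist_apply]
  simp only [map_add, map_smul, map_neg, B_B, neg_zero, smul_zero, add_zero, smul_neg]
  have h : P.B .zero (P.B .one x) =
      half R • P.B .zero (P.B .one x) + half R • P.B .zero (P.B .one x) := by
    rw [← add_smul, half_add_half, one_smul]
  nth_rewrite 3 [h]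
  abel

/-- The lines of the monodromy data. -/
def stripLine : Pt → Submodule R P.bundle
  | .zero => P.line .zero
  | .one => (P.line .one).map (P.twist : P.bundle →ₗ[R] P.bundle)
  | .infty => P.line .infty

theorem isLine_stripLine : ∀ s, P.bundle.IsLine (P.stripLine s)
  | .zero => P.isLine .zero
  | .one => (P.isLine .one).map _
  | .infty => P.isLine .infty

theorem logOne_line (v : P.bundle) (hv : v ∈ P.stripLine .one) : P.logOne v = 0 := by
  obtain ⟨w, hw, rfl⟩ := Submodule.mem_map.1 hv
  change P.twist (P.B .one (P.twist⁻¹ (P.twist w))) = 0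
  rw [twist_inv_twist, P.B_line _ _ hw, map_zero]

theorem logOne_mem (v : P.bundle) : P.logOne v ∈ P.stripLine .one :=
  Submodule.mem_map.2 ⟨_, P.B_mem _ _, rfl⟩

theorem vol_logOne (x y : P.bundle) :
    P.bundle.vol (P.logOne x) y + P.bundle.vol x (P.logOne y) = 0 :=
  (P.isLine_stripLine .one).vol_map_add P.logOne_line P.logOne_mem x y

/-- The monodromy of the strips. -/
def stripMonodromy : Strip → P.bundle.slGroup
  | .left => ⟨SLBundle.oneAdd (-P.B .zero) fun x => by simp [B_B],
      SLBundle.oneAdd_mem_slGroup fun x y => by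
        have := P.vol_B .zero x y
        rw [LinearMap.neg_apply, LinearMap.neg_apply, ← neg_one_smul R, ← neg_one_smul R (P.B .zero y),
          SLBundle.vol_smul_left, SLBundle.vol_smul_right]
        linear_combination -this⟩
  | .mid => 1
  | .right => ⟨SLBundle.oneAdd P.logOne P.logOne_logOne, SLBundle.oneAdd_mem_slGroup P.vol_logOne⟩

theorem stripMonodromy_left_apply (x : P.bundle) :
    (P.stripMonodromy .left).1 x = x - P.B .zero x := (sub_eq_add_neg _ _).symm

theorem stripMonodromy_left_inv_apply (x : P.bundle) :
    ((P.stripMonodromy .left)⁻¹).1 x = x + P.B .zero x := sub_neg_eq_add x _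

theorem stripMonodromy_right_apply (x : P.bundle) :
    (P.stripMonodromy .right).1 x = x + P.logOne x := rfl

/-- The twist at `1` is chosen for this: `(1 + B_0)(1 + B_1 - B_0 B_1) = 1 + B_0 + B_1`, so the line
at `∞` needs no change. -/
theorem stripMonodromy_infty (x : P.bundle) :
    ((P.stripMonodromy .left)⁻¹ * P.stripMonodromy .right).1 x = x - P.B .infty x := by
  change ((P.stripMonodromy .left)⁻¹).1 ((P.stripMonodromy .right).1 x) = _
  rw [stripMonodromy_left_inv_apply, stripMonodromy_right_apply, logOne_eq, B_infty]
  simp only [map_add, map_sub, B_B]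
  abel

/-- The monodromy data. -/
def toStripData : StripData R where
  bundle := P.bundle
  τ := P.stripMonodromy
  line := P.stripLine
  isLine := P.isLine_stripLine
  mem_unipotent s := by
    cases s with
    | zero =>
      change ((1⁻¹ * P.stripMonodromy .left : P.bundle.slGroup) : P.bundle ≃ₗ[R] P.bundle) ∈ _
      rw [inv_one, one_mul]
      exact SLBundle.oneAdd_mem_unipotent (hN := fun x => by simp [B_B])
        (fun v hv => by rw [LinearMap.neg_apply, P.B_line _ _ hv, neg_zero])
        fun v => neg_mem (P.B_mem _ v)
    | one =>
      change (((P.stripMonodromy .right)⁻¹ * 1 : P.bundle.slGroup) : P.bundle ≃ₗ[R] P.bundle) ∈ _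
      rw [mul_one]
      exact inv_mem (SLBundle.oneAdd_mem_unipotent (hN := P.logOne_logOne) P.logOne_line P.logOne_mem)
    | infty =>
      refine ⟨fun v hv => ?_, fun v => ?_⟩
      · refine (P.stripMonodromy_infty v).trans ?_
        rw [P.B_line _ _ hv, sub_zero]
      · refine Eq.mpr (congrArg (fun w => w - v ∈ P.line .infty) (P.stripMonodromy_infty v)) ?_
        rw [sub_sub_cancel_left]
        exact neg_mem (P.B_mem _ v)

section Map

variable {R' : Type u} [CommRing R'] [Algebra ℚ R'] {P} {P' : CotangentPoint R'} {φ : R →ₐ[ℚ] R'}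
  {g : P.bundle →+ P'.bundle} (hg : IsCart φ.toRingHom P.bundle P'.bundle g)

include hg in
theorem map_half_smul (x : P.bundle) : g (half R • x) = half R' • g x := by
  rw [hg.map_smul]
  congr 1
  exact φ.commutes _

variable (hB : ∀ s v, g (P.B s v) = P'.B s (g v))

include hg hB in
theorem map_twist (x : P.bundle) : g (P.twist x) = P'.twist (g x) := by
  rw [twist_apply, twist_apply, map_sub, map_half_smul hg, hB]

include hB in
theorem map_logOne (x : P.bundle) : g (P.logOne x) = P'.logOne (g x) := by
  rw [logOne_eq, logOne_eq, map_sub, hB, hB, hB]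

include hB in
theorem map_stripMonodromy (j : Strip) (v : P.bundle) :
    g ((P.stripMonodromy j).1 v) = (P'.stripMonodromy j).1 (g v) := by
  cases j with
  | left => rw [stripMonodromy_left_apply, stripMonodromy_left_apply, map_sub, hB]
  | mid => rfl
  | right => rw [stripMonodromy_right_apply, stripMonodromy_right_apply, map_add, map_logOne hB]

include hg hB in
theorem map_stripLine (hline : ∀ s, ∀ v ∈ P.line s, g v ∈ P'.line s) (s : Pt) (v : P.bundle)
    (hv : v ∈ P.stripLine s) : g v ∈ P'.stripLine s := by
  cases s with
  | zero => exact hline _ v hv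
  | one =>
    obtain ⟨w, hw, rfl⟩ := Submodule.mem_map.1 hv
    exact Submodule.mem_map.2 ⟨g w, hline _ w hw, (map_twist hg hB w).symm⟩
  | infty => exact hline _ v hv

end Map

end CotangentPoint

namespace StripData

/-- The morphism of Betti points given by a morphism of monodromy data. -/
def hom {R R' : Type u} [CommRing R] [Algebra ℚ R] [CommRing R'] [Algebra ℚ R'] {M : StripData R}
    {M' : StripData R'} (φ : R →ₐ[ℚ] R') (g : M.bundle →+ M'.bundle)
    (hg : IsCart φ.toRingHom M.bundle M'.bundle g) (hτ : ∀ j v, g ((M.τ j).1 v) = (M'.τ j).1 (g v))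
    (hline : ∀ s, ∀ v ∈ M.line s, g v ∈ M'.line s) :
    Loc.Hom ⟨R, M.toBetti⟩ ⟨R', M'.toBetti⟩ where
  base := φ
  map _ := g
  cart _ := hg
  map_transport _ _ γ v := map_rep hτ _ v
  map_line s x v hv := by
    change (M'.frame s (Piece.index x.1.1)).1 (g v) ∈ M'.line s
    exact Eq.mp (congrArg (· ∈ M'.line s) (map_frame hτ s (Piece.index x.1.1) v)) (hline s _ hv)

end StripData

namespace Cotangent

/-- The functor from the linearized moduli to the Betti moduli. -/
def toLoc : Cotangent.{u} ⥤ Loc.{u} where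
  obj L := ⟨L.ring, L.pt.toStripData.toBetti⟩
  map {L L'} g := StripData.hom (M := L.pt.toStripData) (M' := L'.pt.toStripData) (Hom.base g)
    (Hom.map g) (Hom.cart g) (CotangentPoint.map_stripMonodromy (Hom.map_B g))
    (CotangentPoint.map_stripLine (Hom.cart g) (Hom.map_B g) (Hom.map_line g))
  map_id _ := rfl
  map_comp _ _ := rfl

/-- The functor to the Betti moduli is compatible with the maps to `BSL(2)`. -/
def toLocIso (u₀ : PuncturedLine) : toLoc.{u} ⋙ Loc.toBSL u₀ ≅ toBSL.{u} :=
  NatIso.ofComponents (fun L => Iso.refl (toBSL.obj L)) fun _ =>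
    (Category.comp_id _).trans (Category.id_comp _).symm

instance : toLoc.{u}.Faithful where
  map_injective e := Hom.ext (congr_arg Loc.Hom.base e)
    (congr_fun (congr_arg Loc.Hom.map e) ⟨-1, by norm_num⟩)

end Cotangent

theorem Loc.isIso_of_base {L L' : Loc.{u}} (F : L ⟶ L') (b : L'.ring →ₐ[ℚ] L.ring)
    (h : b.comp (Hom.base F) = AlgHom.id ℚ _) (h' : (Hom.base F).comp b = AlgHom.id ℚ _) :
    IsIso F := by
  have e : b.toRingHom.comp (Hom.base F).toRingHom = RingHom.id _ :=
    RingHom.ext fun x => DFunLike.congr_fun h x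
  have e' : (Hom.base F).toRingHom.comp b.toRingHom = RingHom.id _ :=
    RingHom.ext fun x => DFunLike.congr_fun h' x
  choose k ck k1 k2 using fun x => (Hom.cart F x).exists_inverse e e'
  let G : L' ⟶ L :=
    { base := b
      map := k
      cart := ck
      map_transport := fun x y γ v => by
        obtain ⟨v, rfl⟩ : ∃ w, Hom.map F x w = v := ⟨_, k2 x v⟩
        rw [← Hom.map_transport F, k1, k1]
      map_line := fun s x v hv => (Hom.cart F x).mem_line
        (Function.LeftInverse.injective (g := b) fun x => DFunLike.congr_fun h x)
        (L.pt.isLine s x) (L'.pt.isLine s x) (Hom.map_line F s x) (by rwa [k2]) }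
  exact ⟨G, Hom.ext h (funext fun x => AddMonoidHom.ext (k1 x)),
    Hom.ext h' (funext fun x => AddMonoidHom.ext (k2 x))⟩

/-! ### Paths in the punctured line -/

theorem exists_path_of_convex {K : Set ℂ} (hK : Convex ℝ K) (hK' : ∀ z ∈ K, z ≠ 0 ∧ z ≠ 1)
    {x y : PuncturedLine} (hx : x.1 ∈ K) (hy : y.1 ∈ K) : ∃ γ : Path x y, ∀ t, (γ t).1 ∈ K := by
  have h : ∀ t : unitInterval, AffineMap.lineMap x.1 y.1 (t : ℝ) ∈ K := fun t =>
    hK.lineMap_mem hx hy t.2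
  refine ⟨⟨⟨fun t => ⟨AffineMap.lineMap x.1 y.1 (t : ℝ), hK' _ (h t)⟩, ?_⟩, ?_, ?_⟩, h⟩
  · refine Continuous.subtype_mk ?_ _
    exact AffineMap.lineMap_continuous.comp continuous_subtype_val
  · exact Subtype.ext (by simp)
  · exact Subtype.ext (by simp)

theorem homotopic_of_convex {K : Set ℂ} (hK : Convex ℝ K) (hK' : ∀ z ∈ K, z ≠ 0 ∧ z ≠ 1)
    {x y : PuncturedLine} (γ γ' : Path x y) (h : ∀ t, (γ t).1 ∈ K) (h' : ∀ t, (γ' t).1 ∈ K) :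
    γ.Homotopic γ' := by
  have hm : ∀ p : unitInterval × unitInterval,
      AffineMap.lineMap (γ p.2).1 (γ' p.2).1 (p.1 : ℝ) ∈ K := fun p =>
    hK.lineMap_mem (h _) (h' _) p.1.2
  refine ⟨⟨⟨⟨fun p => ⟨AffineMap.lineMap (γ p.2).1 (γ' p.2).1 (p.1 : ℝ), hK' _ (hm p)⟩, ?_⟩, ?_, ?_⟩,
    ?_⟩⟩
  · refine Continuous.subtype_mk ?_ _
    simp only [AffineMap.lineMap_apply_module]
    fun_prop
  · intro t
    exact Subtype.ext (by simp)
  · intro t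
    exact Subtype.ext (by simp)
  · rintro t _ (rfl | rfl)
    · exact Subtype.ext (by simp)
    · exact Subtype.ext (by simp)

theorem exists_path_of_piece {i : Piece} {x y : PuncturedLine} (hx : x.1 ∈ i.set)
    (hy : y.1 ∈ i.set) : ∃ γ : Path x y, ∀ t, γ t ∈ pieceSet i :=
  exists_path_of_convex i.convex_set (fun _ => Piece.ne_of_mem) hx hy

/-! ### Standard paths -/

/-- A path in a piece. -/
def piecePath (i : Piece) {x y : PuncturedLine} (hx : x.1 ∈ i.set) (hy : y.1 ∈ i.set) : Path x y :=
  (exists_path_of_piece hx hy).choose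

theorem piecePath_mem (i : Piece) {x y : PuncturedLine} (hx : x.1 ∈ i.set) (hy : y.1 ∈ i.set)
    (t : unitInterval) : piecePath i hx hy t ∈ pieceSet i :=
  (exists_path_of_piece hx hy).choose_spec t

/-- The real part of the base points of a strip. -/
def Strip.center : Strip → ℝ
  | .left => -1
  | .mid => 1 / 2
  | .right => 2

/-- A base point of the upper half plane. -/
def basePoint : PuncturedLine := ⟨Complex.I, Piece.ne_of_mem (i := .up) (by simp [Piece.set])⟩

theorem basePoint_mem : basePoint.1 ∈ Piece.up.set := by simp [basePoint, Piece.set]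

theorem mk_center_mem (j : Strip) (b : ℝ) : (⟨j.center, b⟩ : ℂ) ∈ (Piece.strip j).set := by
  cases j <;> norm_num [Piece.set, Strip.set, Strip.center]

/-- A point of a strip in the upper half plane. -/
def Strip.above (j : Strip) : PuncturedLine :=
  ⟨⟨j.center, 1⟩, Piece.ne_of_mem (mk_center_mem j 1)⟩

/-- A point of a strip in the lower half plane. -/
def Strip.below (j : Strip) : PuncturedLine :=
  ⟨⟨j.center, -1⟩, Piece.ne_of_mem (mk_center_mem j (-1))⟩

theorem Strip.above_mem (j : Strip) : j.above.1 ∈ (Piece.strip j).set := mk_center_mem j 1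

theorem Strip.below_mem (j : Strip) : j.below.1 ∈ (Piece.strip j).set := mk_center_mem j (-1)

theorem Strip.above_mem_up (j : Strip) : j.above.1 ∈ Piece.up.set := one_pos (α := ℝ)

theorem Strip.below_mem_low (j : Strip) : j.below.1 ∈ Piece.low.set := neg_one_lt_zero (R := ℝ)

/-- The point where the paths from the base point enter a piece. -/
def Piece.entry : Piece → PuncturedLine
  | .up => basePoint
  | .low => Strip.mid.below
  | .strip j => j.above

theorem Piece.entry_mem : ∀ i : Piece, i.entry.1 ∈ i.set
  | .up => basePoint_mem
  | .low => Strip.mid.below_mem_low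
  | .strip j => j.above_mem

/-- The path from the base point to the entry of a piece. -/
def entryPath : ∀ i : Piece, Path basePoint i.entry
  | .up => .refl _
  | .strip j => piecePath .up basePoint_mem j.above_mem_up
  | .low => (piecePath .up basePoint_mem Strip.mid.above_mem_up).trans
      (piecePath (.strip .mid) Strip.mid.above_mem Strip.mid.below_mem)

/-- The path from the base point to a point of a piece. -/
def access (i : Piece) {x : PuncturedLine} (hx : x.1 ∈ i.set) : Path basePoint x :=
  (entryPath i).trans (piecePath i i.entry_mem hx)

theorem winding_piecePath (i : Piece) {x y : PuncturedLine} (hx : x.1 ∈ i.set) (hy : y.1 ∈ i.set) :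
    winding (.mk (piecePath i hx hy)) =
      Piece.change i (Piece.index y.1) * Piece.change (Piece.index x.1) i :=
  winding_piece _ i (piecePath_mem i hx hy)

theorem index_above (j : Strip) : Piece.index j.above.1 = .up := Piece.index_of_pos j.above_mem_up

theorem index_below (j : Strip) : Piece.index j.below.1 = .low :=
  Piece.index_of_neg j.below_mem_low

theorem index_basePoint : Piece.index basePoint.1 = .up := Piece.index_of_pos basePoint_mem

/-- The universal monodromy of the path to the entry of a piece. -/
def entryWinding : Piece → FreeGroup Strip
  | .low => .of .mid
  | _ => 1

theorem winding_entryPath : ∀ i : Piece, winding (.mk (entryPath i)) = entryWinding i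
  | .up => winding_refl _
  | .strip j => by
    change winding (.mk (piecePath .up basePoint_mem j.above_mem_up)) = 1
    rw [winding_piecePath, index_above, index_basePoint]
    rfl
  | .low => by
    change winding (.mk ((piecePath .up basePoint_mem Strip.mid.above_mem_up).trans
      (piecePath (.strip .mid) Strip.mid.above_mem Strip.mid.below_mem))) = _
    rw [Path.Homotopic.Quotient.mk_trans, winding_trans, winding_piecePath, winding_piecePath,
      index_basePoint, index_above, index_below]
    simp [Piece.change, entryWinding]

theorem winding_access (i : Piece) {x : PuncturedLine} (hx : x.1 ∈ i.set) :
    winding (.mk (access i hx)) = Piece.change i (Piece.index x.1) * entryWinding i := by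
  rw [access, Path.Homotopic.Quotient.mk_trans, winding_trans, winding_entryPath, winding_piecePath]
  congr 1
  have : Piece.change (Piece.index i.entry.1) i = 1 := by
    rcases i with _ | _ | j
    · rw [Piece.entry, index_basePoint]; rfl
    · rw [Piece.entry, index_below]; rfl
    · rw [Piece.entry, index_above]; rfl
  rw [this, mul_one]

namespace StripData

variable {R R' : Type u} [CommRing R] [CommRing R'] {M : StripData R} {M' : StripData R'}

/-- The standard path to a point enters the lower half plane through the middle strip only, so the
normalization makes its transport trivial. -/
theorem rep_winding_access (hM : M.τ .mid = 1) (x : PuncturedLine) :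
    M.rep (winding (.mk (access _ (Piece.mem_index x.2)))) = 1 := by
  rw [winding_access, Piece.change_self, one_mul]
  rcases Piece.index x.1 with _ | _ | _
  · exact map_one _
  · exact (M.rep_of _).trans hM
  · exact map_one _

/-- This path enters the lower half plane through the strip `j`, and so recovers its automorphism
from the local system. -/
theorem rep_winding_below (M : StripData R) (j : Strip) :
    M.rep (winding (.mk (access (.strip j) j.below_mem))) = M.τ j := by
  rw [winding_access, index_below]
  simp [Piece.change, entryWinding, rep_of]

/-! ### Morphisms between the local systems given by monodromy data -/

variable [Algebra ℚ R] [Algebra ℚ R'] (F : Loc.Hom ⟨R, M.toBetti⟩ ⟨R', M'.toBetti⟩)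

/-- The homomorphism between the fibres at a point. -/
def homMap (x : PuncturedLine) : M.bundle →+ M'.bundle := F.map x

theorem homMap_rep {x y : PuncturedLine} (γ : Path x y) (v : M.bundle) :
    homMap F y ((M.rep (winding (.mk γ))).1 v) = (M'.rep (winding (.mk γ))).1 (homMap F x v) :=
  F.map_transport x y γ v

variable (hM : M.τ .mid = 1) (hM' : M'.τ .mid = 1)

include hM hM'

theorem homMap_eq (x : PuncturedLine) : homMap F x = homMap F basePoint :=
  AddMonoidHom.ext fun v => by
    have h := homMap_rep F (access _ (Piece.mem_index x.2)) v
    rwa [rep_winding_access hM, rep_winding_access hM'] at h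

theorem homMap_τ (j : Strip) (v : M.bundle) :
    homMap F basePoint ((M.τ j).1 v) = (M'.τ j).1 (homMap F basePoint v) := by
  have h := homMap_rep F (access (.strip j) j.below_mem) v
  rwa [rep_winding_below, rep_winding_below, homMap_eq F hM hM'] at h

end StripData

/-! ### Paths in the punctured discs -/

/-- A parametrization of the punctured discs by the left half plane. -/
def discMap : Pt → {w : ℂ // w.re < 0} → PuncturedLine
  | .zero => fun w => ⟨Complex.exp w, Complex.exp_ne_zero _, fun h => by
      have := congr_arg norm h
      rw [Complex.norm_exp, norm_one, Real.exp_eq_one_iff] at this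
      exact w.2.ne this⟩
  | .one => fun w => ⟨1 + Complex.exp w, fun h => by
      have := congr_arg norm (eq_neg_of_add_eq_zero_right h)
      rw [Complex.norm_exp, norm_neg, norm_one, Real.exp_eq_one_iff] at this
      exact w.2.ne this, fun h => Complex.exp_ne_zero _ (add_eq_left.1 h)⟩
  | .infty => fun w => ⟨Complex.exp (-w), Complex.exp_ne_zero _, fun h => by
      have := congr_arg norm h
      rw [Complex.norm_exp, norm_one, Real.exp_eq_one_iff, Complex.neg_re, neg_eq_zero] at this
      exact w.2.ne this⟩

theorem continuous_discMap (s : Pt) : Continuous (discMap s) := by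
  cases s <;> refine Continuous.subtype_mk ?_ _ <;> fun_prop

theorem range_discMap (s : Pt) : Set.range (discMap s) = puncturedDisc s := by
  have hlog : ∀ z : ℂ, z ≠ 0 → ‖z‖ < 1 → (Complex.log z).re < 0 := fun z h0 h1 => by
    rw [Complex.log_re]; exact Real.log_neg (norm_pos_iff.2 h0) h1
  ext ⟨z, hz⟩
  constructor
  · rintro ⟨w, hw⟩
    rw [← hw]
    have hw' := w.2
    cases s <;> simp only [discMap, puncturedDisc, Set.mem_ofPred_eq]
    · rw [Complex.norm_exp]; exact Real.exp_lt_one_iff.2 hw'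
    · rw [add_sub_cancel_left, Complex.norm_exp]; exact Real.exp_lt_one_iff.2 hw'
    · rw [Complex.norm_exp]; exact Real.one_lt_exp_iff.2 (by simpa using hw')
  · intro h
    cases s <;> simp only [puncturedDisc, Set.mem_ofPred_eq] at h
    · exact ⟨⟨_, hlog z hz.1 h⟩, Subtype.ext (Complex.exp_log hz.1)⟩
    · have h0 : z - 1 ≠ 0 := sub_ne_zero.2 hz.2
      refine ⟨⟨_, hlog _ h0 h⟩, Subtype.ext ?_⟩
      simp only [discMap]
      rw [Complex.exp_log h0, add_sub_cancel]
    · have h0 : z⁻¹ ≠ 0 := inv_ne_zero hz.1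
      refine ⟨⟨_, hlog _ h0 (by rw [norm_inv]; exact inv_lt_one_of_one_lt₀ h)⟩, Subtype.ext ?_⟩
      simp only [discMap]
      rw [Complex.exp_neg, Complex.exp_log h0, inv_inv]

theorem exists_path_of_disc {s : Pt} {x y : PuncturedLine} (hx : x ∈ puncturedDisc s)
    (hy : y ∈ puncturedDisc s) : ∃ γ : Path x y, ∀ t, γ t ∈ puncturedDisc s := by
  have h : IsPathConnected (puncturedDisc s) := by
    have : PathConnectedSpace {w : ℂ // w.re < 0} := isPathConnected_iff_pathConnectedSpace.1
      ((convex_halfSpace_re_lt 0).isPathConnected ⟨-1, by simp⟩)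
    rw [← range_discMap]
    exact isPathConnected_range (continuous_discMap s)
  exact h.joinedIn x hx y hy

/-- Convex sets which cover a neighbourhood of the boundary of the punctured discs. -/
def corner : Pt → Piece → Set ℂ
  | .zero, i => i.set ∩ Metric.ball 0 1
  | .one, i => i.set ∩ Metric.ball 1 1
  -- The outside of a disc is not convex, so half planes away from the unit disc are used at `∞`.
  -- The middle strip is not adjacent to `∞` and gets the empty set.
  | .infty, .up => {z | 1 < z.im}
  | .infty, .low => {z | z.im < -1}
  | .infty, .strip .left => {z | z.re < -1}
  | .infty, .strip .mid => ∅
  | .infty, .strip .right => {z | 1 < z.re}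

theorem convex_corner (s : Pt) (i : Piece) : Convex ℝ (corner s i) := by
  rcases s with _ | _ | _
  · exact i.convex_set.inter (convex_ball _ _)
  · exact i.convex_set.inter (convex_ball _ _)
  · rcases i with _ | _ | _ | _ | _
    · exact convex_halfSpace_im_gt 1
    · exact convex_halfSpace_im_lt (-1)
    · exact convex_halfSpace_re_lt (-1)
    · exact convex_empty
    · exact convex_halfSpace_re_gt 1

theorem corner_subset (s : Pt) (i : Piece) : corner s i ⊆ i.set := by
  rcases s with _ | _ | _
  · exact Set.inter_subset_left
  · exact Set.inter_subset_left
  · rcases i with _ | _ | _ | _ | _ <;> intro z hz <;>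
      simp only [corner, Piece.set, Strip.set, Set.mem_ofPred_eq, Set.mem_empty_iff_false] at hz ⊢ <;>
      linarith

theorem mem_puncturedDisc_of_corner {s : Pt} {i : Piece} {x : PuncturedLine}
    (hx : x.1 ∈ corner s i) : x ∈ puncturedDisc s := by
  rcases s with _ | _ | _
  · exact mem_ball_zero_iff.1 hx.2
  · exact mem_ball_iff_norm.1 hx.2
  · have h1 := Complex.abs_re_le_norm x.1
    have h2 := Complex.abs_im_le_norm x.1
    have h3 := le_abs_self x.1.re
    have h4 := neg_le_abs x.1.re
    have h5 := le_abs_self x.1.im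
    have h6 := neg_le_abs x.1.im
    rcases i with _ | _ | _ | _ | _ <;>
      simp only [corner, Set.mem_ofPred_eq, Set.mem_empty_iff_false, puncturedDisc] at hx ⊢ <;>
      linarith

theorem exists_path_of_corner {s : Pt} (i : Piece) {x y : PuncturedLine} (hx : x.1 ∈ corner s i)
    (hy : y.1 ∈ corner s i) : ∃ γ : Path x y, (∀ t, γ t ∈ puncturedDisc s) ∧
      winding (.mk γ) = Piece.change i (Piece.index y.1) * Piece.change (Piece.index x.1) i := by
  obtain ⟨γ, hγ⟩ := exists_path_of_convex (convex_corner s i)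
    (fun z hz => Piece.ne_of_mem (corner_subset s i hz)) hx hy
  exact ⟨γ, fun t => mem_puncturedDisc_of_corner (hγ t),
    winding_piece γ i fun t => corner_subset s i (hγ t)⟩

theorem exists_mem_corner (s : Pt) :
    (∃ z, z ∈ corner s .up ∧ z ∈ corner s (.strip s.rightStrip)) ∧
    (∃ z, z ∈ corner s .up ∧ z ∈ corner s (.strip s.leftStrip)) ∧
    (∃ z, z ∈ corner s .low ∧ z ∈ corner s (.strip s.leftStrip)) ∧
    ∃ z, z ∈ corner s .low ∧ z ∈ corner s (.strip s.rightStrip) := by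
  have hn : ∀ a b : ℝ, |a| < 2 / 3 → |b| < 1 / 3 → ‖(⟨a, b⟩ : ℂ)‖ < 1 := fun a b ha hb => by
    have := Complex.norm_le_abs_re_add_abs_im ⟨a, b⟩
    simp only at this
    linarith
  have h1 : |(1 / 2 : ℝ)| < 2 / 3 := by norm_num [abs_of_pos]
  have h1' : |(-(1 / 2) : ℝ)| < 2 / 3 := by norm_num [abs_of_pos]
  have h2 : |(1 / 4 : ℝ)| < 1 / 3 := by norm_num [abs_of_pos]
  have h2' : |(-(1 / 4) : ℝ)| < 1 / 3 := by norm_num [abs_of_pos]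
  have hc : ∀ a b : ℝ, ‖(⟨a - 1, b⟩ : ℂ)‖ < 1 → ‖(⟨a, b⟩ : ℂ) - 1‖ < 1 := fun a b h => by
    convert h using 2
    apply Complex.ext <;> simp
  rcases s with _ | _ | _
  · refine ⟨⟨⟨1 / 2, 1 / 4⟩, ?_⟩, ⟨⟨-(1 / 2), 1 / 4⟩, ?_⟩, ⟨⟨-(1 / 2), -(1 / 4)⟩, ?_⟩,
      ⟨⟨1 / 2, -(1 / 4)⟩, ?_⟩⟩ <;>
      simp only [corner, Pt.rightStrip, Pt.leftStrip, Set.mem_inter_iff, mem_ball_zero_iff,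
        Piece.set, Strip.set, Set.mem_ofPred_eq] <;>
      refine ⟨⟨?_, hn _ _ (by assumption) (by assumption)⟩, ?_, hn _ _ (by assumption) (by assumption)⟩ <;>
      norm_num
  · refine ⟨⟨⟨3 / 2, 1 / 4⟩, ?_⟩, ⟨⟨1 / 2, 1 / 4⟩, ?_⟩, ⟨⟨1 / 2, -(1 / 4)⟩, ?_⟩,
      ⟨⟨3 / 2, -(1 / 4)⟩, ?_⟩⟩ <;>
      simp only [corner, Pt.rightStrip, Pt.leftStrip, Set.mem_inter_iff, Metric.mem_ball,
        dist_eq_norm, Piece.set, Strip.set, Set.mem_ofPred_eq] <;>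
      refine ⟨⟨?_, hc _ _ (hn _ _ ?_ (by assumption))⟩, ?_, hc _ _ (hn _ _ ?_ (by assumption))⟩ <;>
      norm_num [abs_of_pos]
  · refine ⟨⟨⟨-2, 2⟩, ?_⟩, ⟨⟨2, 2⟩, ?_⟩, ⟨⟨2, -2⟩, ?_⟩, ⟨⟨-2, -2⟩, ?_⟩⟩ <;>
      simp only [corner, Pt.rightStrip, Pt.leftStrip, Set.mem_ofPred_eq] <;> norm_num

/-- The loop crosses the upper half plane, goes down the left strip, crosses the lower half plane
and returns up the right strip. Only the two crossings between strips and the lower half plane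
contribute. -/
theorem exists_loop (s : Pt) : ∃ (x : puncturedDisc s) (γ : Path x.1 x.1),
    (∀ t, γ t ∈ puncturedDisc s) ∧ x.1.1 ∈ Piece.up.set ∧
      winding (.mk γ) = (.of s.rightStrip)⁻¹ * .of s.leftStrip := by
  obtain ⟨⟨z₁, u₁, r₁⟩, ⟨z₂, u₂, r₂⟩, ⟨z₃, u₃, r₃⟩, ⟨z₄, u₄, r₄⟩⟩ := exists_mem_corner s
  let x₁ : PuncturedLine := ⟨z₁, Piece.ne_of_mem (corner_subset _ _ u₁)⟩
  let x₂ : PuncturedLine := ⟨z₂, Piece.ne_of_mem (corner_subset _ _ u₂)⟩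
  let x₃ : PuncturedLine := ⟨z₃, Piece.ne_of_mem (corner_subset _ _ u₃)⟩
  let x₄ : PuncturedLine := ⟨z₄, Piece.ne_of_mem (corner_subset _ _ u₄)⟩
  obtain ⟨γ₁, m₁, w₁⟩ := exists_path_of_corner .up (x := x₁) (y := x₂) u₁ u₂
  obtain ⟨γ₂, m₂, w₂⟩ := exists_path_of_corner (.strip s.leftStrip) (x := x₂) (y := x₃) r₂ r₃
  obtain ⟨γ₃, m₃, w₃⟩ := exists_path_of_corner .low (x := x₃) (y := x₄) u₃ u₄
  obtain ⟨γ₄, m₄, w₄⟩ := exists_path_of_corner (.strip s.rightStrip) (x := x₄) (y := x₁) r₄ r₁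
  have i₁ : Piece.index x₁.1 = .up := Piece.index_of_pos (corner_subset _ _ u₁)
  have i₂ : Piece.index x₂.1 = .up := Piece.index_of_pos (corner_subset _ _ u₂)
  have i₃ : Piece.index x₃.1 = .low := Piece.index_of_neg (corner_subset _ _ u₃)
  have i₄ : Piece.index x₄.1 = .low := Piece.index_of_neg (corner_subset _ _ u₄)
  refine ⟨⟨x₁, mem_puncturedDisc_of_corner u₁⟩, ((γ₁.trans γ₂).trans γ₃).trans γ₄, fun t => ?_,
    corner_subset _ _ u₁, ?_⟩
  · have h : Set.range (((γ₁.trans γ₂).trans γ₃).trans γ₄) ⊆ puncturedDisc s := by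
      simp only [Path.trans_range, Set.union_subset_iff, Set.range_subset_iff]
      exact ⟨⟨⟨m₁, m₂⟩, m₃⟩, m₄⟩
    exact h ⟨t, rfl⟩
  · simp only [Path.Homotopic.Quotient.mk_trans, winding_trans, w₁, w₂, w₃, w₄, i₁, i₂, i₃, i₄,
      Piece.change, mul_one, one_mul]

/-! ### The functor to the Betti moduli is full -/

namespace StripData

variable {R R' : Type u} [CommRing R] [CommRing R'] {M : StripData R} {M' : StripData R'}

theorem mem_toBetti_line {s : Pt} {x : puncturedDisc s} (hx : x.1.1 ∈ Piece.up.set)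
    (v : M.bundle) : v ∈ M.toBetti.line s x ↔ v ∈ M.line s := by
  change (M.frame s (Piece.index x.1.1)).1 v ∈ M.line s ↔ _
  rw [Piece.index_of_pos hx]
  rfl

theorem homMap_line [Algebra ℚ R] [Algebra ℚ R'] (F : Loc.Hom ⟨R, M.toBetti⟩ ⟨R', M'.toBetti⟩)
    (hM : M.τ .mid = 1) (hM' : M'.τ .mid = 1) (s : Pt) (v : M.bundle) (hv : v ∈ M.line s) :
    homMap F basePoint v ∈ M'.line s := by
  obtain ⟨x, -, -, hx, -⟩ := exists_loop s
  have h : homMap F x.1 v ∈ M'.line s :=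
    (mem_toBetti_line hx _).1 (F.map_line s x v ((mem_toBetti_line hx v).2 hv))
  rwa [homMap_eq F hM hM'] at h

end StripData

namespace CotangentPoint

theorem B_one_eq {R : Type u} [CommRing R] [Algebra ℚ R] (P : CotangentPoint R) (x : P.bundle) :
    P.B .one x = P.logOne x + P.B .zero (P.logOne x) := by
  rw [logOne_eq, map_sub, B_B, sub_zero, sub_add_cancel]

/-- The endomorphisms are polynomials in the monodromy: `B_0 = 1 - τ_left`, and `B_1 = n + B_0 n`
with `n = τ_right - 1`. -/
theorem map_B_of_stripMonodromy {R R' : Type u} [CommRing R] [Algebra ℚ R] [CommRing R']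
    [Algebra ℚ R'] {P : CotangentPoint R} {P' : CotangentPoint R'} {g : P.bundle →+ P'.bundle}
    (h : ∀ j v, g ((P.stripMonodromy j).1 v) = (P'.stripMonodromy j).1 (g v)) :
    ∀ s v, g (P.B s v) = P'.B s (g v) := by
  have h0 : ∀ v, g (P.B .zero v) = P'.B .zero (g v) := fun v => by
    have := h .left v
    rwa [stripMonodromy_left_apply, stripMonodromy_left_apply, map_sub, sub_right_inj] at this
  have hN : ∀ v, g (P.logOne v) = P'.logOne (g v) := fun v => by
    have := h .right v
    rwa [stripMonodromy_right_apply, stripMonodromy_right_apply, map_add, add_right_inj] at this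
  have h1 : ∀ v, g (P.B .one v) = P'.B .one (g v) := fun v => by
    rw [B_one_eq, B_one_eq, map_add, h0, hN]
  intro s v
  cases s with
  | zero => exact h0 v
  | one => exact h1 v
  | infty => rw [B_infty, B_infty, map_neg, map_add, h0, h1]

end CotangentPoint

/-- A morphism of these local systems is constant, as all standard paths have trivial transport, and
commutes with the strip automorphisms. The twist at `1` is built from `B_0`, so it commutes with the
morphism and the line at `1` is carried back. -/
instance : Cotangent.toLoc.{u}.Full where
  map_surjective {L L'} F := by
    let g : L.pt.bundle →+ L'.pt.bundle :=
      StripData.homMap (M := L.pt.toStripData) (M' := L'.pt.toStripData) F basePoint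
    have hcart : IsCart (Loc.Hom.base F).toRingHom L.pt.bundle L'.pt.bundle g :=
      Loc.Hom.cart F basePoint
    have hB : ∀ s v, g (L.pt.B s v) = L'.pt.B s (g v) := CotangentPoint.map_B_of_stripMonodromy
      (StripData.homMap_τ (M := L.pt.toStripData) (M' := L'.pt.toStripData) F rfl rfl)
    have hline : ∀ s, ∀ v ∈ L.pt.stripLine s, g v ∈ L'.pt.stripLine s :=
      StripData.homMap_line (M := L.pt.toStripData) (M' := L'.pt.toStripData) F rfl rfl
    let G : L ⟶ L' :=
      { base := Loc.Hom.base F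
        map := g
        cart := hcart
        map_line := fun s v hv => by
          cases s with
          | zero => exact hline .zero v hv
          | one =>
            have h := hline .one (L.pt.twist v) (Submodule.mem_map_of_mem hv)
            obtain ⟨w, hw, e⟩ := Submodule.mem_map.1 h
            replace e := e.trans (CotangentPoint.map_twist hcart hB v)
            exact L'.pt.twist.injective e ▸ hw
          | infty => exact hline .infty v hv
        map_B := hB }
    exact ⟨G, Loc.Hom.ext rfl (funext fun x =>
      (StripData.homMap_eq (M := L.pt.toStripData) (M' := L'.pt.toStripData) F rfl rfl x).symm)⟩

/-! ### The monodromy data of a Betti point -/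

namespace LocalSystem

variable {R : Type u} [CommRing R] (L : LocalSystem R)

theorem transport_vol {x y : PuncturedLine} (γ : Path x y) (v w : L.fib x) :
    (L.fib y).vol (L.transport γ v) (L.transport γ w) = (L.fib x).vol v w :=
  (L.map (FundamentalGroupoid.fromPath (Path.Homotopic.Quotient.mk γ))).2 v w

theorem transport_refl (x : PuncturedLine) (v : L.fib x) : L.transport (.refl x) v = v := by
  have h : L.map (FundamentalGroupoid.fromPath (.mk (.refl x))) = 𝟙 _ := L.map_id ⟨x⟩
  exact LinearEquiv.congr_fun (congr_arg Subtype.val h) v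

theorem transport_trans {x y z : PuncturedLine} (γ : Path x y) (γ' : Path y z) (v : L.fib x) :
    L.transport (γ.trans γ') v = L.transport γ' (L.transport γ v) := by
  have h : L.map (FundamentalGroupoid.fromPath (.mk (γ.trans γ'))) =
      L.map (FundamentalGroupoid.fromPath (.mk γ)) ≫ L.map (FundamentalGroupoid.fromPath (.mk γ')) :=
    L.map_comp (X := ⟨x⟩) (Y := ⟨y⟩) (Z := ⟨z⟩) (FundamentalGroupoid.fromPath (.mk γ))
      (FundamentalGroupoid.fromPath (.mk γ'))
  exact LinearEquiv.congr_fun (congr_arg Subtype.val h) v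

theorem transport_congr {x y : PuncturedLine} {γ γ' : Path x y} (h : γ.Homotopic γ') :
    L.transport γ = L.transport γ' := by
  rw [transport, transport, Path.Homotopic.Quotient.eq.2 h]

theorem transport_eq_of_piece (i : Piece) {x y : PuncturedLine} {γ γ' : Path x y}
    (h : ∀ t, γ t ∈ pieceSet i) (h' : ∀ t, γ' t ∈ pieceSet i) : L.transport γ = L.transport γ' :=
  L.transport_congr (homotopic_of_convex i.convex_set (fun _ => Piece.ne_of_mem) γ γ' h h')

theorem transport_piece_self (i : Piece) {x : PuncturedLine} {γ : Path x x}
    (h : ∀ t, γ t ∈ pieceSet i) (v : L.fib x) : L.transport γ v = v := by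
  rw [L.transport_eq_of_piece i (γ' := .refl x) h fun t => by simpa using h 0, transport_refl]

/-- The trivialization of the local system over a piece. -/
def chart (i : Piece) {x : PuncturedLine} (hx : x.1 ∈ i.set) : L.fib basePoint ≃ₗ[R] L.fib x :=
  L.transport (access i hx)

theorem transport_chart {i : Piece} {x y : PuncturedLine} (hx : x.1 ∈ i.set) (hy : y.1 ∈ i.set)
    (γ : Path x y) (hγ : ∀ t, γ t ∈ pieceSet i) (v : L.fib basePoint) :
    L.transport γ (L.chart i hx v) = L.chart i hy v := by
  rw [chart, chart, access, access, transport_trans, transport_trans, ← transport_trans]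
  refine LinearEquiv.congr_fun (L.transport_eq_of_piece i (fun t => ?_) (piecePath_mem i _ _)) _
  have h : Set.range ((piecePath i i.entry_mem hx).trans γ) ⊆ pieceSet i := by
    rw [Path.trans_range, Set.union_subset_iff, Set.range_subset_iff, Set.range_subset_iff]
    exact ⟨piecePath_mem i _ _, hγ⟩
  exact h ⟨t, rfl⟩

theorem chart_entry (i : Piece) (v : L.fib basePoint) :
    L.chart i i.entry_mem v = L.transport (entryPath i) v := by
  rw [chart, access, transport_trans]
  exact L.transport_piece_self i (piecePath_mem i _ _) _

/-- Two pieces meet in a convex set, so a comparison of their trivializations at one point holds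
throughout. -/
theorem chart_eq_of_chart_eq {i k : Piece} {x y : PuncturedLine} (hi : x.1 ∈ i.set)
    (hk : x.1 ∈ k.set) (hi' : y.1 ∈ i.set) (hk' : y.1 ∈ k.set) {v w : L.fib basePoint}
    (h : L.chart i hi v = L.chart k hk w) : L.chart i hi' v = L.chart k hk' w := by
  obtain ⟨γ, hγ⟩ := exists_path_of_convex (i.convex_set.inter k.convex_set)
    (fun _ h => Piece.ne_of_mem h.1) (x := x) (y := y) ⟨hi, hk⟩ ⟨hi', hk'⟩
  rw [← L.transport_chart hi hi' γ fun t => (hγ t).1, h, L.transport_chart hk hk' γ fun t => (hγ t).2]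

/-- The monodromy of a strip. -/
def stripMonodromy (j : Strip) : (L.fib basePoint).slGroup :=
  ⟨(L.chart (.strip j) j.below_mem).trans (L.chart .low j.below_mem_low).symm, fun v w => by
    rw [← L.transport_vol (access .low j.below_mem_low)]
    change (L.fib j.below).vol (L.chart .low j.below_mem_low ((L.chart .low j.below_mem_low).symm _))
      (L.chart .low j.below_mem_low ((L.chart .low j.below_mem_low).symm _)) = _
    rw [LinearEquiv.apply_symm_apply, LinearEquiv.apply_symm_apply]
    exact L.transport_vol _ _ _⟩

theorem chart_stripMonodromy (j : Strip) (v : L.fib basePoint) :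
    L.chart .low j.below_mem_low ((L.stripMonodromy j).1 v) = L.chart (.strip j) j.below_mem v :=
  LinearEquiv.apply_symm_apply _ _

/-- The lower half plane is trivialized by the path through the middle strip, so no monodromy is
left there. -/
theorem stripMonodromy_mid : L.stripMonodromy .mid = 1 := by
  refine Subtype.ext (LinearEquiv.ext fun v => (L.chart .low Strip.mid.below_mem_low).injective ?_)
  rw [chart_stripMonodromy]
  exact (L.chart_entry .low v).symm

/-- The monodromy representation. -/
def rep : FreeGroup Strip →* (L.fib basePoint).slGroup := FreeGroup.lift L.stripMonodromy

/-- The trivializations are glued like the universal local system: strips agree with the upper half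
plane by the choice of paths, and differ from the lower one by the strip automorphisms. -/
theorem chart_change {i k : Piece} {x : PuncturedLine} (hi : x.1 ∈ i.set) (hk : x.1 ∈ k.set)
    (v : L.fib basePoint) : L.chart i hi ((L.rep (Piece.change k i)).1 v) = L.chart k hk v := by
  have hup : ∀ (j : Strip) (h : x.1 ∈ Piece.up.set) (h' : x.1 ∈ (Piece.strip j).set)
      (w : L.fib basePoint), L.chart .up h w = L.chart (.strip j) h' w := fun j h h' w => by
    refine L.chart_eq_of_chart_eq j.above_mem_up j.above_mem h h' ?_
    refine Eq.trans ?_ (L.chart_entry (.strip j) w).symm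
    rw [chart, access, transport_trans]
    exact congr_arg _ (L.transport_refl _ w)
  have hlow : ∀ (j : Strip) (h : x.1 ∈ Piece.low.set) (h' : x.1 ∈ (Piece.strip j).set)
      (w : L.fib basePoint), L.chart .low h ((L.stripMonodromy j).1 w) = L.chart (.strip j) h' w :=
    fun j h h' w => L.chart_eq_of_chart_eq j.below_mem_low j.below_mem h h'
      (L.chart_stripMonodromy j w)
  have hof : ∀ j, L.rep (.of j) = L.stripMonodromy j := fun j => FreeGroup.lift_apply_of
  rcases i with _ | _ | i <;> rcases k with _ | _ | k
  · simp only [Piece.change, map_one]; rfl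
  · exact (Piece.not_mem_up_low hi hk).elim
  · simp only [Piece.change, map_one]; exact hup k hi hk v
  · exact (Piece.not_mem_up_low hk hi).elim
  · simp only [Piece.change, map_one]; rfl
  · simp only [Piece.change, hof]; exact hlow k hi hk v
  · simp only [Piece.change, map_one]; exact (hup i hk hi v).symm
  · simp only [Piece.change, map_inv, hof]
    rw [← hlow i hk hi]
    exact congr_arg _ (LinearEquiv.congr_fun (congr_arg Subtype.val
      (mul_inv_cancel (L.stripMonodromy i))) v)
  · obtain rfl := Piece.strip_eq_of_mem hi hk
    simp only [Piece.change, map_one]; rfl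

/-- The identification of the fibres with the fibre at the base point. -/
def chartAt (x : PuncturedLine) : L.fib basePoint ≃ₗ[R] L.fib x := L.chart _ (Piece.mem_index x.2)

theorem transport_chartAt {x y : PuncturedLine} (γ : Path x y) (v : L.fib basePoint) :
    L.transport γ (L.chartAt x v) = L.chartAt y ((L.rep (winding (.mk γ))).1 v) := by
  refine path_induction (D := Set.univ) isOpen_pieceSet iUnion_pieceSet
    (P := fun {x y} γ => ∀ v, L.transport γ (L.chartAt x v) =
      L.chartAt y ((L.rep (winding (.mk γ))).1 v)) (fun h hP => ?_)
    (fun {x y z γ γ'} h h' v => ?_) (fun {x y} γ i _ hi v => ?_) γ (fun _ => trivial) v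
  · rwa [← L.transport_congr h, ← Path.Homotopic.Quotient.eq.2 h]
  · rw [transport_trans, h, h', Path.Homotopic.Quotient.mk_trans, winding_trans, map_mul]
    rfl
  · have hx : x.1 ∈ i.set := by simpa [pieceSet] using hi 0
    have hy : y.1 ∈ i.set := by simpa [pieceSet] using hi 1
    rw [winding_piece γ i hi, map_mul]
    change _ = L.chart _ (Piece.mem_index y.2) ((L.rep _).1 ((L.rep _).1 v))
    rw [L.chart_change (Piece.mem_index y.2) hy, ← L.transport_chart hx hy γ hi,
      L.chart_change hx (Piece.mem_index x.2)]
    rfl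

end LocalSystem

namespace BettiPoint

variable {R : Type u} [CommRing R] (L : BettiPoint R)

/-- A point of the punctured disc in the upper half plane. -/
def discPoint (s : Pt) : puncturedDisc s := (exists_loop s).choose

theorem discPoint_mem (s : Pt) : (discPoint s).1.1 ∈ Piece.up.set :=
  (exists_loop s).choose_spec.choose_spec.2.1

/-- The monodromy data. -/
def toStripData : StripData R where
  bundle := L.sys.fib basePoint
  τ := L.sys.stripMonodromy
  line s := (L.line s (discPoint s)).comap
    (L.sys.chartAt (discPoint s).1 : L.sys.fib basePoint →ₗ[R] L.sys.fib (discPoint s).1)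
  isLine s := (L.isLine s (discPoint s)).comap (L.sys.chartAt (discPoint s).1)
  mem_unipotent s := by
    obtain ⟨γ, hγ, -, hw⟩ := (exists_loop s).choose_spec
    have h : ∀ v, L.sys.chartAt (discPoint s).1
        (((L.sys.stripMonodromy s.rightStrip)⁻¹ * L.sys.stripMonodromy s.leftStrip :
          (L.sys.fib basePoint).slGroup).1 v) =
        L.sys.transport γ (L.sys.chartAt (discPoint s).1 v) := fun v => by
      refine Eq.trans ?_ (L.sys.transport_chartAt γ v).symm
      rw [hw, map_mul, map_inv]
      simp only [LocalSystem.rep, FreeGroup.lift_apply_of]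
      rfl
    refine ⟨fun v hv => (L.sys.chartAt (discPoint s).1).injective ?_, fun v => ?_⟩
    · rw [h]
      exact L.unipotent_sub s (discPoint s) γ hγ _ hv
    · change L.sys.chartAt (discPoint s).1 (_ - _) ∈ L.line s (discPoint s)
      rw [map_sub, h]
      exact L.unipotent_quot s (discPoint s) γ hγ _

/-- Both fields of lines are flat on the punctured disc, which is path connected, and they agree at
the chosen point of it. -/
theorem chartAt_mem_line (s : Pt) (x : puncturedDisc s) (v : L.toStripData.bundle)
    (hv : v ∈ L.toStripData.toBetti.line s x) : L.sys.chartAt x.1 v ∈ L.line s x := by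
  obtain ⟨γ, hγ⟩ := exists_path_of_disc (discPoint s).2 x.2
  obtain ⟨w, rfl⟩ : ∃ w : L.toStripData.bundle, L.toStripData.sys.transport γ w = v :=
    ⟨(L.toStripData.sys.transport γ).symm v, LinearEquiv.apply_symm_apply _ _⟩
  obtain ⟨h, hh, e⟩ := L.toStripData.exists_unipotent γ hγ
  have hv' : h ((L.toStripData.frame s (Piece.index (discPoint s).1.1)).1 w) ∈
      L.toStripData.line s := Eq.mp (congrArg (· ∈ L.toStripData.line s) (e w)) hv
  rw [Piece.index_of_pos (discPoint_mem s)] at hv'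
  have hw : w ∈ L.toStripData.line s := by
    have := sub_mem hv' (hh.2 w)
    exact (sub_sub_self (h w) w) ▸ this
  have := L.flat s (discPoint s) x γ hγ _ hw
  exact (L.sys.transport_chartAt γ w) ▸ this

/-- A Betti point is isomorphic to the one given by its monodromy data. -/
def ofStripData [Algebra ℚ R] : Loc.Hom ⟨R, L.toStripData.toBetti⟩ ⟨R, L⟩ where
  base := AlgHom.id ℚ R
  map x := (L.sys.chartAt x : L.sys.fib basePoint →ₗ[R] L.sys.fib x).toAddMonoidHom
  cart x := IsCart.of_linearEquiv (L.sys.chartAt x) (L.sys.transport_vol _)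
  map_transport _ _ γ v := (L.sys.transport_chartAt γ v).symm
  map_line := L.chartAt_mem_line

end BettiPoint

/-! ### The point of the linearized moduli with given monodromy data -/

/-- After expansion, multiplying by `x` on the left shows that the terms beginning with `x n x`
cancel. Multiplying what is left by `n` on the right then kills `n x n`. -/
theorem mul_eq_neg_mul_of_sq {A : Type*} [Ring A] {x n : A} (hx : x * x = 0) (hn : n * n = 0)
    (h : (x + n + x * n) * (x + n + x * n) = 0) : n * x = -(x * n) := by
  have hx' : ∀ y, x * (x * y) = 0 := fun y => by rw [← mul_assoc, hx, zero_mul]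
  have hn' : ∀ y, n * (n * y) = 0 := fun y => by rw [← mul_assoc, hn, zero_mul]
  have h1 : x * n + n * x + n * x * n + x * n * x + x * n * x * n = 0 := by
    rw [← h]
    simp only [mul_add, add_mul, mul_assoc, hx, hn, hx', zero_add, add_zero, mul_zero]
    abel
  have h2 : x * n * x + x * n * x * n = 0 := by
    have := congr_arg (x * ·) h1
    simpa only [mul_add, mul_assoc, hx, hn, hx', hn', zero_add, add_zero, mul_zero] using this
  have h3 : x * n + n * x + n * x * n = 0 := by
    rw [add_assoc _ (x * n * x), h2, add_zero] at h1
    exact h1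
  have h4 : n * x * n = 0 := by
    have := congr_arg (· * n) h3
    simpa only [add_mul, mul_assoc, hx, hn, hx', hn', zero_add, add_zero, mul_zero, zero_mul]
      using this
  rw [h4, add_zero] at h3
  exact eq_neg_of_add_eq_zero_right h3

namespace StripData

variable {R : Type u} [CommRing R] (M : StripData R)

/-- The endomorphism attached to `0`. -/
def endZero : Module.End R M.bundle := 1 - (M.τ .left).1.toLinearMap

/-- The logarithm of the monodromy around `1`. -/
def endOne : Module.End R M.bundle := (M.τ .right).1.toLinearMap - 1

/-- The endomorphism attached to `∞`. -/
def endInfty : Module.End R M.bundle := 1 - ((M.τ .left)⁻¹ * M.τ .right).1.toLinearMap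

variable {M}

theorem sub_mem_and {ℓ : Submodule R M.bundle} {a : M.bundle ≃ₗ[R] M.bundle}
    (h : a ∈ SLBundle.unipotent ℓ) : (∀ v ∈ ℓ, (1 - a.toLinearMap : Module.End R M.bundle) v = 0) ∧
      ∀ v, (1 - a.toLinearMap : Module.End R M.bundle) v ∈ ℓ :=
  ⟨fun v hv => by rw [LinearMap.sub_apply]; exact sub_eq_zero.2 (h.1 v hv).symm, fun v => by
    rw [LinearMap.sub_apply, ← neg_sub]; exact neg_mem (h.2 v)⟩

theorem mul_self_of_mem {ℓ : Submodule R M.bundle} {N : Module.End R M.bundle}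
    (h : (∀ v ∈ ℓ, N v = 0) ∧ ∀ v, N v ∈ ℓ) : N * N = 0 :=
  LinearMap.ext fun v => h.1 _ (h.2 v)

variable (hM : M.τ .mid = 1)

include hM

theorem endZero_mem : (∀ v ∈ M.line .zero, M.endZero v = 0) ∧ ∀ v, M.endZero v ∈ M.line .zero := by
  have h := M.mem_unipotent .zero
  rw [Pt.leftStrip, Pt.rightStrip, hM, inv_one, one_mul] at h
  exact sub_mem_and h

theorem endOne_mem : (∀ v ∈ M.line .one, M.endOne v = 0) ∧ ∀ v, M.endOne v ∈ M.line .one := by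
  have h := M.mem_unipotent .one
  rw [Pt.leftStrip, Pt.rightStrip, hM, mul_one, Subgroup.coe_inv, inv_mem_iff] at h
  have h' := sub_mem_and h
  have e : ∀ v, M.endOne v = -(1 - (M.τ .right).1.toLinearMap : Module.End R M.bundle) v :=
    fun v => (neg_sub _ _).symm
  exact ⟨fun v hv => by rw [e, h'.1 v hv, neg_zero], fun v => by rw [e]; exact neg_mem (h'.2 v)⟩

omit hM in
theorem endInfty_mem :
    (∀ v ∈ M.line .infty, M.endInfty v = 0) ∧ ∀ v, M.endInfty v ∈ M.line .infty :=
  sub_mem_and (M.mem_unipotent .infty)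

/-- As `endZero` squares to zero, `τ_left⁻¹ = 1 + endZero`; it remains to expand its product with
`τ_right = 1 + endOne`. -/
theorem endInfty_eq :
    M.endInfty = -(M.endZero + M.endOne + M.endZero * M.endOne) := by
  have h0 := mul_self_of_mem (endZero_mem hM)
  have h : ((M.τ .left)⁻¹).1.toLinearMap = (1 + M.endZero : Module.End R M.bundle) := by
    refine LinearMap.ext fun v => (M.τ .left).1.injective ?_
    have e1 : (M.τ .left).1 (((M.τ .left)⁻¹).1 v) = v :=
      LinearEquiv.congr_fun (congr_arg Subtype.val (mul_inv_cancel (M.τ .left))) v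
    refine e1.trans ?_
    have e2 : ((M.τ .left).1.toLinearMap : Module.End R M.bundle) = 1 - M.endZero := by
      rw [endZero, sub_sub_cancel]
    refine Eq.trans ?_ (LinearMap.congr_fun e2 _).symm
    have e3 : (1 - M.endZero) * (1 + M.endZero) = 1 := by
      rw [sub_mul, one_mul, mul_add, mul_one, h0, add_zero, add_sub_cancel_right]
    exact (LinearMap.congr_fun e3 v).symm
  have h' : ((M.τ .right).1.toLinearMap : Module.End R M.bundle) = 1 + M.endOne := by
    rw [endOne, add_sub_cancel]
  have h'' : (((M.τ .left)⁻¹ * M.τ .right).1.toLinearMap : Module.End R M.bundle) =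
      ((M.τ .left)⁻¹).1.toLinearMap * (M.τ .right).1.toLinearMap := rfl
  rw [endInfty, h'', h, h']
  simp only [add_mul, mul_add, one_mul, mul_one]
  abel

theorem endOne_endZero (v : M.bundle) : M.endOne (M.endZero v) = -M.endZero (M.endOne v) := by
  have h := mul_self_of_mem (M.endInfty_mem)
  rw [endInfty_eq hM, neg_mul_neg] at h
  exact LinearMap.congr_fun (mul_eq_neg_mul_of_sq (mul_self_of_mem (endZero_mem hM))
    (mul_self_of_mem (endOne_mem hM)) h) v

variable [Algebra ℚ R]

/-- The automorphism `1 - B₀ / 2`. -/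
def twist : M.bundle ≃ₗ[R] M.bundle :=
  SLBundle.oneAdd (-half R • M.endZero) fun v => by
    simp [(endZero_mem hM).1 _ ((endZero_mem hM).2 v)]

theorem twist_apply (v : M.bundle) : twist hM v = v - half R • M.endZero v := by
  rw [twist, SLBundle.oneAdd_apply, LinearMap.smul_apply, neg_smul, sub_eq_add_neg]

/-- By anticommutation `(1 + x/2) n (1 - x/2) = n + x n`, exactly the term that makes the three
endomorphisms sum to zero. -/
theorem twist_symm_endOne (v : M.bundle) :
    (twist hM).symm (M.endOne (twist hM v)) = M.endOne v + M.endZero (M.endOne v) := by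
  rw [LinearEquiv.symm_apply_eq, twist_apply, twist_apply, map_sub, map_smul, endOne_endZero hM,
    map_add, (endZero_mem hM).1 _ ((endZero_mem hM).2 _), add_zero, smul_neg, sub_neg_eq_add]
  have h : M.endZero (M.endOne v) =
      half R • M.endZero (M.endOne v) + half R • M.endZero (M.endOne v) := by
    rw [← add_smul, half_add_half, one_smul]
  nth_rewrite 2 [h]
  abel

/-- The lines of the point of the linearized moduli with the given monodromy data. -/
def cotangentLine : Pt → Submodule R M.bundle
  | .zero => M.line .zero
  | .one => (M.line .one).comap (twist hM : M.bundle →ₗ[R] M.bundle)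
  | .infty => M.line .infty

/-- The endomorphisms of the point of the linearized moduli with the given monodromy data. -/
def cotangentEnd : Pt → Module.End R M.bundle
  | .zero => M.endZero
  | .one => (twist hM).symm.toLinearMap ∘ₗ M.endOne ∘ₗ (twist hM).toLinearMap
  | .infty => M.endInfty

/-- The point of the linearized moduli with the given monodromy data. -/
def toCotangentPoint : CotangentPoint R where
  bundle := M.bundle
  line := cotangentLine hM
  isLine
    | .zero => M.isLine .zero
    | .one => (M.isLine .one).comap _
    | .infty => M.isLine .infty
  B := cotangentEnd hM
  B_line
    | .zero => (endZero_mem hM).1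
    | .one => fun v hv => by
      have h : M.endOne (twist hM v) = 0 := (endOne_mem hM).1 _ hv
      exact (congr_arg (twist hM).symm h).trans (map_zero _)
    | .infty => endInfty_mem.1
  B_mem
    | .zero => (endZero_mem hM).2
    | .one => fun v => by
      change twist hM ((twist hM).symm (M.endOne (twist hM v))) ∈ M.line .one
      rw [LinearEquiv.apply_symm_apply]
      exact (endOne_mem hM).2 _
    | .infty => endInfty_mem.2
  sum_eq_zero := LinearMap.ext fun v => by
    change M.endZero v + (twist hM).symm (M.endOne (twist hM v)) + M.endInfty v = 0
    rw [twist_symm_endOne, endInfty_eq hM]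
    change _ + -(M.endZero v + M.endOne v + M.endZero (M.endOne v)) = (0 : M.bundle)
    abel

theorem stripMonodromy_toCotangentPoint (j : Strip) (v : M.bundle) :
    ((toCotangentPoint hM).stripMonodromy j).1 v = (M.τ j).1 v := by
  cases j with
  | left =>
    refine ((toCotangentPoint hM).stripMonodromy_left_apply v).trans ?_
    exact sub_sub_cancel (v : M.bundle) ((M.τ .left).1 v)
  | mid => rw [hM]; rfl
  | right =>
    change v + twist hM ((twist hM).symm (M.endOne (twist hM ((twist hM).symm v)))) = _
    rw [LinearEquiv.apply_symm_apply, LinearEquiv.apply_symm_apply]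
    exact add_sub_cancel (v : M.bundle) ((M.τ .right).1 v)

theorem stripLine_toCotangentPoint (s : Pt) (v : M.bundle)
    (hv : v ∈ (toCotangentPoint hM).stripLine s) : v ∈ M.line s := by
  cases s with
  | zero => exact hv
  | one =>
    obtain ⟨w, hw, rfl⟩ : ∃ w : M.bundle, twist hM w ∈ M.line .one ∧ twist hM w = v := hv
    exact hw
  | infty => exact hv

/-- The monodromy data of the point of the linearized moduli are the given ones. -/
def ofCotangentPoint :
    Loc.Hom ⟨R, (toCotangentPoint hM).toStripData.toBetti⟩ ⟨R, M.toBetti⟩ :=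
  StripData.hom (M := (toCotangentPoint hM).toStripData) (AlgHom.id ℚ R)
    (AddMonoidHom.id M.bundle) (IsCart.id M.bundle) (stripMonodromy_toCotangentPoint hM)
    (stripLine_toCotangentPoint hM)

end StripData

instance : Cotangent.toLoc.{u}.EssSurj where
  mem_essImage L := by
    have hM : L.pt.toStripData.τ .mid = 1 := L.pt.sys.stripMonodromy_mid
    let F : Cotangent.toLoc.obj ⟨L.ring, StripData.toCotangentPoint hM⟩ ⟶ L :=
      CategoryStruct.comp (Y := (⟨L.ring, L.pt.toStripData.toBetti⟩ : Loc.{u}))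
        (StripData.ofCotangentPoint hM) L.pt.ofStripData
    have : IsIso F := Loc.isIso_of_base F (AlgHom.id ℚ L.ring) rfl rfl
    exact ⟨_, ⟨asIso F⟩⟩

instance : Cotangent.toLoc.{u}.IsEquivalence where

/-- The Betti moduli and the linearized moduli are isomorphic over `BSL(2)`. -/
theorem isIsomorphicOver_loc (u₀ : PuncturedLine) :
    IsIsomorphicOver (Loc.toBSL.{u} u₀) Cotangent.toBSL.{u} :=
  isIsomorphicOver_of_isEquivalence Cotangent.toLoc (Cotangent.toLocIso u₀)

end Spectral

end

theorem corollaryc (u₀ : Spectral.PuncturedLine) (s : Spectral.Pt) :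
    Spectral.IsIsomorphicOver (Spectral.Loc.toBSL.{u} u₀) Spectral.Cotangent.toBSL.{u} ∧
    Spectral.IsIsomorphicOver (Spectral.Conn.toBSL.{u} s) Spectral.Cotangent.toBSL.{u} ∧
    Spectral.IsIsomorphicOver (Spectral.Loc.toBSL.{u} u₀) (Spectral.Conn.toBSL.{u} s) ∧
    ∀ ε : Spectral.Pt → Bool,
      Spectral.IsCompleteIntersection (Spectral.prodIdeal ε) 3 ∧
      Spectral.IsCompleteIntersection (Spectral.sumIdeal ε) 3 := by
  have h₁ := Spectral.isIsomorphicOver_loc.{u} u₀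
  have h₂ := Spectral.isIsomorphicOver_conn.{u} s
  exact ⟨h₁, h₂, h₁.trans h₂.symm, fun ε => ⟨Spectral.isCompleteIntersection_prodIdeal ε,
    Spectral.isCompleteIntersection_sumIdeal ε⟩⟩
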